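/- Let $n\ge 1$ and let $Q\subset\mathbb R^2$ be a convex $(n+2)$-gon with vertices $v_i=(a_i,f_i)$, $0\le i\le n+1$, where $a_0<a_1<\dots<a_{n+1}$ and $f_0=f_{n+1}=0$. (Then $f_i\neq 0$ for $i\in[n]$; call $i$ an up index if $f_i>0$ and a down index if $f_i<0$.) Let $\Delta\subset\mathbb R^{n+2}$ be the simplex with vertices the standard basis vectors $e_0,\dots,e_{n+1}$, let $\varphi$ be the linear map with $\varphi(e_i)=v_i$, and let $\rho(a,f)=a$, so that $\Delta\xrightarrow{\varphi}Q\xrightarrow{\rho}I=[a_0,a_{n+1}]$. For a linear map $\psi$ and a polytope $P$, the fiber polytope $\Sigma(P\to\psi(P))$ is the set of all averages over $\psi(P)$ (with respect to volume in the dimension of $\psi(P)$) of measurable sections of $\psi:P\to\psi(P)$. Put $\Sigma(\Delta\to Q\to I)=\Sigma\big(\Sigma(\Delta\to I)\to\Sigma(Q\to I)\big)$, the map being $\varphi$, where $\Sigma(Q\to I)=\varphi(\Sigma(\Delta\to I))$. The normal cone of a polytope at a vertex is the set of linear functionals that attain their maximum over the polytope at that vertex. - A triangulation $T$ of $Q$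 (a maximal set of non-crossing chords of $Q$, the sides of $Q$ included) gives the vertex $\Phi_T$ of $\Sigma(\Delta\to Q)$ that is the average of the section of $\varphi$ with values in the union of the faces $\mathrm{conv}(e_i,e_j,e_k)$ of $\Delta$, where $v_iv_jv_k$ runs over the triangles of $T$. - A set $H\subseteq[n]$ gives the vertex $\Phi_H$ of $\Sigma(\Delta\to I)$ that is the average of the section of $\rho\circ\varphi$ with values in the union of the edges $e_ie_j$, for $i<j$ consecutive elements of $H\cup\{0,n+1\}$. - A permutation $x=x_1\cdots x_n$ of $[n]$ gives the monotone path $H_0\to H_1\to\dots\to H_n$, where $H_0$ is the set of down indices and $H_k=H_{k-1}\,\triangle\,\{x_k\}$, and the vertex $\Psi_x$ of $\Sigma(\Delta\to Q\to I)$ that is the average of the section of $\varphi$ with values in the path $\bigcup_k[\Phi_{H_{k-1}},\Phi_{H_k}]$. Then for every permutation $x$ of $[n]$ there is exactly one triangulation $T=\eta_f(x)$ of $Q$ such that the normal cone of $\Sigma(\Delta\to Q\to I)$ at $\Psi_x$ is contained in the normal cone of $\Sigma(\Delta\to Q)$ at $\Phi_T$. Its chords are the chords $v_iv_j$ with $i<j$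 consecutive in $H_k\cup\{0,n+1\}$ for some $0\le k\le n$. The fibers of $\eta_f$ are the congruence classes of a lattice congruence $\Theta_f$ of the right weak order on $S_n$ (the order by containment of the inversion sets $\{(x_j,x_i): i<j,\ x_i>x_j\}$, which is a lattice). Let $s_i=(i,i+1)$, and let $\vec G_f$ be the orientation of the Coxeter diagram of $S_n$ in which, for $2\le b\le n-1$, there is the arrow $s_b\to s_{b-1}$ if $b$ is an up index and the arrow $s_{b-1}\to s_b$ if $b$ is a down index. For an orientation $\vec G$, the Cambrian congruence $\Theta(\vec G)$ is the smallest lattice congruence of the weak order such that for every arrow $s\to t$ the element $t$ is equivalent to the product of the word $tsts\cdots$ with $m(s,t)-1$ letters (here $m(s,t)=3$, so $t\equiv ts$), and the Cambrian lattice $\mathcal C(\vec G)$ is the quotient of the weak order by $\Theta(\vec G)$. Then $\Theta_f=\Theta(\vec G_f)$, and consequently $S_n/\Theta_f=\mathcal C(\vec G_f)$. -/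

import Mathlib

open MeasureTheory

/-! ## Lattice congruences, generated congruences and quotient lattices -/

namespace LatticeCon

/-- The smallest lattice congruence `Θ` with `a ≡ b mod Θ` whenever `r a b`
(the intersection of all lattice congruences with this property). -/
def generate {α : Type*} [Lattice α] (r : α → α → Prop) : LatticeCon α where
  r x y := ∀ Θ : LatticeCon α, (∀ a b, r a b → Θ.r a b) → Θ.r x y
  iseqv :=
    { refl := fun x Θ _ => Θ.refl x
      symm := fun h Θ hΘ => Θ.symm (h Θ hΘ)
      trans := fun h₁ h₂ Θ hΘ => Θ.trans (h₁ Θ hΘ) (h₂ Θ hΘ) }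
  inf := fun h₁ h₂ Θ hΘ => Θ.inf (h₁ Θ hΘ) (h₂ Θ hΘ)
  sup := fun h₁ h₂ Θ hΘ => Θ.sup (h₁ Θ hΘ) (h₂ Θ hΘ)

/-- The set of congruence classes of a lattice congruence. -/
def Quot {α : Type*} [Lattice α] (Θ : LatticeCon α) : Type _ := Quotient Θ.toSetoid

/-- The congruence class of an element. -/
def Quot.mk {α : Type*} [Lattice α] (Θ : LatticeCon α) (a : α) : Θ.Quot :=
  Quotient.mk Θ.toSetoid a

/-- The quotient lattice: `[a] ⊔ [b] = [a ⊔ b]` and `[a] ⊓ [b] = [a ⊓ b]`. -/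
instance Quot.instLattice {α : Type*} [Lattice α] (Θ : LatticeCon α) : Lattice Θ.Quot :=
  letI : Max Θ.Quot := ⟨Quotient.map₂ (· ⊔ ·) fun _ _ h₁ _ _ h₂ => Θ.sup h₁ h₂⟩
  letI : Min Θ.Quot := ⟨Quotient.map₂ (· ⊓ ·) fun _ _ h₁ _ _ h₂ => Θ.inf h₁ h₂⟩
  Lattice.mk'
    (by rintro ⟨a⟩ ⟨b⟩; exact congrArg (Quotient.mk _) (sup_comm a b))
    (by rintro ⟨a⟩ ⟨b⟩ ⟨c⟩; exact congrArg (Quotient.mk _) (sup_assoc a b c))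
    (by rintro ⟨a⟩ ⟨b⟩; exact congrArg (Quotient.mk _) (inf_comm a b))
    (by rintro ⟨a⟩ ⟨b⟩ ⟨c⟩; exact congrArg (Quotient.mk _) (inf_assoc a b c))
    (by rintro ⟨a⟩ ⟨b⟩; exact congrArg (Quotient.mk _) sup_inf_self)
    (by rintro ⟨a⟩ ⟨b⟩; exact congrArg (Quotient.mk _) inf_sup_self)

end LatticeCon

/-! ## The (right) weak order on the symmetric group -/

namespace WeakOrder

/-- The pair of values `a < b` is an inversion of the permutation `x`, written in one-line
notation as `x 0, x 1, …`: the larger value `b` occurs to the left of the smaller value `a`. -/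
def Inv {n : ℕ} (x : Equiv.Perm (Fin n)) (a b : Fin n) : Prop :=
  a < b ∧ x.symm b < x.symm a

/-- The right weak order: containment of left inversion sets. -/
instance instLE {n : ℕ} : LE (Equiv.Perm (Fin n)) where
  le x y := ∀ a b, Inv x a b → Inv y a b

theorem le_def {n : ℕ} {x y : Equiv.Perm (Fin n)} :
    x ≤ y ↔ ∀ a b, Inv x a b → Inv y a b := Iff.rfl

theorem inv_trans {n : ℕ} {x : Equiv.Perm (Fin n)} {a b c : Fin n}
    (h₁ : Inv x a b) (h₂ : Inv x b c) : Inv x a c :=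
  ⟨h₁.1.trans h₂.1, h₂.2.trans h₁.2⟩

theorem inv_cotrans {n : ℕ} {x : Equiv.Perm (Fin n)} {a b c : Fin n}
    (h : Inv x a c) (hab : a < b) (hbc : b < c) : Inv x a b ∨ Inv x b c := by
  rcases lt_or_ge (x.symm b) (x.symm a) with h1 | h1
  · exact Or.inl ⟨hab, h1⟩
  · exact Or.inr ⟨hbc, h.2.trans_le h1⟩

theorem eq_of_inv_iff {n : ℕ} {x y : Equiv.Perm (Fin n)}
    (h : ∀ a b, Inv x a b ↔ Inv y a b) : x = y := by
  have key : ∀ a b, x.symm a < x.symm b ↔ y.symm a < y.symm b := by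
    intro a b
    rcases lt_trichotomy a b with hab | hab | hab
    · have h1 := h a b
      simp only [Inv, hab, true_and] at h1
      have hx : x.symm a ≠ x.symm b := fun e => hab.ne (x.symm.injective e)
      have hy : y.symm a ≠ y.symm b := fun e => hab.ne (y.symm.injective e)
      constructor
      · intro h2
        exact lt_of_le_of_ne (not_lt.1 fun h3 => (h1.2 h3).asymm h2) hy
      · intro h2
        exact lt_of_le_of_ne (not_lt.1 fun h3 => (h1.1 h3).asymm h2) hx
    · subst hab; simp
    · have h1 := h b a
      simpa only [Inv, hab, true_and] using h1
  have hm : StrictMono (fun i => y.symm (x i)) := by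
    intro i j hij
    have := key (x i) (x j)
    simp only [Equiv.symm_apply_apply] at this
    exact this.1 hij
  have hid : ∀ i, y.symm (x i) = i := by
    intro i
    have h1 : StrictMono (⇑(x.trans y.symm)) := hm
    have h2 := Subsingleton.elim (h1.orderIsoOfSurjective _ (x.trans y.symm).surjective)
      (OrderIso.refl (Fin n))
    exact congrArg (fun e : Fin n ≃o Fin n => e i) h2
  ext i
  have := hid i
  rw [Equiv.symm_apply_eq] at this
  rw [this]

instance instPartialOrder {n : ℕ} : PartialOrder (Equiv.Perm (Fin n)) where
  le_refl _ _ _ h := h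
  le_trans _ _ _ h₁ h₂ a b h := h₂ a b (h₁ a b h)
  le_antisymm _ _ h₁ h₂ := eq_of_inv_iff fun a b => ⟨h₁ a b, h₂ a b⟩

/-- A transitive and cotransitive set of pairs `a < b` is an inversion set. -/
theorem exists_perm {n : ℕ} (I : Fin n → Fin n → Prop)
    (hlt : ∀ a b, I a b → a < b) (htr : ∀ a b c, I a b → I b c → I a c)
    (hco : ∀ a b c, I a c → a < b → b < c → I a b ∨ I b c) :
    ∃ x : Equiv.Perm (Fin n), ∀ a b, Inv x a b ↔ I a b := by
  classical
  let R : Fin n → Fin n → Prop := fun a b => (a < b ∧ ¬ I a b) ∨ (b < a ∧ I b a)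
  have Rirr : ∀ a, ¬ R a a := by
    intro a h
    rcases h with h | h <;> exact lt_irrefl _ h.1
  have Rtri : ∀ a b, a ≠ b → R a b ∨ R b a := by
    intro a b hab
    by_cases h1 : a < b
    · by_cases h2 : I a b
      · exact Or.inr (Or.inr ⟨h1, h2⟩)
      · exact Or.inl (Or.inl ⟨h1, h2⟩)
    · have h1 : b < a := lt_of_le_of_ne (not_lt.1 h1) hab.symm
      by_cases h2 : I b a
      · exact Or.inl (Or.inr ⟨h1, h2⟩)
      · exact Or.inr (Or.inl ⟨h1, h2⟩)
  have Rasymm : ∀ a b, R a b → ¬ R b a := by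
    rintro a b (h | h) (h' | h')
    · exact h.1.asymm h'.1
    · exact h.2 h'.2
    · exact h'.2 h.2
    · exact h.1.asymm h'.1
  have Rtrans : ∀ a b c, R a b → R b c → R a c := by
    intro a b c h1 h2
    have hac : a ≠ c := by rintro rfl; exact Rasymm _ _ h1 h2
    rcases h1 with ⟨h1, i1⟩ | ⟨h1, i1⟩ <;> rcases h2 with ⟨h2, i2⟩ | ⟨h2, i2⟩
    · refine Or.inl ⟨h1.trans h2, fun h => ?_⟩
      rcases hco a b c h h1 h2 with h | h
      exacts [i1 h, i2 h]
    · rcases lt_or_gt_of_ne hac with h | h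
      · exact Or.inl ⟨h, fun h3 => i1 (htr _ _ _ h3 i2)⟩
      · rcases hco c a b i2 h h1 with h3 | h3
        · exact Or.inr ⟨h, h3⟩
        · exact absurd h3 i1
    · rcases lt_or_gt_of_ne hac with h | h
      · exact Or.inl ⟨h, fun h3 => i2 (htr _ _ _ i1 h3)⟩
      · rcases hco b c a i1 h2 h with h3 | h3
        · exact absurd h3 i2
        · exact Or.inr ⟨h, h3⟩
    · exact Or.inr ⟨h2.trans h1, htr _ _ _ i2 i1⟩
  let S : Fin n → Finset (Fin n) := fun a => Finset.univ.filter fun c => R c a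
  have hS : ∀ a b, R a b → (S a).card < (S b).card := by
    intro a b hab
    apply Finset.card_lt_card
    refine ⟨fun c hc => ?_, fun hsub => ?_⟩
    · simp only [S, Finset.mem_filter, Finset.mem_univ, true_and] at hc ⊢
      exact Rtrans _ _ _ hc hab
    · have : a ∈ S a := hsub (by simpa [S] using hab)
      simp only [S, Finset.mem_filter, Finset.mem_univ, true_and] at this
      exact Rirr _ this
  have hSn : ∀ a, (S a).card < n := by
    intro a
    have : (S a).card < (Finset.univ : Finset (Fin n)).card := by
      apply Finset.card_lt_card
      refine ⟨Finset.subset_univ _, fun hsub => ?_⟩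
      have : a ∈ S a := hsub (Finset.mem_univ a)
      simp only [S, Finset.mem_filter, Finset.mem_univ, true_and] at this
      exact Rirr _ this
    simpa using this
  let p : Fin n → Fin n := fun a => ⟨(S a).card, hSn a⟩
  have hp : ∀ a b, p a < p b ↔ R a b := by
    intro a b
    constructor
    · intro h
      by_contra h'
      rcases eq_or_ne a b with rfl | hne
      · exact lt_irrefl _ h
      · rcases Rtri a b hne with h2 | h2
        · exact h' h2
        · exact lt_asymm (hS _ _ h2) h
    · exact fun h => hS _ _ h
  have hinj : Function.Injective p := by
    intro a b hab
    by_contra hne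
    rcases Rtri a b hne with h | h
    · exact (hp _ _ |>.2 h).ne hab
    · exact (hp _ _ |>.2 h).ne hab.symm
  let e : Equiv.Perm (Fin n) := Equiv.ofBijective p (Finite.injective_iff_bijective.1 hinj)
  refine ⟨e.symm, fun a b => ?_⟩
  show (a < b ∧ p b < p a) ↔ I a b
  rw [hp]
  constructor
  · rintro ⟨h1, h2 | h2⟩
    · exact absurd h2.1 h1.asymm
    · exact h2.2
  · exact fun h => ⟨hlt _ _ h, Or.inr ⟨hlt _ _ h, h⟩⟩

theorem exists_isLUB {n : ℕ} (x y : Equiv.Perm (Fin n)) :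
    ∃ z : Equiv.Perm (Fin n), x ≤ z ∧ y ≤ z ∧ ∀ w, x ≤ w → y ≤ w → z ≤ w := by
  let U : Fin n → Fin n → Prop := fun a b => Inv x a b ∨ Inv y a b
  have hU : ∀ a b, U a b → a < b := by
    rintro a b (h | h) <;> exact h.1
  have hUco : ∀ a b c, U a c → a < b → b < c → U a b ∨ U b c := by
    rintro a b c (h | h) h1 h2
    · rcases inv_cotrans h h1 h2 with h | h
      exacts [Or.inl (Or.inl h), Or.inr (Or.inl h)]
    · rcases inv_cotrans h h1 h2 with h | h
      exacts [Or.inl (Or.inr h), Or.inr (Or.inr h)]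
  have hlt : ∀ a b, Relation.TransGen U a b → a < b := by
    intro a b h
    induction h with
    | single h => exact hU _ _ h
    | tail _ h ih => exact ih.trans (hU _ _ h)
  obtain ⟨z, hz⟩ := exists_perm (Relation.TransGen U) hlt
    (fun _ _ _ h₁ h₂ => h₁.trans h₂)
    (by
      intro a b c h
      induction h with
      | single h =>
        intro h1 h2
        rcases hUco _ _ _ h h1 h2 with h | h
        exacts [Or.inl (.single h), Or.inr (.single h)]
      | @tail d c hd hc ih =>
        intro h1 h2
        rcases lt_trichotomy b d with h3 | h3 | h3
        · rcases ih h1 h3 with h | h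
          exacts [Or.inl h, Or.inr (h.tail hc)]
        · subst h3
          exact Or.inl hd
        · rcases hUco _ _ _ hc h3 h2 with h | h
          exacts [Or.inl (hd.tail h), Or.inr (.single h)])
  refine ⟨z, fun a b h => (hz a b).2 (.single (Or.inl h)),
    fun a b h => (hz a b).2 (.single (Or.inr h)), fun w hx hy a b h => ?_⟩
  have hU' : ∀ c d, U c d → Inv w c d := fun c d hcd => Or.elim hcd (hx c d) (hy c d)
  have key : ∀ d, Relation.TransGen U a d → Inv w a d := by
    intro d hd
    induction hd with
    | single h' => exact hU' _ _ h'
    | tail _ h' ih => exact inv_trans ih (hU' _ _ h')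
  exact key b ((hz a b).1 h)

/-- Reversal of the one-line notation; it complements inversion sets. -/
def rev {n : ℕ} (x : Equiv.Perm (Fin n)) : Equiv.Perm (Fin n) := x * Fin.revPerm

theorem inv_rev {n : ℕ} (x : Equiv.Perm (Fin n)) (a b : Fin n) :
    Inv (rev x) a b ↔ a < b ∧ ¬ Inv x a b := by
  have h : ∀ c, (rev x).symm c = Fin.rev (x.symm c) := fun c => rfl
  simp only [Inv, h, Fin.rev_lt_rev]
  constructor
  · rintro ⟨h1, h2⟩
    exact ⟨h1, fun h3 => h3.2.asymm h2⟩
  · rintro ⟨h1, h2⟩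
    refine ⟨h1, lt_of_le_of_ne (not_lt.1 fun h3 => h2 ⟨h1, h3⟩) fun e => ?_⟩
    exact h1.ne (x.symm.injective e)

theorem rev_rev {n : ℕ} (x : Equiv.Perm (Fin n)) : rev (rev x) = x := by
  ext i
  simp [rev, Equiv.Perm.mul_apply]

theorem rev_le_rev {n : ℕ} {x y : Equiv.Perm (Fin n)} (h : x ≤ y) : rev y ≤ rev x := by
  intro a b hab
  rw [inv_rev] at hab ⊢
  exact ⟨hab.1, fun h' => hab.2 (h a b h')⟩

/-- The weak order on the symmetric group is a lattice. -/
noncomputable instance instLattice {n : ℕ} : Lattice (Equiv.Perm (Fin n)) where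
  sup x y := (exists_isLUB x y).choose
  le_sup_left x y := (exists_isLUB x y).choose_spec.1
  le_sup_right x y := (exists_isLUB x y).choose_spec.2.1
  sup_le x y z h₁ h₂ := (exists_isLUB x y).choose_spec.2.2 z h₁ h₂
  inf x y := rev (exists_isLUB (rev x) (rev y)).choose
  inf_le_left x y := by
    have := rev_le_rev (exists_isLUB (rev x) (rev y)).choose_spec.1
    rwa [rev_rev] at this
  inf_le_right x y := by
    have := rev_le_rev (exists_isLUB (rev x) (rev y)).choose_spec.2.1
    rwa [rev_rev] at this
  le_inf z x y h₁ h₂ := by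
    have := rev_le_rev ((exists_isLUB (rev x) (rev y)).choose_spec.2.2 (rev z)
      (rev_le_rev h₁) (rev_le_rev h₂))
    rwa [rev_rev] at this

end WeakOrder

/-! ## Cambrian congruences and Cambrian lattices -/

/-- An orientation of the Coxeter diagram of `M`: one directed edge for each edge of the diagram
(the edges are the pairs `s ≠ t` with `m(s,t) ≠ 2`), and no other directed edges. -/
structure DiagramOrientation {B : Type*} (M : CoxeterMatrix B) where
  /-- the directed edges `s → t` -/
  arrow : B → B → Prop
  edge : ∀ s t, arrow s t → s ≠ t ∧ M s t ≠ 2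
  total : ∀ s t, s ≠ t → M s t ≠ 2 → arrow s t ∨ arrow t s
  asymm : ∀ s t, arrow s t → ¬ arrow t s

/-- The product of the word `t s t s ⋯` with `k` letters. -/
def alternatingProd {W : Type*} [Group W] (t s : W) (k : ℕ) : W :=
  ((List.range k).map fun i => if Even i then t else s).prod

/-- The simple reflection of `S_n` that exchanges the neighbours `i` and `i + 1`. -/
def simpleRefl (n : ℕ) (i : Fin (n - 1)) : Equiv.Perm (Fin n) :=
  Equiv.swap ⟨i, by omega⟩ ⟨i + 1, by omega⟩

/-- The Cambrian congruence of the weak order on `S_n` for an orientation of its Coxeter diagram: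
the smallest lattice congruence such that, for every directed edge `s → t`, the simple reflection
`t` is equivalent to the element `t s t s ⋯` with `m(s,t) - 1` letters. -/
noncomputable def cambrianCon {n : ℕ} (G : DiagramOrientation (CoxeterMatrix.A (n - 1))) :
    LatticeCon (Equiv.Perm (Fin n)) :=
  LatticeCon.generate fun x y => ∃ s t, G.arrow s t ∧ x = simpleRefl n t ∧
    y = alternatingProd (simpleRefl n t) (simpleRefl n s) (CoxeterMatrix.A (n - 1) s t - 1)

/-- The Cambrian lattice: the weak order modulo the Cambrian congruence. -/
abbrev CambrianLattice {n : ℕ} (G : DiagramOrientation (CoxeterMatrix.A (n - 1))) : Type :=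
  (cambrianCon G).Quot

/-! ## Fiber polytopes and normal cones -/

section FiberPolytope

variable {E F : Type*} [NormedAddCommGroup E] [NormedSpace ℝ E]
  [NormedAddCommGroup F] [NormedSpace ℝ F] [MeasurableSpace F] [BorelSpace F]

/-- Volume on the set `B`, in the dimension of its affine span. -/
noncomputable def baseVolume (B : Set F) : Measure F :=
  (μH[(Module.finrank ℝ (vectorSpan ℝ B) : ℝ)]).restrict B

/-- The fiber polytope `Σ(P → ψ(P))`, as the normalized Minkowski integral of the bundle of fibers
of `ψ`: the set of all averages over the base `ψ(P)` of measurable sections of `ψ : P → ψ(P)`. -/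
def fiberPolytope (ψ : E →ₗ[ℝ] F) (P : Set E) : Set E :=
  {y | ∃ γ : F → E, AEStronglyMeasurable γ (baseVolume (ψ '' P)) ∧
    (∀ q ∈ ψ '' P, γ q ∈ P ∧ ψ (γ q) = q) ∧ y = ⨍ q, γ q ∂(baseVolume (ψ '' P))}

/-- If `ψ` maps the polyhedral complex `K` (a union of faces of a polytope) bijectively to its
image, this is the average over `ψ(K)` of the section with values in `K`; it is the vertex of the
fiber polytope that belongs to the subdivision of the base by the images of the cells of `K`. -/
noncomputable def sectionAverage (ψ : E →ₗ[ℝ] F) (K : Set E) : E :=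
  ⨍ q, Function.invFunOn ψ K q ∂(baseVolume (ψ '' K))

/-- The normal cone of the polytope `P` at the point `v`: the linear functionals that attain their
maximum over `P` at `v`. The normal cones at the vertices are the maximal cones of the normal
fan. -/
def normalCone (P : Set E) (v : E) : Set (E →ₗ[ℝ] ℝ) :=
  {w | ∀ y ∈ P, w y ≤ w v}

end FiberPolytope

/-! ## The tower simplex → polygon → interval -/

/-- A convex polygon with vertices `v_i = (a_i, f_i)`, `0 ≤ i ≤ n + 1`, where `a_0 < ⋯ < a_{n+1}`
and `f` is the height above the line through `v_0` and `v_{n+1}`. -/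
structure CambrianPolygon (n : ℕ) where
  /-- the images of the vertices in the interval -/
  a : Fin (n + 2) → ℝ
  /-- the signed heights of the vertices -/
  f : Fin (n + 2) → ℝ
  a_strictMono : StrictMono a
  f_zero : f 0 = 0
  f_last : f (Fin.last (n + 1)) = 0
  convexIndependent : ConvexIndependent ℝ fun i => ((a i, f i) : ℝ × ℝ)

namespace CambrianPolygon

variable {n : ℕ} (Q : CambrianPolygon n)

/-- The vertices of the polygon. -/
def v (i : Fin (n + 2)) : ℝ × ℝ := (Q.a i, Q.f i)

/-- The vertex label of an element of `[n]` (numbered from `0` as an element of `Fin n`): the labels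
strictly between `0` and `n + 1`. -/
def inner (i : Fin n) : Fin (n + 2) := i.succ.castSucc

theorem f_inner_ne_zero (i : Fin n) : Q.f (inner i) ≠ 0 := by
  intro h
  have h0 : Q.a 0 < Q.a (inner i) := Q.a_strictMono (by simp [inner, Fin.lt_def])
  have h1 : Q.a (inner i) < Q.a (Fin.last (n + 1)) :=
    Q.a_strictMono (by simp [inner, Fin.lt_def])
  have hmem : Q.v (inner i) ∈ convexHull ℝ (Q.v '' {0, Fin.last (n + 1)}) := by
    rw [Set.image_pair, convexHull_pair]
    refine ⟨(Q.a (Fin.last (n + 1)) - Q.a (inner i)) / (Q.a (Fin.last (n + 1)) - Q.a 0),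
      (Q.a (inner i) - Q.a 0) / (Q.a (Fin.last (n + 1)) - Q.a 0), ?_, ?_, ?_, ?_⟩
    · apply div_nonneg <;> linarith
    · apply div_nonneg <;> linarith
    · rw [← add_div, div_eq_one_iff_eq (by linarith)]; ring
    · have hne : Q.a (Fin.last (n + 1)) - Q.a 0 ≠ 0 := by linarith
      ext
      · simp only [v, Prod.fst_add, Prod.smul_fst, smul_eq_mul]
        field_simp
        ring
      · simp [v, Q.f_zero, Q.f_last, h]
  have := Q.convexIndependent _ _ hmem
  simp [inner, Fin.ext_iff] at this
  omega

/-- The vertices `e_i` of the simplex. -/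
def e (i : Fin (n + 2)) : Fin (n + 2) → ℝ := Pi.single i 1

/-- The simplex `Δ` with vertices `e_0, …, e_{n+1}`. -/
def simplex (n : ℕ) : Set (Fin (n + 2) → ℝ) := stdSimplex ℝ (Fin (n + 2))

/-- The linear map `φ` with `φ(e_i) = v_i`; it maps `Δ` to the polygon. -/
def φ : (Fin (n + 2) → ℝ) →ₗ[ℝ] ℝ × ℝ := Fintype.linearCombination ℝ Q.v

/-- The linear map `ρ`, with `ρ(v_i) = a_i`; it maps the polygon to an interval. -/
def ρ : ℝ × ℝ →ₗ[ℝ] ℝ := LinearMap.fst ℝ ℝ ℝ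

/-- The fiber polytope `Σ(Δ → Q)` (the associahedron). -/
def associahedron : Set (Fin (n + 2) → ℝ) := fiberPolytope Q.φ (simplex n)

/-- The fiber polytope `Σ(Δ → I)` (a combinatorial cube). -/
def cube : Set (Fin (n + 2) → ℝ) := fiberPolytope (ρ ∘ₗ Q.φ) (simplex n)

/-- The iterated fiber polytope `Σ(Δ → Q → I) = Σ(Σ(Δ → I) → Σ(Q → I))` (the permutohedron);
here `Σ(Q → I)` is the image of `Σ(Δ → I)` under `φ`. -/
def permutohedron : Set (Fin (n + 2) → ℝ) := fiberPolytope Q.φ Q.cube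

/-! ### Triangulations and their maximal normal cones -/

/-- A set of chords of the polygon (pairs of vertices `i < j`), no two of which cross. -/
def NonCrossing (S : Set (Fin (n + 2) × Fin (n + 2))) : Prop :=
  (∀ c ∈ S, c.1 < c.2) ∧ ∀ c ∈ S, ∀ d ∈ S, c ≠ d →
    Disjoint (openSegment ℝ (Q.v c.1) (Q.v c.2)) (openSegment ℝ (Q.v d.1) (Q.v d.2))

/-- Triangulations: maximal non-crossing sets of chords. The sides of the polygon cross no chord,
so such a set consists of all the sides and a maximal set of non-crossing diagonals. -/
def Triangulation : Type := {S : Set (Fin (n + 2) × Fin (n + 2)) // Maximal Q.NonCrossing S}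

variable {Q} in
/-- The faces of the simplex that belong to the triangles of a triangulation. -/
def Triangulation.lift (T : Q.Triangulation) : Set (Fin (n + 2) → ℝ) :=
  ⋃ (i) (j) (k) (_ : (i, j) ∈ T.1 ∧ (j, k) ∈ T.1 ∧ (i, k) ∈ T.1), convexHull ℝ {e i, e j, e k}

variable {Q} in
/-- The vertex of `Σ(Δ → Q)` that corresponds to a triangulation. -/
noncomputable def Triangulation.vertex (T : Q.Triangulation) : Fin (n + 2) → ℝ :=
  sectionAverage Q.φ T.lift

/-! ### Permutations and their maximal normal cones -/

/-- The `k`-th set `H_k` on the monotone path of the permutation `x`: `H_0` is the set of down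
indices, and `H_k` and `H_{k-1}` differ exactly by the `k`-th entry of `x`. -/
def pathSet (x : Equiv.Perm (Fin n)) (k : ℕ) : Set (Fin n) :=
  symmDiff {i | Q.f (inner i) ≤ 0} {i | (x.symm i : ℕ) < k}

/-- The pairs `i < j` of consecutive elements of `H ∪ {0, n + 1}`; these are the steps of the
polygonal path from `v_0` to `v_{n+1}` that visits the vertices in `H` in order. -/
def steps (H : Set (Fin n)) : Set (Fin (n + 2) × Fin (n + 2)) :=
  {c | c.1 ∈ inner '' H ∪ {0, Fin.last (n + 1)} ∧ c.2 ∈ inner '' H ∪ {0, Fin.last (n + 1)} ∧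
    c.1 < c.2 ∧ ∀ m ∈ inner '' H ∪ {0, Fin.last (n + 1)}, ¬ (c.1 < m ∧ m < c.2)}

/-- The vertex of `Σ(Δ → I)` that corresponds to the subdivision of the interval at the points
`a_i` with `i ∈ H`. -/
noncomputable def cubeVertex (H : Set (Fin n)) : Fin (n + 2) → ℝ :=
  sectionAverage (ρ ∘ₗ Q.φ) (⋃ c ∈ steps H, segment ℝ (e c.1) (e c.2))

/-- The monotone path on `Σ(Δ → I)` that corresponds to a permutation. -/
noncomputable def monotonePath (x : Equiv.Perm (Fin n)) : Set (Fin (n + 2) → ℝ) :=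
  ⋃ k : Fin n, segment ℝ (Q.cubeVertex (Q.pathSet x k)) (Q.cubeVertex (Q.pathSet x (k + 1)))

/-- The vertex of `Σ(Δ → Q → I)` that corresponds to a permutation. -/
noncomputable def permVertex (x : Equiv.Perm (Fin n)) : Fin (n + 2) → ℝ :=
  sectionAverage Q.φ (Q.monotonePath x)

/-! ### The orientation given by the polygon -/

/-- The orientation `G_f`: with simple reflections numbered such that `simpleRefl n i` exchanges `i`
and `i + 1` (counted from `0`), the two simple reflections that move the index `b` are joined by
the arrow `(b, b + 1) → (b - 1, b)` if `b` is an up index, and by the opposite arrow if `b` is a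
down index. -/
def orientation : DiagramOrientation (CoxeterMatrix.A (n - 1)) where
  arrow s t :=
    ((t : ℕ) + 1 = s ∧ 0 ≤ Q.f (inner ⟨s, by omega⟩)) ∨
      ((s : ℕ) + 1 = t ∧ Q.f (inner ⟨t, by omega⟩) ≤ 0)
  edge := by
    rintro s t (⟨h, -⟩ | ⟨h, -⟩)
    · have hne : s ≠ t := by rintro rfl; omega
      simp [CoxeterMatrix.A, hne, h]
    · have hne : s ≠ t := by rintro rfl; omega
      simp [CoxeterMatrix.A, hne, h]
  total := by
    intro s t hne h2
    have h3 : (t : ℕ) + 1 = s ∨ (s : ℕ) + 1 = t := by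
      by_contra hc
      simp [CoxeterMatrix.A, hne, hc] at h2
    rcases h3 with h | h
    · rcases le_total 0 (Q.f (inner ⟨s, by omega⟩)) with h' | h'
      · exact Or.inl (Or.inl ⟨h, h'⟩)
      · exact Or.inr (Or.inr ⟨h, h'⟩)
    · rcases le_total 0 (Q.f (inner ⟨t, by omega⟩)) with h' | h'
      · exact Or.inr (Or.inl ⟨h, h'⟩)
      · exact Or.inl (Or.inr ⟨h, h'⟩)
  asymm := by
    rintro s t (⟨h, h1⟩ | ⟨h, h1⟩) (⟨h', h2⟩ | ⟨h', h2⟩)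
    · omega
    · exact Q.f_inner_ne_zero _ (le_antisymm h2 h1)
    · exact Q.f_inner_ne_zero _ (le_antisymm h1 h2)
    · omega

end CambrianPolygon

/-!
The proof has a combinatorial part, about the weak order and the chords of a permutation, and a
geometric part, about triangulations and normal cones. They meet in the set `chords U x` of the
chords `(i, j)` with `i < j` consecutive on one of the paths `H₀, …, Hₙ` of `x`, where `U` is the
set of up indices.

**The Cambrian congruence.** Call the pair `a < b` *forced* in `x` if `(a', b')` is an inversion
of `x` whenever `a ≤ a' < b' ≤ b`, where `a'` is `a` or an up index and `b'` is `b` or a down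
index. The forced pairs are the inversions of a permutation `bot U x ≤ x`, the map `bot U` is
monotone and idempotent, and together with its conjugate `top U` under reversal it makes "`bot U x
= bot U y`" a lattice congruence `botCon U`, which contains the generators `t ≡ ts` of the
Cambrian congruence. Conversely, a congruence with these generators relates `x` and `y` whenever
`y` arises from `x` by undoing a descent `c a` such that some `b` between `a` and `c` stands to
the left of both and is an up index, or stands to the right of both and is a down index
(`rel_of_separates`, by joins and meets with suitable permutations and induction on `c - a`).
Undoing such descents leads from `x` to `bot U x` (`rel_bot`), and none of these steps changes the
chords. As the chords determine `bot U x` (`bot_eq_of_chords_eq`), two permutations are Cambrian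
congruent if and only if they have the same chords (`cambrianCon_iff`).

**Triangulations.** Whether two chords cross depends only on which vertices are up: a vertex
strictly between the end points of a chord lies above the chord if and only if it is an up vertex
(`disjoint_iff_compat`). The paths of `x` move upwards from the lower to the upper boundary of the
polygon, so that the chords of `x` form a triangulation (`isTriang_chords`), whose triangles are
the regions between consecutive paths. For any triangulation, two chords that are neighbours in
the vertical order over a point span a triangle, which gives a section of `φ` over the polygon
(`exists_mem_lift`), unique over all points that lie on no line through two vertices
(`lift_unique`).

**Cones.** A functional in the normal cone of `Ψ_x` is maximal over the fibers of `Σ(Δ → I) → Σ(Q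
→ I)` on the monotone path (`le_monotoneSection`), as otherwise the section could be improved near
a point. The maximum over the fibers is a concave function, so on an edge of the monotone path the
functional minus a suitable multiple of the height attains there its maximum over all of `Σ(Δ →
I)` (`exists_slope`). Therefore it attains its maximum over a fiber of `Δ → Q` between two
consecutive paths on a segment that joins these paths. The segment lies in the face of a triangle
of `x`, and the functional is in the normal cone of `Φ_T` for the triangulation `T` of `x`
(`normalCone_subset`).

For uniqueness, split the height function of each path `H` into its concave part `capPart H`, with
kinks at up vertices, and its convex part `cupPart H`. The functional `liftMap H` lifts each
vertex `(t, s)` of the polygon to the value there of the concave function that is the minimum of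
`capPart H t` and `s - cupPart H t`. By Jensen's inequality it is bounded by this function over
every point of the polygon; for a path `H` of `x`, the first bound is attained on the paths of `x`
above `H`, and the second one on those below `H`, so that `liftMap H` is in the normal cone of
`Ψ_x` (`liftMap_mem_normalCone`). If this normal cone lies in that of some `Φ_T`, the two
triangulations have the same values under these functionals over almost every point, and the
equality cases of Jensen's inequality put the section of `T` over the interior of a triangle of
`x` into the face of this triangle (`support_subset_of_liftMap`). So `T` has all triangles of `x`,
and equals the triangulation of `x` (`permTriangulation_eq`).
-/

/-! ### The projections to the bottom and the top of a Cambrian class -/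

namespace WeakOrder

variable {n : ℕ}

theorem eq_of_le_le {x y : Equiv.Perm (Fin n)} (h : x ≤ y) (h' : y ≤ x) : x = y :=
  le_antisymm h h'

/-- `Forced U x a b` says that the larger value `b` stays to the left of `a` in every permutation of
the Cambrian class of `x`, where `U` is the set of up indices: besides `(a, b)`, all the pairs
obtained by raising `a` to an up index and lowering `b` to a down index are inversions of `x`. -/
def Forced (U : Fin n → Prop) (x : Equiv.Perm (Fin n)) (a b : Fin n) : Prop :=
  a < b ∧ ∀ a' b', a ≤ a' → a' < b' → b' ≤ b → (a' = a ∨ U a') → (b' = b ∨ ¬ U b') → Inv x a' b'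

theorem Forced.inv {U : Fin n → Prop} {x : Equiv.Perm (Fin n)} {a b : Fin n}
    (h : Forced U x a b) : Inv x a b :=
  h.2 a b le_rfl h.1 le_rfl (Or.inl rfl) (Or.inl rfl)

theorem Forced.sub {U : Fin n → Prop} {x : Equiv.Perm (Fin n)} {a b a' b' : Fin n}
    (h : Forced U x a b) (h1 : a ≤ a') (h2 : a' < b') (h3 : b' ≤ b)
    (h4 : a' = a ∨ U a') (h5 : b' = b ∨ ¬ U b') : Forced U x a' b' := by
  refine ⟨h2, fun p q hp hpq hq hUp hUq => h.2 p q (h1.trans hp) hpq (hq.trans h3) ?_ ?_⟩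
  · rcases hUp with rfl | hUp
    exacts [h4, Or.inr hUp]
  · rcases hUq with rfl | hUq
    exacts [h5, Or.inr hUq]

theorem exists_bot (U : Fin n → Prop) (x : Equiv.Perm (Fin n)) :
    ∃ z : Equiv.Perm (Fin n), ∀ a b, Inv z a b ↔ Forced U x a b := by
  apply exists_perm
  · exact fun a b h => h.1
  · intro a b c h1 h2
    refine ⟨h1.1.trans h2.1, fun p q hp hpq hq hUp hUq => ?_⟩
    rcases le_or_gt q b with hqb | hqb
    · refine h1.2 p q hp hpq hqb hUp ?_
      rcases eq_or_lt_of_le hqb with h | h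
      · exact Or.inl h
      · exact Or.inr (hUq.resolve_left (h.trans h2.1).ne)
    rcases le_or_gt b p with hbp | hbp
    · refine h2.2 p q hbp hpq hq ?_ hUq
      rcases eq_or_lt_of_le hbp with h | h
      · exact Or.inl h.symm
      · exact Or.inr (hUp.resolve_left (h1.1.trans h).ne')
    · exact inv_trans (h1.2 p b hp hbp le_rfl hUp (Or.inl rfl))
        (h2.2 b q le_rfl hqb hq (Or.inl rfl) hUq)
  · intro a b c h hab hbc
    by_cases hU : U b
    · exact Or.inr (h.sub hab.le hbc le_rfl (Or.inr hU) (Or.inl rfl))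
    · exact Or.inl (h.sub le_rfl hab hbc.le (Or.inl rfl) (Or.inr hU))

/-- The smallest element of the Cambrian class of `x`. -/
noncomputable def bot (U : Fin n → Prop) (x : Equiv.Perm (Fin n)) : Equiv.Perm (Fin n) :=
  (exists_bot U x).choose

theorem inv_bot (U : Fin n → Prop) (x : Equiv.Perm (Fin n)) (a b : Fin n) :
    Inv (bot U x) a b ↔ Forced U x a b := (exists_bot U x).choose_spec a b

/-- The largest element of the Cambrian class of `x`; reversal exchanges up and down. -/
noncomputable def top (U : Fin n → Prop) (x : Equiv.Perm (Fin n)) : Equiv.Perm (Fin n) :=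
  rev (bot (fun a => ¬ U a) (rev x))

theorem bot_le (U : Fin n → Prop) (x : Equiv.Perm (Fin n)) : bot U x ≤ x :=
  fun a b h => ((inv_bot U x a b).1 h).inv

theorem bot_mono (U : Fin n → Prop) {x y : Equiv.Perm (Fin n)} (h : x ≤ y) :
    bot U x ≤ bot U y := by
  intro a b hab
  rw [inv_bot] at hab ⊢
  exact ⟨hab.1, fun p q h1 h2 h3 h4 h5 => h _ _ (hab.2 p q h1 h2 h3 h4 h5)⟩

theorem bot_bot (U : Fin n → Prop) (x : Equiv.Perm (Fin n)) : bot U (bot U x) = bot U x := by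
  refine eq_of_le_le (bot_le _ _) fun a b hab => ?_
  rw [inv_bot] at hab ⊢
  refine ⟨hab.1, fun p q h1 h2 h3 h4 h5 => ?_⟩
  rw [inv_bot]
  exact hab.sub h1 h2 h3 h4 h5

theorem le_top (U : Fin n → Prop) (x : Equiv.Perm (Fin n)) : x ≤ top U x := by
  have := rev_le_rev (bot_le (fun a => ¬ U a) (rev x))
  rwa [rev_rev] at this

theorem top_mono (U : Fin n → Prop) {x y : Equiv.Perm (Fin n)} (h : x ≤ y) :
    top U x ≤ top U y :=
  rev_le_rev (bot_mono _ (rev_le_rev h))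

theorem inv_top (U : Fin n → Prop) (x : Equiv.Perm (Fin n)) (a b : Fin n) :
    Inv (top U x) a b ↔ ∃ a' b', a ≤ a' ∧ a' < b' ∧ b' ≤ b ∧ (a' = a ∨ ¬ U a') ∧
      (b' = b ∨ U b') ∧ Inv x a' b' := by
  rw [top, inv_rev, inv_bot, Forced]
  simp only [inv_rev, not_not]
  constructor
  · rintro ⟨h, h'⟩
    by_contra hc
    push Not at hc
    exact h' ⟨h, fun p q h1 h2 h3 h4 h5 => ⟨h2, hc p q h1 h2 h3 h4 h5⟩⟩
  · rintro ⟨p, q, h1, h2, h3, h4, h5, h6⟩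
    exact ⟨h1.trans_lt (h2.trans_le h3), fun hc => (hc.2 p q h1 h2 h3 h4 h5).2 h6⟩

/-- Raising `x` to `top U x` creates no forced inversion, so the two projections have the same
fibers. -/
theorem bot_top (U : Fin n → Prop) (x : Equiv.Perm (Fin n)) : bot U (top U x) = bot U x := by
  refine eq_of_le_le ?_ (bot_mono U (le_top U x))
  have key : ∀ d : ℕ, ∀ a b : Fin n, (b : ℕ) - a = d → Forced U (top U x) a b → Inv x a b := by
    intro d
    induction d using Nat.strong_induction_on with
    | _ d ih =>
      intro a b hd h
      obtain ⟨p, q, h1, h2, h3, h4, h5, h6⟩ := (inv_top U x a b).1 h.inv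
      have hab := h.1
      -- the part of the chain `a ≤ p < q ≤ b` before `p` and after `q` is forced
      have left : p = a ∨ (a < p ∧ Inv x a p) := by
        rcases eq_or_lt_of_le h1 with e | e
        · exact Or.inl e.symm
        · refine Or.inr ⟨e, ih _ ?_ a p rfl
            (h.sub le_rfl e (h2.le.trans h3) (Or.inl rfl) (Or.inr (h4.resolve_left e.ne')))⟩
          simp only [Fin.lt_def, Fin.le_def] at *
          omega
      have right : q = b ∨ (q < b ∧ Inv x q b) := by
        rcases eq_or_lt_of_le h3 with e | e
        · exact Or.inl e
        · refine Or.inr ⟨e, ih _ ?_ q b rfl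
            (h.sub (h1.trans h2.le) e le_rfl (Or.inr (h5.resolve_left e.ne)) (Or.inl rfl))⟩
          simp only [Fin.lt_def, Fin.le_def] at *
          omega
      have hpb : Inv x p b := by
        rcases right with e | ⟨-, e⟩
        · exact e ▸ h6
        · exact inv_trans h6 e
      rcases left with e | ⟨-, e⟩
      · exact e ▸ hpb
      · exact inv_trans e hpb
  intro a b hab
  rw [inv_bot] at hab ⊢
  exact ⟨hab.1, fun p q h1 h2 h3 h4 h5 => key _ p q rfl (hab.sub h1 h2 h3 h4 h5)⟩

theorem top_bot (U : Fin n → Prop) (x : Equiv.Perm (Fin n)) : top U (bot U x) = top U x := by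
  have h : bot U x = rev (top (fun a => ¬ U a) (rev x)) := by
    simp only [top, rev_rev, not_not]
  rw [h, top, rev_rev, bot_top]
  rfl

/-- Permutations with the same bottom element form a lattice congruence. -/
noncomputable def botCon (U : Fin n → Prop) : LatticeCon (Equiv.Perm (Fin n)) where
  r x y := bot U x = bot U y
  iseqv := ⟨fun _ => rfl, fun h => h.symm, fun h h' => h.trans h'⟩
  inf := by
    have key : ∀ {w x y z : Equiv.Perm (Fin n)}, bot U w = bot U x → bot U y = bot U z →
        bot U (w ⊓ y) ≤ bot U (x ⊓ z) := by
      intro w x y z h h'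
      rw [← bot_bot U (w ⊓ y)]
      refine bot_mono U (le_inf ?_ ?_)
      · exact (bot_mono U inf_le_left).trans (h.le.trans (bot_le U x))
      · exact (bot_mono U inf_le_right).trans (h'.le.trans (bot_le U z))
    intro w x y z h h'
    exact eq_of_le_le (key h h') (key h.symm h'.symm)
  sup := by
    have htop : ∀ {w x : Equiv.Perm (Fin n)}, bot U w = bot U x → top U w = top U x := by
      intro w x h
      rw [← top_bot U w, h, top_bot]
    have key : ∀ {w x y z : Equiv.Perm (Fin n)}, bot U w = bot U x → bot U y = bot U z →
        bot U (w ⊔ y) ≤ bot U (x ⊔ z) := by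
      intro w x y z h h'
      rw [← bot_top U (x ⊔ z)]
      refine bot_mono U (sup_le ?_ ?_)
      · exact (le_top U w).trans ((htop h).le.trans (top_mono U le_sup_left))
      · exact (le_top U y).trans ((htop h').le.trans (top_mono U le_sup_right))
    intro w x y z h h'
    exact eq_of_le_le (key h h') (key h.symm h'.symm)

/-- `b` lies between `a` and `c` in value and outside the part of the word of `x` between `c` and
`a`: to the left of it if `b` is an up index, and to the right of it if `b` is a down index. -/
def Separates (U : Fin n → Prop) (x : Equiv.Perm (Fin n)) (a b c : Fin n) : Prop :=
  a < b ∧ b < c ∧ ((U b ∧ ¬ Inv x b c) ∨ (¬ U b ∧ ¬ Inv x a b))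

/-- Undoing the inversion `(a, c)` does not change the bottom element if some `b` separates. -/
theorem bot_eq_of_separates {U : Fin n → Prop} {x y : Equiv.Perm (Fin n)} {a b c : Fin n}
    (hxy : ∀ p q, Inv x p q ↔ Inv y p q ∨ (p = a ∧ q = c)) (h : Separates U x a b c) :
    bot U x = bot U y := by
  refine eq_of_le_le ?_ (bot_mono U fun p q hpq => (hxy p q).2 (Or.inl hpq))
  intro p q hpq
  rw [inv_bot] at hpq ⊢
  refine ⟨hpq.1, fun p' q' h1 h2 h3 h4 h5 => ?_⟩
  rcases (hxy p' q').1 (hpq.2 p' q' h1 h2 h3 h4 h5) with h' | ⟨rfl, rfl⟩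
  · exact h'
  obtain ⟨hab, hbc, h6⟩ := h
  rcases h6 with ⟨hU, h6⟩ | ⟨hU, h6⟩
  · exact absurd (hpq.2 b q' (h1.trans hab.le) hbc h3 (Or.inr hU) h5) h6
  · exact absurd (hpq.2 p' b h1 hab (hbc.le.trans h3) h4 (Or.inr hU)) h6

/-! ### Forcing in the weak order -/

/-- The permutation that sorts by `κ`, and increasingly where `κ` is constant. -/
theorem exists_sort (κ : Fin n → ℕ) :
    ∃ x : Equiv.Perm (Fin n), ∀ a b, Inv x a b ↔ a < b ∧ κ b < κ a := by
  apply exists_perm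
  · exact fun a b h => h.1
  · exact fun a b c h h' => ⟨h.1.trans h'.1, h'.2.trans h.2⟩
  · intro a b c h hab hbc
    rcases lt_or_ge (κ b) (κ a) with h1 | h1
    · exact Or.inl ⟨hab, h1⟩
    · exact Or.inr ⟨hbc, h.2.trans_le h1⟩

/-- The permutation that sorts by `κ`, and decreasingly where `κ` is constant. -/
theorem exists_sort' (κ : Fin n → ℕ) :
    ∃ x : Equiv.Perm (Fin n), ∀ a b, Inv x a b ↔ a < b ∧ κ b ≤ κ a := by
  apply exists_perm
  · exact fun a b h => h.1
  · exact fun a b c h h' => ⟨h.1.trans h'.1, h'.2.trans h.2⟩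
  · intro a b c h hab hbc
    rcases le_or_gt (κ b) (κ a) with h1 | h1
    · exact Or.inl ⟨hab, h1⟩
    · exact Or.inr ⟨hbc, h.2.trans h1.le⟩

/-- The pairs `t ≡ ts` at the value `b`: if `b` is an up index, the inversion sets of the two
permutations are `{(a, b)}` and `{(a, b), (a, c)}`; otherwise they are `{(b, c)}` and
`{(b, c), (a, c)}`. -/
def HasGenerators (U : Fin n → Prop) (Θ : LatticeCon (Equiv.Perm (Fin n))) : Prop :=
  ∀ a b c : Fin n, (a : ℕ) + 1 = b → (b : ℕ) + 1 = c → ∃ x y, Θ.r x y ∧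
    (∀ p q, Inv y p q ↔ (U b ∧ p = a ∧ q = b) ∨ (¬ U b ∧ p = b ∧ q = c)) ∧
    ∀ p q, Inv x p q ↔ Inv y p q ∨ (p = a ∧ q = c)

/-- Let `x` have just one inversion more than `y`. A congruence that relates some `j ≤ x` with this
inversion to some `z ≤ j` without it relates `x = y ⊔ j` to `y = y ⊔ z`. -/
theorem rel_of_le_join {Θ : LatticeCon (Equiv.Perm (Fin n))} {x y j z : Equiv.Perm (Fin n)}
    {a c : Fin n} (hxy : ∀ p q, Inv x p q ↔ Inv y p q ∨ (p = a ∧ q = c))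
    (hj : Inv j a c) (hjx : j ≤ x) (hz : ¬ Inv z a c) (hzj : z ≤ j) (h : Θ.r j z) : Θ.r x y := by
  have h1 : y ⊔ z = y := sup_eq_left.2 fun p q hpq => by
    rcases (hxy p q).1 (hjx _ _ (hzj _ _ hpq)) with h' | ⟨rfl, rfl⟩
    exacts [h', absurd hpq hz]
  have hyx : y ≤ x := fun p q hpq => (hxy p q).2 (Or.inl hpq)
  have h2 : y ⊔ j = x := eq_of_le_le (sup_le hyx hjx) fun p q hpq => by
    rcases (hxy p q).1 hpq with h' | ⟨rfl, rfl⟩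
    · exact (le_sup_left : y ≤ y ⊔ j) _ _ h'
    · exact (le_sup_right : j ≤ y ⊔ j) _ _ hj
  have := Θ.sup (Θ.refl y) h
  rwa [h1, h2] at this

/-- Let `x` have just one inversion more than `y`. A congruence that relates some `m ≥ y` without
this inversion to some `z ≥ m` with it relates `y = x ⊓ m` to `x = x ⊓ z`. -/
theorem rel_of_meet_le {Θ : LatticeCon (Equiv.Perm (Fin n))} {x y m z : Equiv.Perm (Fin n)}
    {a c : Fin n} (hxy : ∀ p q, Inv x p q ↔ Inv y p q ∨ (p = a ∧ q = c))
    (hm : ¬ Inv m a c) (hym : y ≤ m) (hz : Inv z a c) (hmz : m ≤ z) (h : Θ.r z m) : Θ.r x y := by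
  have hyx : y ≤ x := fun p q hpq => (hxy p q).2 (Or.inl hpq)
  have h1 : x ⊓ m = y := eq_of_le_le (fun p q hpq => by
    rcases (hxy p q).1 ((inf_le_left : x ⊓ m ≤ x) _ _ hpq) with h' | ⟨rfl, rfl⟩
    · exact h'
    · exact absurd ((inf_le_right : x ⊓ m ≤ m) _ _ hpq) hm) (le_inf hyx hym)
  have h2 : x ⊓ z = x := inf_eq_left.2 fun p q hpq => by
    rcases (hxy p q).1 hpq with h' | ⟨rfl, rfl⟩
    exacts [hmz _ _ (hym _ _ h'), hz]
  have := Θ.inf (Θ.refl x) h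
  rwa [h1, h2] at this

end WeakOrder

/-! ### Forcing with prescribed words -/

namespace WeakOrder

variable {n : ℕ}

open Classical in
/-- The sorting key of a permutation whose word consists of six blocks: the values below `a`, the
values of `L` between `a` and `c`, then `a`, `k`, `c` in the order given by their keys, the remaining
values between `a` and `c`, and the values above `c`. -/
noncomputable def blockKey (L : Fin n → Prop) (a k c : Fin n) (lo hi a₁ k₁ c₁ : ℕ) (v : Fin n) :
    ℕ :=
  if v < a then lo else if c < v then hi else if v = k then k₁ else if v = c then c₁ else
    if v = a then a₁ else if L v then 1 else 5

section BlockKey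

variable {L : Fin n → Prop} {a k c : Fin n} {lo hi a₁ k₁ c₁ : ℕ}

theorem blockKey_left (hak : a < k) (hkc : k < c) : blockKey L a k c lo hi a₁ k₁ c₁ a = a₁ := by
  unfold blockKey; grind

theorem blockKey_mid (hak : a < k) (hkc : k < c) : blockKey L a k c lo hi a₁ k₁ c₁ k = k₁ := by
  unfold blockKey; grind

theorem blockKey_right (hak : a < k) (hkc : k < c) : blockKey L a k c lo hi a₁ k₁ c₁ c = c₁ := by
  unfold blockKey; grind

open Classical in
theorem blockKey_other {b : Fin n} (hab : a < b) (hbc : b < c) (hb : b ≠ k) :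
    blockKey L a k c lo hi a₁ k₁ c₁ b = if L b then 1 else 5 := by
  unfold blockKey; grind

theorem blockKey_swap_right (hak : a < k) (hkc : k < c) (p q : Fin n) :
    (p < q ∧ blockKey L a k c 0 6 4 3 2 q < blockKey L a k c 0 6 4 3 2 p) ↔
      (p < q ∧ blockKey L a k c 0 6 4 2 3 q < blockKey L a k c 0 6 4 2 3 p) ∨
        (p = k ∧ q = c) := by
  unfold blockKey; grind (splits := 20)

theorem blockKey_swap_left (hak : a < k) (hkc : k < c) (p q : Fin n) :
    (p < q ∧ blockKey L a k c 0 6 4 3 2 q < blockKey L a k c 0 6 4 3 2 p) ↔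
      (p < q ∧ blockKey L a k c 0 6 3 4 2 q < blockKey L a k c 0 6 3 4 2 p) ∨
        (p = a ∧ q = k) := by
  unfold blockKey; grind (splits := 20)

theorem blockKey_swap_right' (hak : a < k) (hkc : k < c) (p q : Fin n) :
    (p < q ∧ blockKey L a k c 6 0 2 4 3 q ≤ blockKey L a k c 6 0 2 4 3 p) ↔
      (p < q ∧ blockKey L a k c 6 0 2 3 4 q ≤ blockKey L a k c 6 0 2 3 4 p) ∨
        (p = k ∧ q = c) := by
  unfold blockKey; grind (splits := 20)

theorem blockKey_swap_left' (hak : a < k) (hkc : k < c) (p q : Fin n) :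
    (p < q ∧ blockKey L a k c 6 0 3 2 4 q ≤ blockKey L a k c 6 0 3 2 4 p) ↔
      (p < q ∧ blockKey L a k c 6 0 2 3 4 q ≤ blockKey L a k c 6 0 2 3 4 p) ∨
        (p = a ∧ q = k) := by
  unfold blockKey; grind (splits := 20)

open Classical in
theorem blockKey_lt_of_lt {p q : Fin n} (hpq : p < q)
    (h : blockKey L a k c 0 6 4 (if L k then 1 else 5) 2 q <
      blockKey L a k c 0 6 4 (if L k then 1 else 5) 2 p) :
    blockKey L a k c 0 6 4 3 2 q < blockKey L a k c 0 6 4 3 2 p := by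
  unfold blockKey at *; grind (splits := 20)

open Classical in
theorem blockKey_le_of_le {p q : Fin n} (hpq : p < q)
    (h : blockKey L a k c 6 0 2 3 4 q ≤ blockKey L a k c 6 0 2 3 4 p) :
    blockKey L a k c 6 0 2 (if L k then 1 else 5) 3 q ≤
      blockKey L a k c 6 0 2 (if L k then 1 else 5) 3 p := by
  unfold blockKey at *; grind (splits := 20)

open Classical in
theorem inv_of_blockKey_lt {I : Fin n → Fin n → Prop} (hak : a < k) (hkc : k < c)
    (hac : I a c) (hright : ∀ m, a < m → m < c → ¬ I a m → I m c)
    (hco : ∀ p q, a < p → p < q → I a q → ¬ I a p → I p q) {p q : Fin n} (hpq : p < q)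
    (h : blockKey (I a) a k c 0 6 4 (if I a k then 1 else 5) 2 q <
      blockKey (I a) a k c 0 6 4 (if I a k then 1 else 5) 2 p) : I p q := by
  have h1 := hright p
  have h2 := hco p q
  clear hright hco
  unfold blockKey at h; grind (splits := 30)

open Classical in
theorem blockKey_le_of_inv {I : Fin n → Fin n → Prop} (hak : a < k)
    (hleft : ∀ m, a < m → m < c → I m c → ¬ I a m)
    (htr : ∀ p q, a < p → p < q → I a p → I p q → I a q) {p q : Fin n} (hpq : p < q)
    (hne : ¬ (p = a ∧ q = c)) (h : I p q) :
    blockKey (I a) a k c 6 0 2 (if I a k then 1 else 5) 3 q ≤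
      blockKey (I a) a k c 6 0 2 (if I a k then 1 else 5) 3 p := by
  have h1 := hleft p
  have h2 := htr p q
  clear hleft htr
  unfold blockKey; grind (splits := 30)

end BlockKey

/-- A lattice congruence that contains the pairs `t ≡ ts` identifies two permutations that differ
only by the inversion `(a, c)`, if some `b` separates. The proof is by induction on `c - a`. For a
value `k ≠ b` between `a` and `c`, the pair is forced by a similar pair `α < β` that differs by the
inversion `(k, c)` or `(a, k)`: either the join with `β` adds `(a, c)` by transitivity, or the meet
with `α` removes it by cotransitivity. -/
theorem rel_of_separates {U : Fin n → Prop} {Θ : LatticeCon (Equiv.Perm (Fin n))}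
    (hgen : HasGenerators U Θ) (b : Fin n) : ∀ (d : ℕ) (a c : Fin n), (c : ℕ) - a = d →
    ∀ x y : Equiv.Perm (Fin n), (∀ p q, Inv x p q ↔ Inv y p q ∨ (p = a ∧ q = c)) →
      ¬ Inv y a c → Separates U x a b c → Θ.r x y := by
  classical
  intro d
  induction d using Nat.strong_induction_on with
  | _ d ih =>
  intro a c hd x y hxy hy hsep
  obtain ⟨hab, hbc, hside⟩ := hsep
  have hac : a < c := hab.trans hbc
  have hx : Inv x a c := (hxy a c).2 (Or.inr ⟨rfl, rfl⟩)
  have hdich : ∀ m, a < m → m < c → (Inv x m c ↔ ¬ Inv x a m) := by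
    intro m h1 h2
    constructor
    · intro h3 h4
      have h5 : Inv y a m := ((hxy a m).1 h4).resolve_right fun h => h2.ne h.2
      have h6 : Inv y m c := ((hxy m c).1 h3).resolve_right fun h => h1.ne' h.1
      exact hy (inv_trans h5 h6)
    · exact fun h => (inv_cotrans hx h1 h2).resolve_left h
  by_cases hbase : (a : ℕ) + 1 = b ∧ (b : ℕ) + 1 = c
  · -- the generators themselves
    obtain ⟨j, z, h, hz, hj⟩ := hgen a b c hbase.1 hbase.2
    refine rel_of_le_join hxy ((hj a c).2 (Or.inr ⟨rfl, rfl⟩)) ?_ ?_ ?_ h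
    · intro p q hpq
      rcases (hj p q).1 hpq with h1 | ⟨rfl, rfl⟩
      · have := hdich b hab hbc
        rcases (hz p q).1 h1 with ⟨h2, rfl, rfl⟩ | ⟨h2, rfl, rfl⟩
        · tauto
        · tauto
      · exact hx
    · rw [hz]
      rintro (⟨-, -, h2⟩ | ⟨-, h2, -⟩)
      · exact hbc.ne' h2
      · exact hab.ne h2
    · exact fun p q hpq => (hj p q).2 (Or.inl hpq)
  obtain ⟨k, hak, hkc, hkb⟩ : ∃ k, a < k ∧ k < c ∧ k ≠ b := by
    by_cases h1 : (a : ℕ) + 1 = b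
    · refine ⟨⟨b + 1, by omega⟩, ?_, ?_, ?_⟩ <;>
        simp only [Fin.lt_def, ne_eq, Fin.ext_iff] at * <;> omega
    · refine ⟨⟨a + 1, by omega⟩, ?_, ?_, ?_⟩ <;>
        simp only [Fin.lt_def, ne_eq, Fin.ext_iff] at * <;> omega
  have hdk := hdich k hak hkc
  have hdb := hdich b hab hbc
  have hkc' : (c : ℕ) - k < d := by rw [Fin.lt_def] at *; omega
  have hak' : (k : ℕ) - a < d := by rw [Fin.lt_def] at *; omega
  by_cases hcase : (k < b ↔ Inv x a k)
  · obtain ⟨m, hm⟩ := exists_sort' (blockKey (Inv x a) a k c 6 0 2 (if Inv x a k then 1 else 5) 3)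
    obtain ⟨α, hα⟩ := exists_sort' (blockKey (Inv x a) a k c 6 0 2 3 4)
    have hmac : ¬ Inv m a c := by
      rw [hm, blockKey_left hak hkc, blockKey_right hak hkc]
      omega
    have hym : y ≤ m := by
      intro p q hpq
      refine (hm p q).2 ⟨hpq.1, blockKey_le_of_inv hak (fun v h1 h2 => (hdich v h1 h2).1)
        (fun _ _ _ _ h1 h2 => inv_trans h1 h2) hpq.1 ?_ ((hxy p q).2 (Or.inl hpq))⟩
      rintro ⟨rfl, rfl⟩
      exact hy hpq
    have hαm : α ≤ m := fun p q hpq =>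
      (hm p q).2 ⟨hpq.1, blockKey_le_of_le hpq.1 ((hα p q).1 hpq).2⟩
    by_cases hkb' : k < b
    · obtain ⟨β, hβ⟩ := exists_sort' (blockKey (Inv x a) a k c 6 0 2 4 3)
      have hrel : Θ.r β α := by
        refine ih _ hkc' k c rfl β α ?_ ?_ ⟨hkb', hbc, ?_⟩
        · intro p q
          rw [hα, hβ, blockKey_swap_right' hak hkc]
        · rw [hα, blockKey_mid hak hkc, blockKey_right hak hkc]
          omega
        · rw [hβ, hβ, blockKey_mid hak hkc, blockKey_right hak hkc,
            blockKey_other hab hbc hkb.symm]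
          grind
      refine rel_of_meet_le hxy hmac hym (z := m ⊔ β) ?_ le_sup_left ?_
      · have h1 : Inv m a k := by
          rw [hm, blockKey_left hak hkc, blockKey_mid hak hkc]
          grind
        have h2 : Inv β k c := by
          rw [hβ, blockKey_mid hak hkc, blockKey_right hak hkc]
          grind
        exact inv_trans ((le_sup_left : m ≤ m ⊔ β) _ _ h1) ((le_sup_right : β ≤ m ⊔ β) _ _ h2)
      · have := Θ.sup (Θ.refl m) hrel
        rwa [sup_eq_left.2 hαm] at this
    · have hbk : b < k := lt_of_le_of_ne (not_lt.1 hkb') hkb.symm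
      obtain ⟨β, hβ⟩ := exists_sort' (blockKey (Inv x a) a k c 6 0 3 2 4)
      have hrel : Θ.r β α := by
        refine ih _ hak' a k rfl β α ?_ ?_ ⟨hab, hbk, ?_⟩
        · intro p q
          rw [hα, hβ, blockKey_swap_left' hak hkc]
        · rw [hα, blockKey_mid hak hkc, blockKey_left hak hkc]
          omega
        · rw [hβ, hβ, blockKey_mid hak hkc, blockKey_left hak hkc,
            blockKey_other hab hbc hkb.symm]
          grind
      refine rel_of_meet_le hxy hmac hym (z := m ⊔ β) ?_ le_sup_left ?_
      · have h1 : Inv m k c := by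
          rw [hm, blockKey_right hak hkc, blockKey_mid hak hkc]
          grind
        have h2 : Inv β a k := by
          rw [hβ, blockKey_mid hak hkc, blockKey_left hak hkc]
          grind
        exact inv_trans ((le_sup_right : β ≤ m ⊔ β) _ _ h2) ((le_sup_left : m ≤ m ⊔ β) _ _ h1)
      · have := Θ.sup (Θ.refl m) hrel
        rwa [sup_eq_left.2 hαm] at this
  · obtain ⟨j, hj⟩ := exists_sort (blockKey (Inv x a) a k c 0 6 4 (if Inv x a k then 1 else 5) 2)
    obtain ⟨β, hβ⟩ := exists_sort (blockKey (Inv x a) a k c 0 6 4 3 2)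
    have hjac : Inv j a c := by
      rw [hj, blockKey_left hak hkc, blockKey_right hak hkc]
      exact ⟨hac, by omega⟩
    have hjx : j ≤ x := fun p q hpq =>
      inv_of_blockKey_lt hak hkc hx (fun v h1 h2 => (hdich v h1 h2).2)
        (fun p q h1 h2 h3 h4 => (inv_cotrans h3 h1 h2).resolve_left h4) hpq.1 ((hj p q).1 hpq).2
    have hjβ : j ≤ β := fun p q hpq =>
      (hβ p q).2 ⟨hpq.1, blockKey_lt_of_lt hpq.1 ((hj p q).1 hpq).2⟩
    by_cases hkb' : k < b
    · obtain ⟨α, hα⟩ := exists_sort (blockKey (Inv x a) a k c 0 6 4 2 3)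
      have hrel : Θ.r β α := by
        refine ih _ hkc' k c rfl β α ?_ ?_ ⟨hkb', hbc, ?_⟩
        · intro p q
          rw [hα, hβ, blockKey_swap_right hak hkc]
        · rw [hα, blockKey_mid hak hkc, blockKey_right hak hkc]
          omega
        · rw [hβ, hβ, blockKey_mid hak hkc, blockKey_right hak hkc,
            blockKey_other hab hbc hkb.symm]
          grind
      refine rel_of_le_join hxy hjac hjx (z := j ⊓ α) ?_ inf_le_left ?_
      · intro h
        rcases inv_cotrans h hak hkc with h1 | h1
        · have h2 := (inf_le_left : j ⊓ α ≤ j) _ _ h1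
          rw [hj, blockKey_left hak hkc, blockKey_mid hak hkc] at h2
          grind
        · have h2 := (inf_le_right : j ⊓ α ≤ α) _ _ h1
          rw [hα, blockKey_right hak hkc, blockKey_mid hak hkc] at h2
          omega
      · have := Θ.inf (Θ.refl j) hrel
        rwa [inf_eq_left.2 hjβ] at this
    · have hbk : b < k := lt_of_le_of_ne (not_lt.1 hkb') hkb.symm
      obtain ⟨α, hα⟩ := exists_sort (blockKey (Inv x a) a k c 0 6 3 4 2)
      have hrel : Θ.r β α := by
        refine ih _ hak' a k rfl β α ?_ ?_ ⟨hab, hbk, ?_⟩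
        · intro p q
          rw [hα, hβ, blockKey_swap_left hak hkc]
        · rw [hα, blockKey_mid hak hkc, blockKey_left hak hkc]
          omega
        · rw [hβ, hβ, blockKey_mid hak hkc, blockKey_left hak hkc,
            blockKey_other hab hbc hkb.symm]
          grind
      refine rel_of_le_join hxy hjac hjx (z := j ⊓ α) ?_ inf_le_left ?_
      · intro h
        rcases inv_cotrans h hak hkc with h1 | h1
        · have h2 := (inf_le_right : j ⊓ α ≤ α) _ _ h1
          rw [hα, blockKey_left hak hkc, blockKey_mid hak hkc] at h2
          omega
        · have h2 := (inf_le_left : j ⊓ α ≤ j) _ _ h1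
          rw [hj, blockKey_right hak hkc, blockKey_mid hak hkc] at h2
          grind
      · have := Θ.inf (Θ.refl j) hrel
        rwa [inf_eq_left.2 hjβ] at this

end WeakOrder

/-! ### The chords of a permutation -/

namespace CambrianPolygon

variable {n : ℕ}

/-- The vertices of the polygonal path of `H`. -/
def verts (H : Set (Fin n)) : Set (Fin (n + 2)) := inner '' H ∪ {0, Fin.last (n + 1)}

theorem inner_val (i : Fin n) : (inner i : ℕ) = i + 1 := rfl

theorem inner_lt_inner {i j : Fin n} : inner i < inner j ↔ i < j := by
  rw [Fin.lt_def, Fin.lt_def, inner_val, inner_val]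
  omega

theorem inner_injective : Function.Injective (inner : Fin n → Fin (n + 2)) := by
  intro i j h
  have := congrArg Fin.val h
  simp only [inner_val] at this
  exact Fin.ext (by omega)

theorem zero_mem_verts (H : Set (Fin n)) : 0 ∈ verts H := Or.inr (Or.inl rfl)

theorem last_mem_verts (H : Set (Fin n)) : Fin.last (n + 1) ∈ verts H := Or.inr (Or.inr rfl)

theorem exists_inner {v : Fin (n + 2)} (h0 : v ≠ 0) (h1 : v ≠ Fin.last (n + 1)) :
    ∃ i : Fin n, inner i = v := by
  rw [ne_eq, Fin.ext_iff] at h0 h1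
  simp only [Fin.val_zero, Fin.val_last] at h0 h1
  have := v.2
  exact ⟨⟨v - 1, by omega⟩, Fin.ext (by simp only [inner_val]; omega)⟩

theorem exists_inner_of_lt {u v w : Fin (n + 2)} (h0 : u < v) (h1 : v < w) :
    ∃ i : Fin n, inner i = v :=
  exists_inner (((Fin.zero_le u).trans_lt h0).ne') (h1.trans_le (Fin.le_last w)).ne

theorem inner_mem_verts {H : Set (Fin n)} {i : Fin n} : inner i ∈ verts H ↔ i ∈ H := by
  constructor
  · rintro (⟨j, hj, h⟩ | h | h)
    · exact inner_injective h ▸ hj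
    · have := congrArg Fin.val h
      simp [inner_val] at this
    · have := congrArg Fin.val h
      simp only [inner_val, Fin.val_last] at this
      omega
  · exact fun h => Or.inl ⟨i, h, rfl⟩

theorem mem_steps {H : Set (Fin n)} {c : Fin (n + 2) × Fin (n + 2)} :
    c ∈ steps H ↔ c.1 ∈ verts H ∧ c.2 ∈ verts H ∧ c.1 < c.2 ∧
      ∀ m ∈ verts H, ¬ (c.1 < m ∧ m < c.2) := Iff.rfl

theorem steps_congr {H H' : Set (Fin n)} {c : Fin (n + 2) × Fin (n + 2)} (hc : c ∈ steps H)
    (h : ∀ i, c.1 ≤ inner i → inner i ≤ c.2 → (i ∈ H ↔ i ∈ H')) : c ∈ steps H' := by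
  have key : ∀ v, c.1 ≤ v → v ≤ c.2 → (v ∈ verts H ↔ v ∈ verts H') := by
    intro v h1 h2
    by_cases h3 : v = 0
    · simp [h3, zero_mem_verts]
    by_cases h4 : v = Fin.last (n + 1)
    · simp [h4, last_mem_verts]
    obtain ⟨i, rfl⟩ := exists_inner h3 h4
    rw [inner_mem_verts, inner_mem_verts, h i h1 h2]
  obtain ⟨h1, h2, h3, h4⟩ := mem_steps.1 hc
  exact mem_steps.2 ⟨(key _ le_rfl h3.le).1 h1, (key _ h3.le le_rfl).1 h2, h3,
    fun m hm hm' => h4 m ((key m hm'.1.le hm'.2.le).2 hm) hm'⟩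

/-- The set `H_k` of a permutation, for the set `U` of up indices: the up indices among the first
`k` letters and the down indices among the other letters. -/
def toggled (U : Fin n → Prop) (x : Equiv.Perm (Fin n)) (k : ℕ) : Set (Fin n) :=
  {i | U i ↔ (x.symm i : ℕ) < k}

theorem mem_toggled {U : Fin n → Prop} {x : Equiv.Perm (Fin n)} {k : ℕ} {i : Fin n} :
    i ∈ toggled U x k ↔ (U i ↔ (x.symm i : ℕ) < k) := Iff.rfl

theorem mem_toggled_congr {U : Fin n → Prop} {x y : Equiv.Perm (Fin n)} {k l : ℕ} {i : Fin n}
    (h : (x.symm i : ℕ) < k ↔ (y.symm i : ℕ) < l) : i ∈ toggled U x k ↔ i ∈ toggled U y l := by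
  rw [mem_toggled, mem_toggled, h]

/-- All the chords that occur on the polygonal paths of a permutation. -/
def chords (U : Fin n → Prop) (x : Equiv.Perm (Fin n)) : Set (Fin (n + 2) × Fin (n + 2)) :=
  ⋃ k ∈ Set.Iic n, steps (toggled U x k)

theorem mem_chords {U : Fin n → Prop} {x : Equiv.Perm (Fin n)} {c : Fin (n + 2) × Fin (n + 2)} :
    c ∈ chords U x ↔ ∃ k ≤ n, c ∈ steps (toggled U x k) := by
  simp [chords]

theorem mem_chords_of {U : Fin n → Prop} {x : Equiv.Perm (Fin n)} {c : Fin (n + 2) × Fin (n + 2)}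
    {k : ℕ} (h : c ∈ steps (toggled U x k)) : c ∈ chords U x := by
  rcases le_total k n with hk | hk
  · exact mem_chords.2 ⟨k, hk, h⟩
  · refine mem_chords.2 ⟨n, le_rfl, steps_congr h fun i _ _ => ?_⟩
    have := (x.symm i).2
    exact mem_toggled_congr (iff_of_true (this.trans_le hk) this)

/-- Each index is exchanged only once, so its presence at the time `k` is determined if it is the
same at an earlier and at a later time. -/
theorem mem_verts_toggled_of_between {U : Fin n → Prop} {x : Equiv.Perm (Fin n)} {k₁ k k₂ : ℕ}
    (h1 : k₁ ≤ k) (h2 : k ≤ k₂) {v : Fin (n + 2)}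
    (h : v ∈ verts (toggled U x k₁) ↔ v ∈ verts (toggled U x k₂)) :
    v ∈ verts (toggled U x k) ↔ v ∈ verts (toggled U x k₁) := by
  by_cases h3 : v = 0
  · simp [h3, zero_mem_verts]
  by_cases h4 : v = Fin.last (n + 1)
  · simp [h4, last_mem_verts]
  obtain ⟨i, rfl⟩ := exists_inner h3 h4
  simp only [inner_mem_verts, mem_toggled] at *
  grind

theorem swap_symm_apply (x : Equiv.Perm (Fin n)) (s t i : Fin n) :
    (Equiv.swap s t * x).symm i = x.symm (Equiv.swap s t i) := rfl

theorem swap_swap_mul (x : Equiv.Perm (Fin n)) (s t : Fin n) :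
    Equiv.swap s t * (Equiv.swap s t * x) = x := by
  rw [← mul_assoc, Equiv.swap_mul_self, one_mul]

theorem chords_swap_subset {U : Fin n → Prop} {x : Equiv.Perm (Fin n)} {s t e : Fin n}
    (hst : (x.symm t : ℕ) = x.symm s + 1) (he : (s < e ∧ e < t) ∨ (t < e ∧ e < s))
    (heT : e ∈ toggled U x (x.symm s + 1)) : chords U (Equiv.swap s t * x) ⊆ chords U x := by
  intro c hc
  obtain ⟨k, -, hc⟩ := mem_chords.1 hc
  have hes : e ≠ s := by rintro rfl; rcases he with h | h <;> simp at h
  have het : e ≠ t := by rintro rfl; rcases he with h | h <;> simp at h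
  have hs : (Equiv.swap s t * x).symm s = x.symm t := by simp [swap_symm_apply]
  have ht : (Equiv.swap s t * x).symm t = x.symm s := by simp [swap_symm_apply]
  have ho : ∀ i, i ≠ s → i ≠ t → (Equiv.swap s t * x).symm i = x.symm i := fun i h1 h2 => by
    rw [swap_symm_apply, Equiv.swap_apply_of_ne_of_ne h1 h2]
  have hpos : ∀ i j, (x.symm i : ℕ) = x.symm j → i = j :=
    fun i j h => x.symm.injective (Fin.ext h)
  by_cases hk : k = x.symm s + 1
  · have hek : e ∈ toggled U (Equiv.swap s t * x) k := by
      rw [mem_toggled, ho e hes het]; rw [mem_toggled] at heT; rw [heT, hk]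
    have hside : c.2 ≤ inner e ∨ inner e ≤ c.1 := by
      by_contra hcon
      push Not at hcon
      exact (mem_steps.1 hc).2.2.2 _ (inner_mem_verts.2 hek) ⟨hcon.2, hcon.1⟩
    -- on one side of `e`, the path agrees with the one before both letters or the one after both
    have agree : (∀ i, c.1 ≤ inner i → inner i ≤ c.2 → i ≠ s) ∨
        (∀ i, c.1 ≤ inner i → inner i ≤ c.2 → i ≠ t) := by
      have hsv := inner_val s
      have htv := inner_val t
      have hev := inner_val e
      rcases hside with h | h <;> rcases he with h' | h'
      · right; rintro i - h2 rfl; rw [Fin.lt_def] at h'; rw [Fin.le_def] at *; omega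
      · left; rintro i - h2 rfl; rw [Fin.lt_def] at h'; rw [Fin.le_def] at *; omega
      · left; rintro i h2 - rfl; rw [Fin.lt_def] at h'; rw [Fin.le_def] at *; omega
      · right; rintro i h2 - rfl; rw [Fin.lt_def] at h'; rw [Fin.le_def] at *; omega
    rcases agree with h | h
    · refine mem_chords_of (k := x.symm s + 2) (steps_congr hc fun i h1 h2 => ?_)
      have his := h i h1 h2
      apply mem_toggled_congr
      by_cases hit : i = t
      · subst hit; rw [ht]; omega
      · rw [ho i his hit]
        have : (x.symm i : ℕ) ≠ x.symm t := fun h => hit (hpos i t h)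
        omega
    · refine mem_chords_of (k := x.symm s) (steps_congr hc fun i h1 h2 => ?_)
      have hit := h i h1 h2
      apply mem_toggled_congr
      by_cases his : i = s
      · subst his; rw [hs]; omega
      · rw [ho i his hit]
        have : (x.symm i : ℕ) ≠ x.symm s := fun h => his (hpos i s h)
        omega
  · refine mem_chords_of (k := k) (steps_congr hc fun i h1 h2 => ?_)
    apply mem_toggled_congr
    by_cases his : i = s
    · subst his; rw [hs]; omega
    by_cases hit : i = t
    · subst hit; rw [ht]; omega
    rw [ho i his hit]

theorem chords_swap {U : Fin n → Prop} {x : Equiv.Perm (Fin n)} {s t e : Fin n}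
    (hst : (x.symm t : ℕ) = x.symm s + 1) (he : (s < e ∧ e < t) ∨ (t < e ∧ e < s))
    (heT : e ∈ toggled U x (x.symm s + 1)) : chords U (Equiv.swap s t * x) = chords U x := by
  refine (chords_swap_subset hst he heT).antisymm ?_
  have hes : e ≠ s := by rintro rfl; rcases he with h | h <;> simp at h
  have het : e ≠ t := by rintro rfl; rcases he with h | h <;> simp at h
  have h := chords_swap_subset (U := U) (x := Equiv.swap s t * x) (s := t) (t := s) (e := e)
    (by simpa [swap_symm_apply] using hst) he.symm (by
      rw [mem_toggled] at heT ⊢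
      rw [swap_symm_apply, swap_symm_apply, Equiv.swap_apply_right,
        Equiv.swap_apply_of_ne_of_ne hes het]
      exact heT)
  rwa [Equiv.swap_comm t s, swap_swap_mul] at h

end CambrianPolygon

/-! ### Descents to the bottom of a Cambrian class -/

namespace WeakOrder

open CambrianPolygon

variable {n : ℕ}

/-- Exchanging two adjacent letters `c, a` with `a < c` removes just the inversion `(a, c)`. -/
theorem inv_swap {x : Equiv.Perm (Fin n)} {a c : Fin n} (hac : a < c)
    (h : (x.symm a : ℕ) = x.symm c + 1) (p q : Fin n) :
    Inv x p q ↔ Inv (Equiv.swap c a * x) p q ∨ (p = a ∧ q = c) := by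
  have hsym : ∀ i, ((Equiv.swap c a * x).symm i : ℕ) =
      if i = c then (x.symm a : ℕ) else if i = a then (x.symm c : ℕ) else x.symm i := by
    intro i
    rw [swap_symm_apply, Equiv.swap_apply_def]
    split_ifs <;> rfl
  have hpos : ∀ i j, (x.symm i : ℕ) = x.symm j → i = j :=
    fun i j h => x.symm.injective (Fin.ext h)
  have hp := hpos p a
  have hp' := hpos p c
  have hq := hpos q a
  have hq' := hpos q c
  simp only [Inv, Fin.lt_def, hsym] at *
  clear hsym hpos
  grind

theorem not_inv_swap {x : Equiv.Perm (Fin n)} {a c : Fin n}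
    (h : (x.symm a : ℕ) = x.symm c + 1) : ¬ Inv (Equiv.swap c a * x) a c := by
  rintro ⟨-, h2⟩
  simp only [swap_symm_apply, Equiv.swap_apply_left, Equiv.swap_apply_right, Fin.lt_def] at h2
  omega

theorem separates_of_mem_toggled {U : Fin n → Prop} {x : Equiv.Perm (Fin n)} {a c e : Fin n}
    (h : (x.symm a : ℕ) = x.symm c + 1) (hae : a < e) (hec : e < c)
    (he : e ∈ toggled U x (x.symm c + 1)) : Separates U x a e c := by
  refine ⟨hae, hec, ?_⟩
  rw [mem_toggled] at he
  by_cases hU : U e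
  · refine Or.inl ⟨hU, fun h' => ?_⟩
    have h1 := he.1 hU
    have h2 := h'.2
    rw [Fin.lt_def] at h2
    omega
  · refine Or.inr ⟨hU, fun h' => ?_⟩
    have h1 := mt he.2 hU
    have h2 := h'.2
    rw [Fin.lt_def] at h2
    omega

theorem Separates.mem_toggled {U : Fin n → Prop} {x : Equiv.Perm (Fin n)} {a c e : Fin n}
    (h : (x.symm a : ℕ) = x.symm c + 1) (hs : Separates U x a e c) :
    e ∈ toggled U x (x.symm c + 1) := by
  obtain ⟨hae, hec, hs⟩ := hs
  have h1 : (x.symm e : ℕ) ≠ x.symm c := fun h => hec.ne (x.symm.injective (Fin.ext h))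
  have h2 : (x.symm e : ℕ) ≠ x.symm a := fun h => hae.ne' (x.symm.injective (Fin.ext h))
  rw [CambrianPolygon.mem_toggled]
  rcases hs with ⟨hU, h'⟩ | ⟨hU, h'⟩
  · simp only [Inv, hec, true_and, Fin.lt_def] at h'
    simp only [hU, true_iff]
    omega
  · simp only [Inv, hae, true_and, Fin.lt_def] at h'
    simp only [hU, false_iff]
    omega

/-- If `x` is not the bottom of its class, then it has a separated descent. -/
theorem exists_separates {U : Fin n → Prop} {x : Equiv.Perm (Fin n)} (h : bot U x ≠ x) :
    ∃ a b c, Separates U x a b c ∧ (x.symm a : ℕ) = x.symm c + 1 := by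
  have hpos : ∀ i j, (x.symm i : ℕ) = x.symm j → i = j :=
    fun i j h => x.symm.injective (Fin.ext h)
  -- some inversion is separated
  have h1 : ∃ a b c, Inv x a c ∧ Separates U x a b c := by
    by_contra hno
    push Not at hno
    refine h (eq_of_le_le (bot_le U x) fun a c hac => (inv_bot U x a c).2
      ⟨hac.1, fun a' c' h1 h2 h3 h4 h5 => ?_⟩)
    have h6 : Inv x a' c := by
      rcases h4 with rfl | hU
      · exact hac
      rcases eq_or_lt_of_le h1 with rfl | h1
      · exact hac
      by_contra h7
      exact hno a a' c hac ⟨h1, h2.trans_le h3, Or.inl ⟨hU, h7⟩⟩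
    rcases h5 with rfl | hU
    · exact h6
    rcases eq_or_lt_of_le h3 with rfl | h3
    · exact h6
    by_contra h7
    exact hno a' c' c h6 ⟨h2, h3, Or.inr ⟨hU, h7⟩⟩
  obtain ⟨a, b, c, hac, hs⟩ := h1
  -- a separated inversion with its letters as close as possible is a descent
  have key : ∀ d : ℕ, ∀ a b c, Inv x a c → Separates U x a b c →
      (x.symm a : ℕ) - x.symm c = d →
      ∃ a b c, Separates U x a b c ∧ (x.symm a : ℕ) = x.symm c + 1 := by
    intro d
    induction d using Nat.strong_induction_on with
    | _ d ih =>
      intro a b c hac hs hd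
      by_cases hadj : (x.symm a : ℕ) = x.symm c + 1
      · exact ⟨a, b, c, hs, hadj⟩
      have h2 := hac.2
      rw [Fin.lt_def] at h2
      obtain ⟨e, he⟩ : ∃ e, (x.symm e : ℕ) = x.symm c + 1 := by
        have := (x.symm a).2
        exact ⟨x ⟨x.symm c + 1, by omega⟩, by simp⟩
      obtain ⟨hab, hbc, hs⟩ := hs
      have hba : (x.symm b : ℕ) ≠ x.symm a := fun h => hab.ne' (hpos _ _ h)
      have hbc' : (x.symm b : ℕ) ≠ x.symm c := fun h => hbc.ne (hpos _ _ h)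
      simp only [Inv, hab, hbc, true_and, Fin.lt_def] at hs
      rcases lt_trichotomy e b with hlt | rfl | hlt
      · refine ⟨e, b, c, ⟨hlt, hbc, ?_⟩, he⟩
        have : (x.symm b : ℕ) ≠ x.symm e := fun h => hlt.ne' (hpos _ _ h)
        simp only [Inv, hlt, hbc, true_and, Fin.lt_def]
        rcases hs with hs | hs
        · exact Or.inl ⟨hs.1, by omega⟩
        · exact Or.inr ⟨hs.1, by omega⟩
      · exfalso
        rcases hs with hs | hs <;> omega
      · refine ih (x.symm a - x.symm e) (by omega) a b e ⟨hab.trans hlt, ?_⟩ ⟨hab, hlt, ?_⟩ rfl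
        · rw [Fin.lt_def]; omega
        · have : (x.symm b : ℕ) ≠ x.symm e := fun h => hlt.ne (hpos _ _ h)
          simp only [Inv, hab, hlt, true_and, Fin.lt_def]
          rcases hs with hs | hs
          · exact Or.inl ⟨hs.1, by omega⟩
          · exact Or.inr ⟨hs.1, by omega⟩
  exact key _ a b c hac hs rfl

/-- An equivalence relation that contains all the exchanges of separated descents relates every
permutation to the bottom of its class. -/
theorem rel_bot {U : Fin n → Prop} {R : Equiv.Perm (Fin n) → Equiv.Perm (Fin n) → Prop}
    (hR : Equivalence R) (hstep : ∀ x a b c, Separates U x a b c →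
      (x.symm a : ℕ) = x.symm c + 1 → R x (Equiv.swap c a * x)) (x : Equiv.Perm (Fin n)) :
    R x (bot U x) := by
  classical
  have key : ∀ d : ℕ, ∀ x : Equiv.Perm (Fin n),
      (Finset.univ.filter fun p : Fin n × Fin n => Inv x p.1 p.2).card = d → R x (bot U x) := by
    intro d
    induction d using Nat.strong_induction_on with
    | _ d ih =>
      intro x hd
      by_cases hx : bot U x = x
      · rw [hx]; exact hR.refl x
      obtain ⟨a, b, c, hs, hadj⟩ := exists_separates hx
      have hac := hs.1.trans hs.2.1
      have hinv := inv_swap hac hadj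
      rw [bot_eq_of_separates hinv hs]
      refine hR.trans (hstep x a b c hs hadj) (ih _ ?_ _ rfl)
      rw [← hd]
      refine Finset.card_lt_card ⟨fun p hp => ?_, fun hsub => ?_⟩
      · simp only [Finset.mem_filter, Finset.mem_univ, true_and] at hp ⊢
        exact (hinv _ _).2 (Or.inl hp)
      · have : (a, c) ∈ Finset.univ.filter fun p : Fin n × Fin n =>
            Inv (Equiv.swap c a * x) p.1 p.2 :=
          hsub (by simpa using (hinv a c).2 (Or.inr ⟨rfl, rfl⟩))
        simp only [Finset.mem_filter, Finset.mem_univ, true_and] at this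
        exact not_inv_swap hadj this
  exact key _ x rfl

theorem rel_of_bot_eq {U : Fin n → Prop} {Θ : LatticeCon (Equiv.Perm (Fin n))}
    (hgen : HasGenerators U Θ) {x y : Equiv.Perm (Fin n)} (h : bot U x = bot U y) : Θ.r x y := by
  have key : ∀ z, Θ.r z (bot U z) := rel_bot Θ.iseqv fun z a b c hs hadj =>
    rel_of_separates hgen b _ a c rfl z _ (inv_swap (hs.1.trans hs.2.1) hadj)
      (not_inv_swap hadj) hs
  exact Θ.trans (key x) (h ▸ Θ.symm (key y))

theorem chords_eq_of_bot_eq {U : Fin n → Prop} {x y : Equiv.Perm (Fin n)}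
    (h : bot U x = bot U y) : chords U x = chords U y := by
  have key : ∀ z, chords U z = chords U (bot U z) :=
    rel_bot (R := fun z w => chords U z = chords U w)
      ⟨fun _ => rfl, fun h => h.symm, fun h h' => h.trans h'⟩ fun z a b c hs hadj =>
        (chords_swap hadj (Or.inr ⟨hs.1, hs.2.1⟩) (hs.mem_toggled hadj)).symm
  rw [key x, h, key y]

theorem bot_swap {U : Fin n → Prop} {x : Equiv.Perm (Fin n)} {s t e : Fin n}
    (hst : (x.symm t : ℕ) = x.symm s + 1) (he : (s < e ∧ e < t) ∨ (t < e ∧ e < s))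
    (heT : e ∈ toggled U x (x.symm s + 1)) : bot U (Equiv.swap s t * x) = bot U x := by
  rcases he with he | he
  · have hes := he.1.ne'
    have het := he.2.ne
    have hadj : ((Equiv.swap s t * x).symm s : ℕ) = (Equiv.swap s t * x).symm t + 1 := by
      simpa [swap_symm_apply] using hst
    have h := bot_eq_of_separates (inv_swap (he.1.trans he.2) hadj)
      (separates_of_mem_toggled (U := U) hadj he.1 he.2 (by
        rw [CambrianPolygon.mem_toggled] at heT ⊢
        rw [swap_symm_apply, swap_symm_apply, Equiv.swap_apply_right,
          Equiv.swap_apply_of_ne_of_ne hes het]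
        exact heT))
    rwa [Equiv.swap_comm t s, swap_swap_mul] at h
  · exact (bot_eq_of_separates (inv_swap (he.1.trans he.2) hst)
      (separates_of_mem_toggled hst he.1 he.2 heT)).symm

end WeakOrder

/-! ### The triangles of a permutation determine its Cambrian class -/

namespace CambrianPolygon

open WeakOrder

variable {n : ℕ}

theorem toggled_succ {U : Fin n → Prop} {x : Equiv.Perm (Fin n)} {i b : Fin n} (h : i ≠ b) :
    i ∈ toggled U x (x.symm b + 1) ↔ i ∈ toggled U x (x.symm b) := by
  have : (x.symm i : ℕ) ≠ x.symm b := fun h' => h (x.symm.injective (Fin.ext h'))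
  exact mem_toggled_congr (by omega)

theorem mem_verts_toggled_succ {U : Fin n → Prop} {x : Equiv.Perm (Fin n)} {v : Fin (n + 2)}
    {b : Fin n} (h : v ≠ inner b) :
    v ∈ verts (toggled U x (x.symm b + 1)) ↔ v ∈ verts (toggled U x (x.symm b)) := by
  by_cases h3 : v = 0
  · simp [h3, zero_mem_verts]
  by_cases h4 : v = Fin.last (n + 1)
  · simp [h4, last_mem_verts]
  obtain ⟨i, rfl⟩ := exists_inner h3 h4
  rw [inner_mem_verts, inner_mem_verts, toggled_succ fun h' => h (congrArg inner h')]

/-- The two neighbours of an index on a path. -/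
theorem exists_neighbours (H : Set (Fin n)) (b : Fin n) :
    ∃ i j, i ∈ verts H ∧ j ∈ verts H ∧ i < inner b ∧ inner b < j ∧
      ∀ m ∈ verts H, i < m → m < j → m = inner b := by
  classical
  obtain ⟨i, hi⟩ := Finset.exists_maximal (s := Finset.univ.filter fun i => i ∈ verts H ∧ i < inner b)
    ⟨0, by simp [zero_mem_verts, Fin.lt_def, inner_val]⟩
  obtain ⟨j, hj⟩ := Finset.exists_minimal (s := Finset.univ.filter fun j => j ∈ verts H ∧ inner b < j)
    ⟨Fin.last (n + 1), by simp [last_mem_verts, Fin.lt_def, inner_val]⟩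
  have hi1 := hi.1
  have hj1 := hj.1
  simp only [Finset.mem_filter, Finset.mem_univ, true_and] at hi1 hj1
  refine ⟨i, j, hi1.1, hj1.1, hi1.2, hj1.2, fun m hm h1 h2 => ?_⟩
  by_contra hne
  rcases lt_or_gt_of_ne hne with h | h
  · exact absurd (hi.2 (by simp [hm, h]) h1.le) (not_le.2 h1)
  · exact absurd (hj.2 (by simp [hm, h]) h2.le) (not_le.2 h2)

/-- `(i, b, j)` is the triangle between the polygonal paths before and after the exchange of `b`. -/
structure IsStep (U : Fin n → Prop) (x : Equiv.Perm (Fin n)) (b : Fin n) (i j : Fin (n + 2)) :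
    Prop where
  left_mem : i ∈ verts (toggled U x (x.symm b))
  right_mem : j ∈ verts (toggled U x (x.symm b))
  left_lt : i < inner b
  lt_right : inner b < j
  eq_of_mem : ∀ m ∈ verts (toggled U x (x.symm b)), i < m → m < j → m = inner b

theorem exists_isStep (U : Fin n → Prop) (x : Equiv.Perm (Fin n)) (b : Fin n) :
    ∃ i j, IsStep U x b i j := by
  obtain ⟨i, j, h1, h2, h3, h4, h5⟩ := exists_neighbours (toggled U x (x.symm b)) b
  exact ⟨i, j, h1, h2, h3, h4, h5⟩

namespace IsStep

variable {U : Fin n → Prop} {x : Equiv.Perm (Fin n)} {b : Fin n} {i j : Fin (n + 2)}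

theorem left_mem' (h : IsStep U x b i j) : i ∈ verts (toggled U x (x.symm b + 1)) :=
  (mem_verts_toggled_succ h.left_lt.ne).2 h.left_mem

theorem right_mem' (h : IsStep U x b i j) : j ∈ verts (toggled U x (x.symm b + 1)) :=
  (mem_verts_toggled_succ h.lt_right.ne').2 h.right_mem

theorem eq_of_mem' (h : IsStep U x b i j) :
    ∀ m ∈ verts (toggled U x (x.symm b + 1)), i < m → m < j → m = inner b := by
  intro m hm h1 h2
  by_contra hne
  exact hne (h.eq_of_mem m ((mem_verts_toggled_succ hne).1 hm) h1 h2)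

theorem mem_succ_of_up (hU : U b) : inner b ∈ verts (toggled U x (x.symm b + 1)) := by
  rw [inner_mem_verts, mem_toggled]
  simp [hU]

theorem not_mem_of_up (hU : U b) : inner b ∉ verts (toggled U x (x.symm b)) := by
  rw [inner_mem_verts, mem_toggled]
  simp [hU]

theorem mem_of_down (hU : ¬ U b) : inner b ∈ verts (toggled U x (x.symm b)) := by
  rw [inner_mem_verts, mem_toggled]
  simp [hU]

theorem not_mem_succ_of_down (hU : ¬ U b) : inner b ∉ verts (toggled U x (x.symm b + 1)) := by
  rw [inner_mem_verts, mem_toggled]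
  simp [hU]

theorem long_mem_of_up (h : IsStep U x b i j) (hU : U b) :
    (i, j) ∈ steps (toggled U x (x.symm b)) := by
  refine mem_steps.2 ⟨h.left_mem, h.right_mem, h.left_lt.trans h.lt_right, fun m hm h' => ?_⟩
  exact not_mem_of_up hU (h.eq_of_mem m hm h'.1 h'.2 ▸ hm)

theorem long_mem_of_down (h : IsStep U x b i j) (hU : ¬ U b) :
    (i, j) ∈ steps (toggled U x (x.symm b + 1)) := by
  refine mem_steps.2 ⟨h.left_mem', h.right_mem', h.left_lt.trans h.lt_right, fun m hm h' => ?_⟩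
  exact not_mem_succ_of_down hU (h.eq_of_mem' m hm h'.1 h'.2 ▸ hm)

theorem left_mem_of_up (h : IsStep U x b i j) (hU : U b) :
    (i, inner b) ∈ steps (toggled U x (x.symm b + 1)) :=
  mem_steps.2 ⟨h.left_mem', mem_succ_of_up hU, h.left_lt, fun m hm h' =>
    h'.2.ne (h.eq_of_mem' m hm h'.1 (h'.2.trans h.lt_right))⟩

theorem right_mem_of_up (h : IsStep U x b i j) (hU : U b) :
    (inner b, j) ∈ steps (toggled U x (x.symm b + 1)) :=
  mem_steps.2 ⟨mem_succ_of_up hU, h.right_mem', h.lt_right, fun m hm h' =>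
    h'.1.ne' (h.eq_of_mem' m hm (h.left_lt.trans h'.1) h'.2)⟩

theorem left_mem_of_down (h : IsStep U x b i j) (hU : ¬ U b) :
    (i, inner b) ∈ steps (toggled U x (x.symm b)) :=
  mem_steps.2 ⟨h.left_mem, mem_of_down hU, h.left_lt, fun m hm h' =>
    h'.2.ne (h.eq_of_mem m hm h'.1 (h'.2.trans h.lt_right))⟩

theorem right_mem_of_down (h : IsStep U x b i j) (hU : ¬ U b) :
    (inner b, j) ∈ steps (toggled U x (x.symm b)) :=
  mem_steps.2 ⟨mem_of_down hU, h.right_mem, h.lt_right, fun m hm h' =>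
    h'.1.ne' (h.eq_of_mem m hm (h.left_lt.trans h'.1) h'.2)⟩

theorem chords_mem (h : IsStep U x b i j) :
    (i, inner b) ∈ chords U x ∧ (inner b, j) ∈ chords U x ∧ (i, j) ∈ chords U x := by
  by_cases hU : U b
  · exact ⟨mem_chords_of (h.left_mem_of_up hU), mem_chords_of (h.right_mem_of_up hU),
      mem_chords_of (h.long_mem_of_up hU)⟩
  · exact ⟨mem_chords_of (h.left_mem_of_down hU), mem_chords_of (h.right_mem_of_down hU),
      mem_chords_of (h.long_mem_of_down hU)⟩

/-- There is only one triangle with the middle vertex `b`. -/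
theorem eq_of_chords_mem (h : IsStep U x b i j) {i' j' : Fin (n + 2)} (hi' : i' < inner b)
    (hj' : inner b < j') (h1 : (i', inner b) ∈ chords U x) (h2 : (inner b, j') ∈ chords U x)
    (h3 : (i', j') ∈ chords U x) : i' = i ∧ j' = j := by
  obtain ⟨k₁, -, h1⟩ := mem_chords.1 h1
  obtain ⟨k₂, -, h2⟩ := mem_chords.1 h2
  obtain ⟨k₃, -, h3⟩ := mem_chords.1 h3
  rw [mem_steps] at h1 h2 h3
  simp only at h1 h2 h3
  have hb3 : inner b ∉ verts (toggled U x k₃) := fun h' => h3.2.2.2 _ h' ⟨hi', hj'⟩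
  have hb1 := h1.2.1
  have hb2 := h2.1
  rw [inner_mem_verts, mem_toggled] at hb1 hb2 hb3
  -- at the time of the exchange, a vertex is present if it is present at both other times
  have sandwich : ∀ k, (U b ↔ (x.symm b : ℕ) < k) → ∀ v,
      (v ∈ verts (toggled U x k) ↔ v ∈ verts (toggled U x k₃)) →
      (v ∈ verts (toggled U x (x.symm b)) ↔ v ∈ verts (toggled U x k₃)) := by
    intro k hk v hv
    by_cases hU : U b
    · rw [mem_verts_toggled_of_between (k₁ := k₃) (k₂ := k) (by simp [hU] at hb3; omega)
        (by simp [hU] at hk; omega) hv.symm]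
    · rw [mem_verts_toggled_of_between (k₁ := k) (k₂ := k₃) (by simp [hU] at hk; omega)
        (by simp [hU] at hb3; omega) hv, hv]
  have hi'm := (sandwich k₁ hb1 i' (iff_of_true h1.1 h3.1)).2 h3.1
  have hj'm := (sandwich k₂ hb2 j' (iff_of_true h2.2.1 h3.2.1)).2 h3.2.1
  constructor
  · rcases lt_trichotomy i' i with hlt | heq | hlt
    · have hn1 : i ∉ verts (toggled U x k₁) := fun h' => h1.2.2.2 _ h' ⟨hlt, h.left_lt⟩
      have hn3 : i ∉ verts (toggled U x k₃) :=
        fun h' => h3.2.2.2 _ h' ⟨hlt, h.left_lt.trans hj'⟩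
      exact absurd ((sandwich k₁ hb1 i (iff_of_false hn1 hn3)).1 h.left_mem) hn3
    · exact heq
    · exact absurd (h.eq_of_mem i' hi'm hlt (hi'.trans h.lt_right)) hi'.ne
  · rcases lt_trichotomy j' j with hlt | heq | hlt
    · exact absurd (h.eq_of_mem j' hj'm (h.left_lt.trans hj') hlt) hj'.ne'
    · exact heq
    · have hn2 : j ∉ verts (toggled U x k₂) := fun h' => h2.2.2.2 _ h' ⟨h.lt_right, hlt⟩
      have hn3 : j ∉ verts (toggled U x k₃) :=
        fun h' => h3.2.2.2 _ h' ⟨hi'.trans h.lt_right, hlt⟩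
      exact absurd ((sandwich k₂ hb2 j (iff_of_false hn2 hn3)).1 h.right_mem) hn3

end IsStep

/-- If `x` and `y` have the same chords and agree in the first `k` letters, then the next letter of
`y` can be moved to the left in the word of `x` by exchanges of separated letters. -/
theorem exists_agree_succ {U : Fin n → Prop} {y : Equiv.Perm (Fin n)} (b : Fin n) : ∀ (d : ℕ)
    (x : Equiv.Perm (Fin n)), chords U x = chords U y →
      (∀ e, (y.symm e : ℕ) < y.symm b → x.symm e = y.symm e) →
      (x.symm b : ℕ) = y.symm b + d →
      ∃ z, bot U z = bot U x ∧ chords U z = chords U y ∧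
        ∀ e, (y.symm e : ℕ) < y.symm b + 1 → z.symm e = y.symm e := by
  intro d
  induction d with
  | zero =>
    intro x hc ha hd
    refine ⟨x, rfl, hc, fun e he => ?_⟩
    rcases Nat.lt_succ_iff_lt_or_eq.1 he with h | h
    · exact ha e h
    · obtain rfl := y.symm.injective (Fin.ext h)
      exact Fin.ext hd
  | succ d ih =>
    intro x hc ha hd
    have hposx : ∀ i j, (x.symm i : ℕ) = x.symm j → i = j :=
      fun i j h => x.symm.injective (Fin.ext h)
    -- the two paths agree at the time at which `y` exchanges `b`
    have hfirst : ∀ e, (x.symm e : ℕ) < y.symm b ↔ (y.symm e : ℕ) < y.symm b := by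
      intro e
      refine ⟨fun h => ?_, fun h => by rwa [ha e h]⟩
      have h1 : (y.symm (y (x.symm e)) : ℕ) < y.symm b := by rwa [Equiv.symm_apply_apply]
      have h2 := ha _ h1
      rw [Equiv.symm_apply_apply] at h2
      rw [x.symm.injective h2] at h1
      exact h1
    have hT : toggled U x (y.symm b) = toggled U y (y.symm b) := by
      ext e
      exact mem_toggled_congr (hfirst e)
    obtain ⟨i, j, hy⟩ := exists_isStep U y b
    obtain ⟨i', j', hx⟩ := exists_isStep U x b
    have hch := hy.chords_mem
    rw [← hc] at hch
    obtain ⟨rfl, rfl⟩ := hx.eq_of_chords_mem hy.left_lt hy.lt_right hch.1 hch.2.1 hch.2.2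
    obtain ⟨m, hm⟩ : ∃ m, (x.symm m : ℕ) + 1 = x.symm b := by
      have := (x.symm b).2
      exact ⟨x ⟨x.symm b - 1, by omega⟩, by simp; omega⟩
    have hmb : m ≠ b := by rintro rfl; omega
    have hlast : ∀ v, (v ∈ verts (toggled U y (y.symm b)) ↔ v ∈ verts (toggled U x (x.symm b))) →
        (v ∈ verts (toggled U x (x.symm m)) ↔ v ∈ verts (toggled U x (x.symm b))) := by
      intro v hv
      rw [← hT] at hv
      rw [mem_verts_toggled_of_between (k₁ := y.symm b) (k₂ := x.symm b) (by omega) (by omega) hv,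
        hv]
    have hmtog : inner m ∈ verts (toggled U x (x.symm m)) ↔
        ¬ inner m ∈ verts (toggled U x (x.symm b)) := by
      rw [inner_mem_verts, inner_mem_verts, mem_toggled, mem_toggled, ← hm]
      simp
    have hmi : inner m < i ∨ j < inner m := by
      by_contra hcon
      push Not at hcon
      refine absurd (hlast (inner m) ?_) (by tauto)
      rcases eq_or_lt_of_le hcon.1 with h | h
      · exact iff_of_true (h ▸ hy.left_mem) (h ▸ hx.left_mem)
      rcases eq_or_lt_of_le hcon.2 with h' | h'
      · exact iff_of_true (h' ▸ hy.right_mem) (h' ▸ hx.right_mem)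
      · exact iff_of_false
          (fun h'' => hmb (inner_injective (hy.eq_of_mem _ h'' h h')))
          (fun h'' => hmb (inner_injective (hx.eq_of_mem _ h'' h h')))
    obtain ⟨e, he, heT⟩ : ∃ e, ((m < e ∧ e < b) ∨ (b < e ∧ e < m)) ∧
        e ∈ toggled U x (x.symm m + 1) := by
      rw [hm]
      rcases hmi with h | h
      · obtain ⟨e, rfl⟩ := exists_inner_of_lt h hy.left_lt
        exact ⟨e, Or.inl ⟨inner_lt_inner.1 h, inner_lt_inner.1 hy.left_lt⟩,
          inner_mem_verts.1 hx.left_mem⟩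
      · obtain ⟨e, rfl⟩ := exists_inner_of_lt hy.lt_right h
        exact ⟨e, Or.inr ⟨inner_lt_inner.1 hy.lt_right, inner_lt_inner.1 h⟩,
          inner_mem_verts.1 hx.right_mem⟩
    obtain ⟨z, hz1, hz2, hz3⟩ := ih (Equiv.swap m b * x) ((chords_swap hm.symm he heT).trans hc)
      (fun e' he' => by
        have h1 := (hfirst e').2 he'
        rw [swap_symm_apply, Equiv.swap_apply_of_ne_of_ne, ha e' he']
        · rintro rfl; omega
        · rintro rfl; omega)
      (by rw [swap_symm_apply, Equiv.swap_apply_right]; omega)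
    exact ⟨z, hz1.trans (bot_swap hm.symm he heT), hz2, hz3⟩

theorem bot_eq_of_chords_eq {U : Fin n → Prop} {x y : Equiv.Perm (Fin n)}
    (h : chords U x = chords U y) : bot U x = bot U y := by
  have key : ∀ k ≤ n, ∃ z, bot U z = bot U x ∧ chords U z = chords U y ∧
      ∀ e, (y.symm e : ℕ) < k → z.symm e = y.symm e := by
    intro k
    induction k with
    | zero => exact fun _ => ⟨x, rfl, h, fun e he => by omega⟩
    | succ k ih =>
      intro hk
      obtain ⟨z, hz1, hz2, hz3⟩ := ih (by omega)
      have hb : (y.symm (y ⟨k, hk⟩) : ℕ) = k := by simp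
      have hle : k ≤ (z.symm (y ⟨k, hk⟩) : ℕ) := by
        by_contra hlt
        push Not at hlt
        have h2 := hz3 (y (z.symm (y ⟨k, hk⟩))) (by simpa using hlt)
        rw [Equiv.symm_apply_apply] at h2
        have h3 := y.injective (z.symm.injective h2)
        rw [h3] at hlt
        exact lt_irrefl _ hlt
      obtain ⟨w, hw1, hw2, hw3⟩ := exists_agree_succ (y ⟨k, hk⟩) (z.symm (y ⟨k, hk⟩) - k) z hz2
        (fun e he => hz3 e (by omega)) (by omega)
      exact ⟨w, hw1.trans hz1, hw2, fun e he => hw3 e (by omega)⟩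
  obtain ⟨z, hz1, -, hz3⟩ := key n le_rfl
  have : z = y := by
    have h4 : z.symm = y.symm := Equiv.ext fun e => hz3 e (y.symm e).2
    rw [← z.symm_symm, h4, y.symm_symm]
  rw [← hz1, this]

end CambrianPolygon

/-! ### The Cambrian congruence of the polygon -/

namespace WeakOrder

variable {n : ℕ}

theorem inv_adjacent_swap {a b : Fin n} (hab : (a : ℕ) + 1 = b) (p q : Fin n) :
    Inv (Equiv.swap a b) p q ↔ p = a ∧ q = b := by
  have hsym : ∀ i, ((Equiv.swap a b).symm i : ℕ) =
      if i = a then (b : ℕ) else if i = b then (a : ℕ) else i := by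
    intro i
    rw [Equiv.symm_swap, Equiv.swap_apply_def]
    split_ifs <;> rfl
  simp only [Inv, Fin.lt_def, hsym, Fin.ext_iff]
  split_ifs <;> omega

theorem inv_swap_mul_swap_up {a b c : Fin n} (hab : (a : ℕ) + 1 = b) (hbc : (b : ℕ) + 1 = c)
    (p q : Fin n) :
    Inv (Equiv.swap a b * Equiv.swap b c) p q ↔ (p = a ∧ q = b) ∨ (p = a ∧ q = c) := by
  have hsym : ∀ i, ((Equiv.swap a b * Equiv.swap b c).symm i : ℕ) =
      if i = a then (c : ℕ) else if i = b then (a : ℕ) else if i = c then (b : ℕ) else i := by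
    intro i
    change ((Equiv.swap b c) (Equiv.swap a b i) : ℕ) = _
    rw [Equiv.swap_apply_def, Equiv.swap_apply_def]
    simp only [Fin.ext_iff]
    split_ifs <;> first | rfl | omega
  simp only [Inv, Fin.lt_def, hsym, Fin.ext_iff]
  split_ifs <;> omega

theorem inv_swap_mul_swap_down {a b c : Fin n} (hab : (a : ℕ) + 1 = b) (hbc : (b : ℕ) + 1 = c)
    (p q : Fin n) :
    Inv (Equiv.swap b c * Equiv.swap a b) p q ↔ (p = b ∧ q = c) ∨ (p = a ∧ q = c) := by
  have hsym : ∀ i, ((Equiv.swap b c * Equiv.swap a b).symm i : ℕ) =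
      if i = a then (b : ℕ) else if i = b then (c : ℕ) else if i = c then (a : ℕ) else i := by
    intro i
    change ((Equiv.swap a b) (Equiv.swap b c i) : ℕ) = _
    rw [Equiv.swap_apply_def, Equiv.swap_apply_def]
    simp only [Fin.ext_iff]
    split_ifs <;> first | rfl | omega
  simp only [Inv, Fin.lt_def, hsym, Fin.ext_iff]
  split_ifs <;> omega

theorem bot_swap_mul_swap_up {U : Fin n → Prop} {a b c : Fin n} (hab : (a : ℕ) + 1 = b)
    (hbc : (b : ℕ) + 1 = c) (hU : U b) :
    bot U (Equiv.swap a b * Equiv.swap b c) = bot U (Equiv.swap a b) := by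
  refine bot_eq_of_separates (a := a) (b := b) (c := c) (fun p q => ?_)
    ⟨?_, ?_, Or.inl ⟨hU, ?_⟩⟩
  · rw [inv_swap_mul_swap_up hab hbc, inv_adjacent_swap hab]
  · rw [Fin.lt_def]; omega
  · rw [Fin.lt_def]; omega
  · rw [inv_swap_mul_swap_up hab hbc]
    simp only [Fin.ext_iff]
    omega

theorem bot_swap_mul_swap_down {U : Fin n → Prop} {a b c : Fin n} (hab : (a : ℕ) + 1 = b)
    (hbc : (b : ℕ) + 1 = c) (hU : ¬ U b) :
    bot U (Equiv.swap b c * Equiv.swap a b) = bot U (Equiv.swap b c) := by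
  refine bot_eq_of_separates (a := a) (b := b) (c := c) (fun p q => ?_)
    ⟨?_, ?_, Or.inr ⟨hU, ?_⟩⟩
  · rw [inv_swap_mul_swap_down hab hbc, inv_adjacent_swap hbc]
  · rw [Fin.lt_def]; omega
  · rw [Fin.lt_def]; omega
  · rw [inv_swap_mul_swap_down hab hbc]
    simp only [Fin.ext_iff]
    omega

end WeakOrder

namespace CambrianPolygon

open WeakOrder

variable {n : ℕ} (Q : CambrianPolygon n)

/-- The up indices. -/
def Up (i : Fin n) : Prop := 0 < Q.f (inner i)

theorem pathSet_eq (x : Equiv.Perm (Fin n)) (k : ℕ) : Q.pathSet x k = toggled Q.Up x k := by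
  ext i
  rw [pathSet, Set.mem_symmDiff, mem_toggled, Up]
  simp only [Set.mem_ofPred_eq]
  rw [← not_lt]
  tauto

theorem not_up_iff {i : Fin n} : ¬ Q.Up i ↔ Q.f (inner i) ≤ 0 := not_lt

theorem arrow_iff {s t : Fin (n - 1)} : Q.orientation.arrow s t ↔
    ((t : ℕ) + 1 = s ∧ Q.Up ⟨s, by omega⟩) ∨ ((s : ℕ) + 1 = t ∧ ¬ Q.Up ⟨t, by omega⟩) := by
  have h : ∀ i : Fin n, 0 ≤ Q.f (inner i) ↔ Q.Up i := fun i =>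
    ⟨fun h => lt_of_le_of_ne h (Q.f_inner_ne_zero i).symm, le_of_lt⟩
  simp only [orientation, h, not_up_iff]

theorem alternatingProd_two {W : Type*} [Group W] (t s : W) : alternatingProd t s 2 = t * s := by
  simp [alternatingProd, List.range_succ]

theorem coxeterA_of_arrow {s t : Fin (n - 1)} (h : Q.orientation.arrow s t) :
    CoxeterMatrix.A (n - 1) s t = 3 := by
  have h' : (t : ℕ) + 1 = s ∨ (s : ℕ) + 1 = t := by
    rw [arrow_iff] at h
    tauto
  have hne : s ≠ t := by rintro rfl; omega
  simp [CoxeterMatrix.A, hne, h']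

theorem hasGenerators {Θ : LatticeCon (Equiv.Perm (Fin n))}
    (h : ∀ s t, Q.orientation.arrow s t →
      Θ.r (simpleRefl n t) (simpleRefl n t * simpleRefl n s)) : HasGenerators Q.Up Θ := by
  intro a b c hab hbc
  have hc := c.2
  by_cases hU : Q.Up b
  · have h1 := h ⟨b, by omega⟩ ⟨a, by omega⟩ (Q.arrow_iff.2 (Or.inl ⟨hab, hU⟩))
    have e1 : simpleRefl n ⟨a, by omega⟩ = Equiv.swap a b :=
      congrArg₂ Equiv.swap (Fin.ext rfl) (Fin.ext hab)
    have e2 : simpleRefl n ⟨b, by omega⟩ = Equiv.swap b c :=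
      congrArg₂ Equiv.swap (Fin.ext rfl) (Fin.ext hbc)
    rw [e1, e2] at h1
    refine ⟨_, _, Θ.symm h1, fun p q => ?_, fun p q => ?_⟩
    · rw [inv_adjacent_swap hab]
      simp [hU]
    · rw [inv_adjacent_swap hab, inv_swap_mul_swap_up hab hbc]
  · have h1 := h ⟨a, by omega⟩ ⟨b, by omega⟩ (Q.arrow_iff.2 (Or.inr ⟨hab, hU⟩))
    have e1 : simpleRefl n ⟨a, by omega⟩ = Equiv.swap a b :=
      congrArg₂ Equiv.swap (Fin.ext rfl) (Fin.ext hab)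
    have e2 : simpleRefl n ⟨b, by omega⟩ = Equiv.swap b c :=
      congrArg₂ Equiv.swap (Fin.ext rfl) (Fin.ext hbc)
    rw [e1, e2] at h1
    refine ⟨_, _, Θ.symm h1, fun p q => ?_, fun p q => ?_⟩
    · rw [inv_adjacent_swap hbc]
      simp [hU]
    · rw [inv_adjacent_swap hbc, inv_swap_mul_swap_down hab hbc]

theorem botCon_generators {s t : Fin (n - 1)} (h : Q.orientation.arrow s t) :
    bot Q.Up (simpleRefl n t * simpleRefl n s) = bot Q.Up (simpleRefl n t) := by
  rcases Q.arrow_iff.1 h with ⟨h1, hU⟩ | ⟨h1, hU⟩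
  · have e1 : simpleRefl n t = Equiv.swap ⟨t, by omega⟩ ⟨s, by omega⟩ :=
      congrArg₂ Equiv.swap (Fin.ext rfl) (Fin.ext h1)
    have e2 : simpleRefl n s = Equiv.swap ⟨s, by omega⟩ ⟨s + 1, by omega⟩ := rfl
    rw [e1, e2]
    exact bot_swap_mul_swap_up h1 rfl hU
  · have e1 : simpleRefl n s = Equiv.swap ⟨s, by omega⟩ ⟨t, by omega⟩ :=
      congrArg₂ Equiv.swap (Fin.ext rfl) (Fin.ext h1)
    have e2 : simpleRefl n t = Equiv.swap ⟨t, by omega⟩ ⟨t + 1, by omega⟩ := rfl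
    rw [e1, e2]
    exact bot_swap_mul_swap_down h1 rfl hU

/-- The Cambrian congruence identifies the permutations with the same chords. -/
theorem cambrianCon_iff {x y : Equiv.Perm (Fin n)} :
    (cambrianCon Q.orientation).r x y ↔ chords Q.Up x = chords Q.Up y := by
  have hprod : ∀ s t, Q.orientation.arrow s t → alternatingProd (simpleRefl n t) (simpleRefl n s)
      (CoxeterMatrix.A (n - 1) s t - 1) = simpleRefl n t * simpleRefl n s := by
    intro s t h
    rw [Q.coxeterA_of_arrow h, alternatingProd_two]
  constructor
  · intro h
    refine chords_eq_of_bot_eq (U := Q.Up) (h (botCon Q.Up) ?_)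
    rintro _ _ ⟨s, t, hst, rfl, rfl⟩
    rw [hprod s t hst]
    exact (Q.botCon_generators hst).symm
  · intro h Θ hΘ
    exact rel_of_bot_eq (Q.hasGenerators fun s t hst => hΘ _ _ ⟨s, t, hst, rfl, (hprod s t hst).symm⟩)
      (bot_eq_of_chords_eq h)

end CambrianPolygon

/-! ### Crossing of chords in terms of up and down vertices -/

namespace CambrianPolygon

section Chord

variable {N : ℕ} {up : Fin N → Prop}

/-- For two chords over a common strip of a polygon with the set `up` of upper vertices: the chord
`c` is nowhere above `d`. Both chords are graphs over their vertical strips, so this is a condition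
at the two ends of the common strip; there, a vertex of one chord lies above the other chord if and
only if it is an upper vertex. -/
def LeChord (up : Fin N → Prop) (c d : Fin N × Fin N) : Prop :=
  (c.1 < d.1 → up d.1) ∧ (d.1 < c.1 → ¬ up c.1) ∧ (d.2 < c.2 → up d.2) ∧ (c.2 < d.2 → ¬ up c.2)

/-- The two chords do not cross. -/
def Compat (up : Fin N → Prop) (c d : Fin N × Fin N) : Prop :=
  c.1 < d.2 → d.1 < c.2 → LeChord up c d ∨ LeChord up d c

theorem LeChord.antisymm {c d : Fin N × Fin N} (h : LeChord up c d) (h' : LeChord up d c) :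
    c = d := by
  unfold LeChord at *
  grind

theorem LeChord.refl (c : Fin N × Fin N) : LeChord up c c := by
  unfold LeChord
  grind

theorem Compat.symm {c d : Fin N × Fin N} (h : Compat up c d) : Compat up d c :=
  fun h1 h2 => (h h2 h1).symm

/-- A set of pairwise non-crossing chords that is maximal with this property, in terms of the upper
vertices. -/
structure IsTriang (up : Fin N → Prop) (T : Set (Fin N × Fin N)) : Prop where
  lt : ∀ c ∈ T, c.1 < c.2
  compat : ∀ c ∈ T, ∀ d ∈ T, Compat up c d
  mem : ∀ c, c.1 < c.2 → (∀ d ∈ T, Compat up c d) → c ∈ T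

/-! The six cases of one fact: if `d` lies directly below `c` over some strip in a set of pairwise
non-crossing chords, then the segment that joins the two left ends, the two right ends, or an inner
pair of ends crosses no chord of the set, as a chord that crosses it would have to cross `c` or `d`
or lie between them. -/

theorem compat_diagonal_of_lt {i j k l m p r : Fin N} (h2 : j ≤ m) (h3 : m < k) (h4 : m < l)
    (hdc : LeChord up (j, l) (i, k)) (hij : i < j)
    (hgc : Compat up (p, r) (i, k)) (hgd : Compat up (p, r) (j, l))
    (hno : p ≤ m → m < r → LeChord up (j, l) (p, r) → LeChord up (p, r) (i, k) →
      (p, r) = (i, k) ∨ (p, r) = (j, l)) : Compat up (j, k) (p, r) := by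
  unfold Compat LeChord at *
  simp only [Prod.mk.injEq] at *
  grind (splits := 40)

theorem compat_diagonal_of_gt {i j k l m p r : Fin N} (h1 : i ≤ m) (h3 : m < k) (h4 : m < l)
    (hdc : LeChord up (j, l) (i, k)) (hij : j < i)
    (hgc : Compat up (p, r) (i, k)) (hgd : Compat up (p, r) (j, l))
    (hno : p ≤ m → m < r → LeChord up (j, l) (p, r) → LeChord up (p, r) (i, k) →
      (p, r) = (i, k) ∨ (p, r) = (j, l)) : Compat up (i, l) (p, r) := by
  unfold Compat LeChord at *
  simp only [Prod.mk.injEq] at *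
  grind (splits := 40)

theorem compat_left_of_lt {i j k m p r : Fin N} (h2 : j ≤ m) (h3 : m < k)
    (hdc : LeChord up (j, k) (i, k)) (hij : i < j)
    (hgc : Compat up (p, r) (i, k)) (hgd : Compat up (p, r) (j, k))
    (hno : p ≤ m → m < r → LeChord up (j, k) (p, r) → LeChord up (p, r) (i, k) →
      (p, r) = (i, k) ∨ (p, r) = (j, k)) : Compat up (i, j) (p, r) := by
  unfold Compat LeChord at *
  simp only [Prod.mk.injEq] at *
  grind (splits := 40)

theorem compat_left_of_gt {i j k m p r : Fin N} (h1 : i ≤ m) (h3 : m < k)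
    (hdc : LeChord up (j, k) (i, k)) (hij : j < i)
    (hgc : Compat up (p, r) (i, k)) (hgd : Compat up (p, r) (j, k))
    (hno : p ≤ m → m < r → LeChord up (j, k) (p, r) → LeChord up (p, r) (i, k) →
      (p, r) = (i, k) ∨ (p, r) = (j, k)) : Compat up (j, i) (p, r) := by
  unfold Compat LeChord at *
  simp only [Prod.mk.injEq] at *
  grind (splits := 40)

theorem compat_right_of_lt {i k l m p r : Fin N} (h1 : i ≤ m) (h3 : m < k)
    (hdc : LeChord up (i, l) (i, k)) (hkl : k < l)
    (hgc : Compat up (p, r) (i, k)) (hgd : Compat up (p, r) (i, l))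
    (hno : p ≤ m → m < r → LeChord up (i, l) (p, r) → LeChord up (p, r) (i, k) →
      (p, r) = (i, k) ∨ (p, r) = (i, l)) : Compat up (k, l) (p, r) := by
  unfold Compat LeChord at *
  simp only [Prod.mk.injEq] at *
  grind (splits := 40)

theorem compat_right_of_gt {i k l m p r : Fin N} (h1 : i ≤ m) (h4 : m < l)
    (hdc : LeChord up (i, l) (i, k)) (hkl : l < k)
    (hgc : Compat up (p, r) (i, k)) (hgd : Compat up (p, r) (i, l))
    (hno : p ≤ m → m < r → LeChord up (i, l) (p, r) → LeChord up (p, r) (i, k) →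
      (p, r) = (i, k) ∨ (p, r) = (i, l)) : Compat up (l, k) (p, r) := by
  unfold Compat LeChord at *
  simp only [Prod.mk.injEq] at *
  grind (splits := 40)

/-- Two chords of a triangulation that are neighbours in the vertical order over some strip are two
sides of a triangle: otherwise a diagonal of the region between them could be added. -/
theorem IsTriang.exists_triangle {T : Set (Fin N × Fin N)} (hT : IsTriang up T) {m : Fin N}
    {c d : Fin N × Fin N} (hc : c ∈ T) (hd : d ∈ T) (hcm : c.1 ≤ m) (hmc : m < c.2)
    (hdm : d.1 ≤ m) (hmd : m < d.2) (hdc : LeChord up d c) (hne : d ≠ c)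
    (hno : ∀ e ∈ T, e.1 ≤ m → m < e.2 → LeChord up d e → LeChord up e c → e = c ∨ e = d) :
    ∃ i j k, (i, j) ∈ T ∧ (j, k) ∈ T ∧ (i, k) ∈ T ∧
      c ∈ ({(i, j), (j, k), (i, k)} : Set (Fin N × Fin N)) ∧
      d ∈ ({(i, j), (j, k), (i, k)} : Set (Fin N × Fin N)) := by
  obtain ⟨i, k⟩ := c
  obtain ⟨j, l⟩ := d
  simp only at hcm hmc hdm hmd
  have hC : ∀ g ∈ T, Compat up g (i, k) := fun g hg => hT.compat g hg _ hc
  have hD : ∀ g ∈ T, Compat up g (j, l) := fun g hg => hT.compat g hg _ hd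
  have hik := hT.lt _ hc
  have hjl := hT.lt _ hd
  simp only at hik hjl
  rcases lt_trichotomy i j with hij | rfl | hij
  · rcases eq_or_ne k l with rfl | hkl
    · have h : (i, j) ∈ T := hT.mem _ hij fun g hg =>
        compat_left_of_lt hdm hmc hdc hij (hC g hg) (hD g hg) (hno g hg)
      exact ⟨i, j, k, h, hd, hc, by simp, by simp⟩
    · have h : (j, k) ∈ T := hT.mem _ (hdm.trans_lt hmc) fun g hg =>
        compat_diagonal_of_lt hdm hmc hmd hdc hij (hC g hg) (hD g hg) (hno g hg)
      have h1 : LeChord up (j, l) (j, k) ∧ LeChord up (j, k) (i, k) := by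
        unfold LeChord at *
        grind
      rcases hno _ h hdm hmc h1.1 h1.2 with h2 | h2
      · exact absurd (congrArg Prod.fst h2) hij.ne'
      · exact absurd (congrArg Prod.snd h2) hkl
  · rcases lt_trichotomy k l with hkl | rfl | hkl
    · have h : (k, l) ∈ T := hT.mem _ hkl fun g hg =>
        compat_right_of_lt hcm hmc hdc hkl (hC g hg) (hD g hg) (hno g hg)
      exact ⟨i, k, l, hc, h, hd, by simp, by simp⟩
    · exact absurd rfl hne
    · have h : (l, k) ∈ T := hT.mem _ hkl fun g hg =>
        compat_right_of_gt hcm hmd hdc hkl (hC g hg) (hD g hg) (hno g hg)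
      exact ⟨i, l, k, hd, h, hc, by simp, by simp⟩
  · rcases eq_or_ne k l with rfl | hkl
    · have h : (j, i) ∈ T := hT.mem _ hij fun g hg =>
        compat_left_of_gt hcm hmc hdc hij (hC g hg) (hD g hg) (hno g hg)
      exact ⟨j, i, k, h, hc, hd, by simp, by simp⟩
    · have h : (i, l) ∈ T := hT.mem _ (hcm.trans_lt hmd) fun g hg =>
        compat_diagonal_of_gt hcm hmc hmd hdc hij (hC g hg) (hD g hg) (hno g hg)
      have h1 : LeChord up (j, l) (i, l) ∧ LeChord up (i, l) (i, k) := by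
        unfold LeChord at *
        grind
      rcases hno _ h hcm hmd h1.1 h1.2 with h2 | h2
      · exact absurd (congrArg Prod.snd h2).symm hkl
      · exact absurd (congrArg Prod.fst h2) hij.ne'

/-- The one of the two short sides `(i, j)` and `(j, k)` of the triangle `i < j < k` that lies over
the strip between `m` and its successor, where `i ≤ m < k`. -/
def shortSide (i j k m : Fin N) : Fin N × Fin N := if m < j then (i, j) else (j, k)

/-- No chord enters the interior of a triangle whose sides it does not cross. -/
theorem leChord_triangle_of_up {i j k m : Fin N} {g : Fin N × Fin N} (hij : i < j) (hjk : j < k)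
    (him : i ≤ m) (hmk : m < k) (hgm : g.1 ≤ m) (hmg : m < g.2) (hj : up j)
    (h1 : Compat up g (i, j)) (h2 : Compat up g (j, k)) (h3 : Compat up g (i, k)) :
    LeChord up g (i, k) ∨ LeChord up (shortSide i j k m) g := by
  unfold Compat LeChord shortSide at *
  obtain ⟨p, r⟩ := g
  simp only at *
  grind (splits := 40)

theorem leChord_triangle_of_down {i j k m : Fin N} {g : Fin N × Fin N} (hij : i < j) (hjk : j < k)
    (him : i ≤ m) (hmk : m < k) (hgm : g.1 ≤ m) (hmg : m < g.2) (hj : ¬ up j)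
    (h1 : Compat up g (i, j)) (h2 : Compat up g (j, k)) (h3 : Compat up g (i, k)) :
    LeChord up g (shortSide i j k m) ∨ LeChord up (i, k) g := by
  unfold Compat LeChord shortSide at *
  obtain ⟨p, r⟩ := g
  simp only at *
  grind (splits := 40)

/-! A chord that lies between the sides of the triangle `i < b < j` and crosses none of them is one
of the sides. -/

theorem eq_long_of_leChord_left {i b j : Fin N} {c : Fin N × Fin N} (hbj : b < j)
    (hb : up b) (hc : c.1 < b) (hc' : i < c.2) (h1 : LeChord up (i, j) c)
    (h2 : LeChord up c (i, b)) (h3 : Compat up c (b, j)) (hne : c ≠ (i, b)) : c = (i, j) := by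
  unfold Compat LeChord at *
  obtain ⟨p, r⟩ := c
  simp only [Prod.mk.injEq, ne_eq] at *
  grind (splits := 40)

theorem eq_long_of_leChord_right {i b j : Fin N} {c : Fin N × Fin N} (hib : i < b)
    (hb : up b) (hc : c.1 < j) (hc' : b < c.2) (h1 : LeChord up (i, j) c)
    (h2 : LeChord up c (b, j)) (h3 : Compat up c (i, b)) (hne : c ≠ (b, j)) : c = (i, j) := by
  unfold Compat LeChord at *
  obtain ⟨p, r⟩ := c
  simp only [Prod.mk.injEq, ne_eq] at *
  grind (splits := 40)

theorem eq_short_of_leChord {i b j : Fin N} {c : Fin N × Fin N} (hib : i < b) (hbj : b < j)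
    (hc : c.1 < j) (hc' : i < c.2) (h : c.1 < c.2)
    (h1 : c.1 < b → i < c.2 → LeChord up (i, b) c) (h2 : c.1 < j → b < c.2 → LeChord up (b, j) c)
    (h3 : LeChord up c (i, j)) (hne : c ≠ (i, j)) : c = (i, b) ∨ c = (b, j) := by
  unfold LeChord at *
  obtain ⟨p, r⟩ := c
  simp only [Prod.mk.injEq, ne_eq] at *
  grind (splits := 40)

end Chord

/-! ### The chords of a permutation form a triangulation -/

section ChordsTriang

variable {n : ℕ} {up : Fin (n + 2) → Prop} {x : Equiv.Perm (Fin n)}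

theorem up_of_not_mem_of_mem {u v w : Fin (n + 2)} (huv : u < v) (hvw : v < w) {k l : ℕ}
    (hkl : k ≤ l) (h : v ∉ verts (toggled (fun i => up (inner i)) x k))
    (h' : v ∈ verts (toggled (fun i => up (inner i)) x l)) : up v := by
  obtain ⟨i, rfl⟩ := exists_inner_of_lt huv hvw
  rw [inner_mem_verts, mem_toggled] at h h'
  grind

theorem not_up_of_mem_of_not_mem {u v w : Fin (n + 2)} (huv : u < v) (hvw : v < w) {k l : ℕ}
    (hkl : k ≤ l) (h : v ∈ verts (toggled (fun i => up (inner i)) x k))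
    (h' : v ∉ verts (toggled (fun i => up (inner i)) x l)) : ¬ up v := by
  obtain ⟨i, rfl⟩ := exists_inner_of_lt huv hvw
  rw [inner_mem_verts, mem_toggled] at h h'
  grind

theorem mem_verts_toggled_zero {u v w : Fin (n + 2)} (huv : u < v) (hvw : v < w) :
    v ∈ verts (toggled (fun i => up (inner i)) x 0) ↔ ¬ up v := by
  obtain ⟨i, rfl⟩ := exists_inner_of_lt huv hvw
  rw [inner_mem_verts, mem_toggled]
  simp

theorem mem_verts_toggled_last {u v w : Fin (n + 2)} (huv : u < v) (hvw : v < w) :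
    v ∈ verts (toggled (fun i => up (inner i)) x n) ↔ up v := by
  obtain ⟨i, rfl⟩ := exists_inner_of_lt huv hvw
  rw [inner_mem_verts, mem_toggled]
  simp

/-- The paths of a permutation move upwards. -/
theorem leChord_of_steps {k l : ℕ} (hkl : k ≤ l) {c d : Fin (n + 2) × Fin (n + 2)}
    (hc : c ∈ steps (toggled (fun i => up (inner i)) x k))
    (hd : d ∈ steps (toggled (fun i => up (inner i)) x l)) (h1 : c.1 < d.2) (h2 : d.1 < c.2) :
    LeChord up c d := by
  obtain ⟨c1, c2, c3, c4⟩ := mem_steps.1 hc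
  obtain ⟨d1, d2, d3, d4⟩ := mem_steps.1 hd
  exact ⟨fun h => up_of_not_mem_of_mem h h2 hkl (fun h' => c4 _ h' ⟨h, h2⟩) d1,
    fun h => not_up_of_mem_of_not_mem h h1 hkl c1 fun h' => d4 _ h' ⟨h, h1⟩,
    fun h => up_of_not_mem_of_mem h1 h hkl (fun h' => c4 _ h' ⟨h1, h⟩) d2,
    fun h => not_up_of_mem_of_not_mem h2 h hkl c2 fun h' => d4 _ h' ⟨h2, h⟩⟩

theorem leChord_of_steps_zero {c d : Fin (n + 2) × Fin (n + 2)}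
    (hd : d ∈ steps (toggled (fun i => up (inner i)) x 0)) (h1 : c.1 < d.2) (h2 : d.1 < c.2) :
    LeChord up d c := by
  obtain ⟨d1, d2, d3, d4⟩ := mem_steps.1 hd
  refine ⟨fun h => ?_, fun h => (mem_verts_toggled_zero h d3).1 d1, fun h => ?_,
    fun h => (mem_verts_toggled_zero d3 h).1 d2⟩
  · by_contra h'
    exact d4 _ ((mem_verts_toggled_zero h h1).2 h') ⟨h, h1⟩
  · by_contra h'
    exact d4 _ ((mem_verts_toggled_zero h2 h).2 h') ⟨h2, h⟩

theorem leChord_of_steps_last {c d : Fin (n + 2) × Fin (n + 2)}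
    (hd : d ∈ steps (toggled (fun i => up (inner i)) x n)) (h1 : c.1 < d.2) (h2 : d.1 < c.2) :
    LeChord up c d := by
  obtain ⟨d1, d2, d3, d4⟩ := mem_steps.1 hd
  refine ⟨fun h => (mem_verts_toggled_last h d3).1 d1, fun h h' => ?_,
    fun h => (mem_verts_toggled_last d3 h).1 d2, fun h h' => ?_⟩
  · exact d4 _ ((mem_verts_toggled_last h h1).2 h') ⟨h, h1⟩
  · exact d4 _ ((mem_verts_toggled_last h2 h).2 h') ⟨h2, h⟩

/-- Every strip is crossed by a step of each path. -/
theorem exists_step (H : Set (Fin n)) {m m' : Fin (n + 2)} (hm : m < m') :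
    ∃ c ∈ steps H, c.1 ≤ m ∧ m < c.2 := by
  classical
  obtain ⟨i, hi⟩ := Finset.exists_maximal (s := Finset.univ.filter fun i => i ∈ verts H ∧ i ≤ m)
    ⟨0, by simp [zero_mem_verts]⟩
  obtain ⟨j, hj⟩ := Finset.exists_minimal (s := Finset.univ.filter fun j => j ∈ verts H ∧ m < j)
    ⟨Fin.last (n + 1), by simpa [last_mem_verts] using hm.trans_le (Fin.le_last m')⟩
  have hi1 := hi.1
  have hj1 := hj.1
  simp only [Finset.mem_filter, Finset.mem_univ, true_and] at hi1 hj1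
  refine ⟨(i, j), mem_steps.2 ⟨hi1.1, hj1.1, hi1.2.trans_lt hj1.2, fun v hv h => ?_⟩, hi1.2, hj1.2⟩
  rcases le_or_gt v m with h' | h'
  · exact absurd (hi.2 (by simp [hv, h']) h.1.le) (not_le.2 h.1)
  · exact absurd (hj.2 (by simp [hv, h']) h.2.le) (not_le.2 h.2)

theorem IsStep.mem_steps_succ {U : Fin n → Prop} {b : Fin n} {i j : Fin (n + 2)}
    (h : IsStep U x b i j) {d : Fin (n + 2) × Fin (n + 2)}
    (hd : d ∈ steps (toggled U x (x.symm b + 1))) (hd' : d ∉ steps (toggled U x (x.symm b))) :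
    (U b ∧ (d = (i, inner b) ∨ d = (inner b, j))) ∨ (¬ U b ∧ d = (i, j)) := by
  have hb : d.1 ≤ inner b ∧ inner b ≤ d.2 := by
    by_contra hcon
    refine hd' (steps_congr hd fun i' h1 h2 => toggled_succ ?_)
    rintro rfl
    exact hcon ⟨h1, h2⟩
  obtain ⟨d1, d2, d3, d4⟩ := mem_steps.1 hd
  have hleft : d.1 < inner b → d.1 = i := by
    intro h1
    rcases lt_trichotomy d.1 i with h2 | h2 | h2
    · exact absurd ⟨h2, h.left_lt.trans_le hb.2⟩ (d4 _ h.left_mem')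
    · exact h2
    · exact absurd (h.eq_of_mem' _ d1 h2 (h1.trans h.lt_right)) h1.ne
  have hright : inner b < d.2 → d.2 = j := by
    intro h1
    rcases lt_trichotomy d.2 j with h2 | h2 | h2
    · exact absurd (h.eq_of_mem' _ d2 (h.left_lt.trans h1) h2) h1.ne'
    · exact h2
    · exact absurd ⟨hb.1.trans_lt h.lt_right, h2⟩ (d4 _ h.right_mem')
  by_cases hU : U b
  · refine Or.inl ⟨hU, ?_⟩
    rcases eq_or_lt_of_le hb.1 with h1 | h1
    · exact Or.inr (Prod.ext h1 (hright (h1 ▸ d3)))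
    rcases eq_or_lt_of_le hb.2 with h2 | h2
    · exact Or.inl (Prod.ext (hleft h1) h2.symm)
    · exact absurd ⟨h1, h2⟩ (d4 _ (IsStep.mem_succ_of_up hU))
  · have hnb := IsStep.not_mem_succ_of_down (x := x) hU
    refine Or.inr ⟨hU, Prod.ext (hleft (lt_of_le_of_ne hb.1 ?_)) (hright (lt_of_le_of_ne hb.2 ?_))⟩
    · rintro h1; exact hnb (h1 ▸ d1)
    · rintro h1; exact hnb (h1 ▸ d2)

theorem isTriang_chords (up : Fin (n + 2) → Prop) (x : Equiv.Perm (Fin n)) :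
    IsTriang up (chords (fun i => up (inner i)) x) where
  lt c hc := by
    obtain ⟨k, -, hc⟩ := mem_chords.1 hc
    exact (mem_steps.1 hc).2.2.1
  compat c hc d hd h1 h2 := by
    obtain ⟨k, -, hc⟩ := mem_chords.1 hc
    obtain ⟨l, -, hd⟩ := mem_chords.1 hd
    rcases le_total k l with hkl | hkl
    · exact Or.inl (leChord_of_steps hkl hc hd h1 h2)
    · exact Or.inr (leChord_of_steps hkl hd hc h2 h1)
  mem c hlt hc := by
    by_contra hcon
    -- the chord lies above all the paths: look at the first path that is not below it
    have key : ∀ k ≤ n, ∀ d ∈ steps (toggled (fun i => up (inner i)) x k), c.1 < d.2 →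
        d.1 < c.2 → LeChord up d c := by
      intro k
      induction k with
      | zero => exact fun _ d hd => leChord_of_steps_zero hd
      | succ k ih =>
        intro hk d hd h1 h2
        by_contra hdc
        have hcd := (hc d (mem_chords_of hd) h1 h2).resolve_right hdc
        have hne : c ≠ d := by rintro rfl; exact hdc (LeChord.refl _)
        obtain ⟨b, hb⟩ : ∃ b, (x.symm b : ℕ) = k := ⟨x ⟨k, hk⟩, by simp⟩
        obtain ⟨i, j, hs⟩ := exists_isStep (fun i => up (inner i)) x b
        have hch := hs.chords_mem
        have ih' := ih (by omega)
        rw [← hb] at hd ih'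
        rcases hs.mem_steps_succ hd fun hd' => hdc (ih' d hd' h1 h2) with
          ⟨hU, rfl | rfl⟩ | ⟨hU, rfl⟩
        · exact hcon (eq_long_of_leChord_left hs.lt_right hU h1 h2
            (ih' _ (hs.long_mem_of_up hU) (h1.trans hs.lt_right) h2) hcd (hc _ hch.2.1) hne ▸
              hch.2.2)
        · exact hcon (eq_long_of_leChord_right hs.left_lt hU h1 h2
            (ih' _ (hs.long_mem_of_up hU) h1 (hs.left_lt.trans h2)) hcd (hc _ hch.1) hne ▸
              hch.2.2)
        · rcases eq_short_of_leChord hs.left_lt hs.lt_right h1 h2 hlt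
            (ih' _ (hs.left_mem_of_down hU)) (ih' _ (hs.right_mem_of_down hU)) hcd hne with h | h
          · exact hcon (h ▸ hch.1)
          · exact hcon (h ▸ hch.2.1)
    obtain ⟨d, hd, h1, h2⟩ := exists_step (toggled (fun i => up (inner i)) x n) hlt
    have := (key n le_rfl d hd h2 (h1.trans_lt hlt)).antisymm
      (leChord_of_steps_last hd h2 (h1.trans_lt hlt))
    exact hcon (this ▸ mem_chords_of hd)

end ChordsTriang

end CambrianPolygon

/-! ### Heights of chords -/

namespace CambrianPolygon

section Height

variable {n : ℕ} (Q : CambrianPolygon n)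

/-- The vertex lies strictly above the line through the first and the last vertex. -/
def IsUp (v : Fin (n + 2)) : Prop := 0 < Q.f v

/-- The slope of a chord. -/
noncomputable def slope (c : Fin (n + 2) × Fin (n + 2)) : ℝ :=
  (Q.f c.2 - Q.f c.1) / (Q.a c.2 - Q.a c.1)

/-- The height over `t` of the line through the end points of a chord. -/
noncomputable def ht (c : Fin (n + 2) × Fin (n + 2)) (t : ℝ) : ℝ :=
  Q.f c.1 + Q.slope c * (t - Q.a c.1)

variable {Q}

theorem ht_left (c : Fin (n + 2) × Fin (n + 2)) : Q.ht c (Q.a c.1) = Q.f c.1 := by simp [ht]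

theorem ht_right {c : Fin (n + 2) × Fin (n + 2)} (h : c.1 < c.2) :
    Q.ht c (Q.a c.2) = Q.f c.2 := by
  have := Q.a_strictMono h
  rw [ht, slope, div_mul_cancel₀ _ (by linarith)]
  ring

theorem ht_interpolate (c : Fin (n + 2) × Fin (n + 2)) (t L R : ℝ) :
    Q.ht c t * (R - L) = Q.ht c L * (R - t) + Q.ht c R * (t - L) := by
  simp only [ht]
  ring

theorem ht_convex_combination (c : Fin (n + 2) × Fin (n + 2)) {s r : ℝ} (h : s + r = 1)
    (t t' : ℝ) : Q.ht c (s * t + r * t') = s * Q.ht c t + r * Q.ht c t' := by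
  simp only [ht]
  linear_combination -(Q.f c.1 - Q.slope c * Q.a c.1) * h

theorem continuous_ht (c : Fin (n + 2) × Fin (n + 2)) : Continuous (Q.ht c) := by
  unfold ht
  fun_prop

/-- The weight of the second end point in the point of a chord over `t`. -/
noncomputable def wt (Q : CambrianPolygon n) (c : Fin (n + 2) × Fin (n + 2)) (t : ℝ) : ℝ :=
  (t - Q.a c.1) / (Q.a c.2 - Q.a c.1)

theorem wt_nonneg {c : Fin (n + 2) × Fin (n + 2)} (h : c.1 < c.2) {t : ℝ} (ht : Q.a c.1 ≤ t) :
    0 ≤ Q.wt c t :=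
  div_nonneg (by linarith) (by linarith [Q.a_strictMono h])

theorem wt_le_one {c : Fin (n + 2) × Fin (n + 2)} (h : c.1 < c.2) {t : ℝ} (ht : t ≤ Q.a c.2) :
    Q.wt c t ≤ 1 :=
  (div_le_one (by linarith [Q.a_strictMono h])).2 (by linarith)

theorem wt_combination_a {c : Fin (n + 2) × Fin (n + 2)} (h : c.1 < c.2) (t : ℝ) :
    (1 - Q.wt c t) * Q.a c.1 + Q.wt c t * Q.a c.2 = t := by
  have := Q.a_strictMono h
  have h1 : Q.wt c t * (Q.a c.2 - Q.a c.1) = t - Q.a c.1 := div_mul_cancel₀ _ (by linarith)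
  linarith

theorem wt_combination_f (c : Fin (n + 2) × Fin (n + 2)) (t : ℝ) :
    (1 - Q.wt c t) * Q.f c.1 + Q.wt c t * Q.f c.2 = Q.ht c t := by
  simp only [ht, slope, wt]
  ring

theorem mem_segment_v {c : Fin (n + 2) × Fin (n + 2)} (h : c.1 < c.2) {t : ℝ}
    (h1 : Q.a c.1 ≤ t) (h2 : t ≤ Q.a c.2) : (t, Q.ht c t) ∈ segment ℝ (Q.v c.1) (Q.v c.2) := by
  refine ⟨1 - Q.wt c t, Q.wt c t, by linarith [wt_le_one h h2], wt_nonneg h h1, by ring, ?_⟩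
  ext
  · simpa [v] using wt_combination_a h t
  · simpa [v] using wt_combination_f c t

theorem mem_openSegment_v {c : Fin (n + 2) × Fin (n + 2)} (h : c.1 < c.2) {q : ℝ × ℝ} :
    q ∈ openSegment ℝ (Q.v c.1) (Q.v c.2) ↔
      Q.a c.1 < q.1 ∧ q.1 < Q.a c.2 ∧ q.2 = Q.ht c q.1 := by
  have ha := Q.a_strictMono h
  constructor
  · rintro ⟨s, r, hs, hr, hsr, rfl⟩
    obtain rfl : s = 1 - r := by linarith
    simp only [v, Prod.smul_mk, smul_eq_mul, Prod.mk_add_mk]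
    refine ⟨by nlinarith, by nlinarith, ?_⟩
    rw [ht_convex_combination c (by ring), ht_left, ht_right h]
  · rintro ⟨h1, h2, h3⟩
    have h4 : 0 < Q.wt c q.1 := div_pos (by linarith) (by linarith)
    have h5 : Q.wt c q.1 < 1 := (div_lt_one (by linarith)).2 (by linarith)
    refine ⟨1 - Q.wt c q.1, Q.wt c q.1, by linarith, h4, by ring, ?_⟩
    ext
    · simpa [v] using wt_combination_a h q.1
    · rw [h3]
      simpa [v] using wt_combination_f c q.1

/-- A vertex strictly between the end points of a chord is not between the chord and the chord
from the first to the last vertex. -/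
theorem not_between {i j k : Fin (n + 2)} (hij : i < j) (hjk : j < k) (h0 : Q.ht (i, k) (Q.a j) ≠ 0)
    (h1 : 0 ≤ Q.f j / Q.ht (i, k) (Q.a j)) (h2 : Q.f j / Q.ht (i, k) (Q.a j) ≤ 1) : False := by
  have h0l : (0 : Fin (n + 2)) < Fin.last (n + 1) := Fin.last_pos
  have hj0 : Q.a 0 ≤ Q.a j := Q.a_strictMono.monotone (Fin.zero_le j)
  have hjl : Q.a j ≤ Q.a (Fin.last (n + 1)) := Q.a_strictMono.monotone (Fin.le_last j)
  have hp := mem_segment_v (Q := Q) (c := (0, Fin.last (n + 1))) h0l hj0 hjl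
  have hq := mem_segment_v (Q := Q) (c := (i, k)) (hij.trans hjk) (Q.a_strictMono hij).le
    (Q.a_strictMono hjk).le
  have hht : Q.ht (0, Fin.last (n + 1)) (Q.a j) = 0 := by simp [ht, slope, Q.f_zero, Q.f_last]
  rw [hht] at hp
  have hmem : Q.v j ∈ convexHull ℝ (Q.v '' {0, Fin.last (n + 1), i, k}) := by
    have hc := convex_convexHull ℝ (Q.v '' {0, Fin.last (n + 1), i, k})
    have hsub : ∀ m ∈ ({0, Fin.last (n + 1), i, k} : Set (Fin (n + 2))),
        Q.v m ∈ convexHull ℝ (Q.v '' {0, Fin.last (n + 1), i, k}) :=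
      fun m hm => subset_convexHull ℝ _ ⟨m, hm, rfl⟩
    have hp' := hc.segment_subset (hsub 0 (by simp)) (hsub _ (by simp)) hp
    have hq' := hc.segment_subset (hsub i (by simp)) (hsub k (by simp)) hq
    refine hc.segment_subset hp' hq' ⟨1 - Q.f j / Q.ht (i, k) (Q.a j),
      Q.f j / Q.ht (i, k) (Q.a j), by linarith, h1, by ring, ?_⟩
    ext
    · simp only [v, Prod.smul_mk, smul_eq_mul, Prod.mk_add_mk]
      ring
    · simp only [v, Prod.smul_mk, smul_eq_mul, Prod.mk_add_mk]
      rw [div_mul_cancel₀ _ h0]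
      ring
  have := Q.convexIndependent _ _ hmem
  simp only [Set.mem_insert_iff, Set.mem_singleton_iff] at this
  rcases this with rfl | rfl | rfl | rfl
  · exact absurd hij (not_lt.2 (Fin.zero_le i))
  · exact absurd hjk (not_lt.2 (Fin.le_last k))
  · exact lt_irrefl _ hij
  · exact lt_irrefl _ hjk

theorem ht_lt_of_isUp {i j k : Fin (n + 2)} (hij : i < j) (hjk : j < k) (hj : Q.IsUp j) :
    Q.ht (i, k) (Q.a j) < Q.f j := by
  by_contra! h
  have hj' : 0 < Q.f j := hj
  have h0 := hj'.trans_le h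
  exact not_between hij hjk h0.ne' (div_nonneg hj'.le h0.le) ((div_le_one h0).2 h)

theorem lt_ht_of_not_isUp {i j k : Fin (n + 2)} (hij : i < j) (hjk : j < k) (hj : ¬ Q.IsUp j) :
    Q.f j < Q.ht (i, k) (Q.a j) := by
  by_contra! h
  have hj' : Q.f j < 0 := by
    obtain ⟨b, rfl⟩ := exists_inner_of_lt hij hjk
    exact lt_of_le_of_ne (not_lt.1 hj) (Q.f_inner_ne_zero b)
  have h0 := h.trans_lt hj'
  exact not_between hij hjk h0.ne (div_nonneg_of_nonpos hj'.le h0.le)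
    ((div_le_one_of_neg h0).2 h)

theorem ht_le_left {c d : Fin (n + 2) × Fin (n + 2)} (h : LeChord Q.IsUp c d) (h1 : c.1 < d.2)
    (h2 : d.1 < c.2) : Q.ht c (Q.a (max c.1 d.1)) ≤ Q.ht d (Q.a (max c.1 d.1)) ∧
      (c.1 ≠ d.1 → Q.ht c (Q.a (max c.1 d.1)) < Q.ht d (Q.a (max c.1 d.1))) := by
  rcases lt_trichotomy c.1 d.1 with h3 | h3 | h3
  · rw [max_eq_right h3.le, ht_left d]
    have := ht_lt_of_isUp h3 h2 (h.1 h3)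
    exact ⟨this.le, fun _ => this⟩
  · rw [h3, max_self, ht_left d, ← h3, ht_left c, h3]
    exact ⟨le_rfl, fun h => absurd rfl h⟩
  · rw [max_eq_left h3.le, ht_left c]
    have := lt_ht_of_not_isUp h3 h1 (h.2.1 h3)
    exact ⟨this.le, fun _ => this⟩

theorem ht_le_right {c d : Fin (n + 2) × Fin (n + 2)} (hc : c.1 < c.2) (hd : d.1 < d.2)
    (h : LeChord Q.IsUp c d) (h1 : c.1 < d.2) (h2 : d.1 < c.2) :
    Q.ht c (Q.a (min c.2 d.2)) ≤ Q.ht d (Q.a (min c.2 d.2)) ∧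
      (c.2 ≠ d.2 → Q.ht c (Q.a (min c.2 d.2)) < Q.ht d (Q.a (min c.2 d.2))) := by
  rcases lt_trichotomy c.2 d.2 with h3 | h3 | h3
  · rw [min_eq_left h3.le, ht_right hc]
    have := lt_ht_of_not_isUp h2 h3 (h.2.2.2 h3)
    exact ⟨this.le, fun _ => this⟩
  · rw [h3, min_self, ht_right hd, ← h3, ht_right hc, h3]
    exact ⟨le_rfl, fun h => absurd rfl h⟩
  · rw [min_eq_right h3.le, ht_right hd]
    have := ht_lt_of_isUp h1 h3 (h.2.2.1 h3)
    exact ⟨this.le, fun _ => this⟩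

theorem ht_le_ht {c d : Fin (n + 2) × Fin (n + 2)} (hc : c.1 < c.2) (hd : d.1 < d.2)
    (h : LeChord Q.IsUp c d) (h1 : c.1 < d.2) (h2 : d.1 < c.2) {t : ℝ} (hct : Q.a c.1 ≤ t)
    (htc : t ≤ Q.a c.2) (hdt : Q.a d.1 ≤ t) (htd : t ≤ Q.a d.2) : Q.ht c t ≤ Q.ht d t := by
  have hlr : Q.a (max c.1 d.1) < Q.a (min c.2 d.2) :=
    Q.a_strictMono (max_lt (lt_min hc h1) (lt_min h2 hd))
  have hl : Q.a (max c.1 d.1) ≤ t := by rcases max_choice c.1 d.1 with h | h <;> rwa [h]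
  have hr : t ≤ Q.a (min c.2 d.2) := by rcases min_choice c.2 d.2 with h | h <;> rwa [h]
  have e1 := ht_interpolate (Q := Q) c t (Q.a (max c.1 d.1)) (Q.a (min c.2 d.2))
  have e2 := ht_interpolate (Q := Q) d t (Q.a (max c.1 d.1)) (Q.a (min c.2 d.2))
  refine le_of_mul_le_mul_right ?_ (sub_pos.2 hlr)
  rw [e1, e2]
  exact add_le_add (mul_le_mul_of_nonneg_right (ht_le_left h h1 h2).1 (by linarith))
    (mul_le_mul_of_nonneg_right (ht_le_right hc hd h h1 h2).1 (by linarith))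

theorem ht_lt_ht {c d : Fin (n + 2) × Fin (n + 2)} (hc : c.1 < c.2) (hd : d.1 < d.2)
    (h : LeChord Q.IsUp c d) (hne : c ≠ d) {t : ℝ} (hct : Q.a c.1 < t)
    (htc : t < Q.a c.2) (hdt : Q.a d.1 < t) (htd : t < Q.a d.2) : Q.ht c t < Q.ht d t := by
  have h1 : c.1 < d.2 := Q.a_strictMono.lt_iff_lt.1 (hct.trans htd)
  have h2 : d.1 < c.2 := Q.a_strictMono.lt_iff_lt.1 (hdt.trans htc)
  have hlr : Q.a (max c.1 d.1) < Q.a (min c.2 d.2) :=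
    Q.a_strictMono (max_lt (lt_min hc h1) (lt_min h2 hd))
  have hl : Q.a (max c.1 d.1) < t := by rcases max_choice c.1 d.1 with h | h <;> rwa [h]
  have hr : t < Q.a (min c.2 d.2) := by rcases min_choice c.2 d.2 with h | h <;> rwa [h]
  have e1 := ht_interpolate (Q := Q) c t (Q.a (max c.1 d.1)) (Q.a (min c.2 d.2))
  have e2 := ht_interpolate (Q := Q) d t (Q.a (max c.1 d.1)) (Q.a (min c.2 d.2))
  have hL := ht_le_left h h1 h2
  have hR := ht_le_right hc hd h h1 h2
  refine lt_of_mul_lt_mul_right ?_ (sub_pos.2 hlr).le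
  rw [e1, e2]
  by_cases h3 : c.1 = d.1
  · have h4 : c.2 ≠ d.2 := fun h4 => hne (Prod.ext h3 h4)
    exact add_lt_add_of_le_of_lt (mul_le_mul_of_nonneg_right hL.1 (by linarith))
      (mul_lt_mul_of_pos_right (hR.2 h4) (by linarith))
  · exact add_lt_add_of_lt_of_le (mul_lt_mul_of_pos_right (hL.2 h3) (by linarith))
      (mul_le_mul_of_nonneg_right hR.1 (by linarith))

/-- A chord that is not below another one is above it at one of the ends of the common strip. -/
theorem exists_ht_lt_of_not_leChord {c d : Fin (n + 2) × Fin (n + 2)} (hc : c.1 < c.2)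
    (hd : d.1 < d.2) (h1 : c.1 < d.2) (h2 : d.1 < c.2) (h : ¬ LeChord Q.IsUp c d) :
    Q.ht d (Q.a (max c.1 d.1)) < Q.ht c (Q.a (max c.1 d.1)) ∨
      Q.ht d (Q.a (min c.2 d.2)) < Q.ht c (Q.a (min c.2 d.2)) := by
  unfold LeChord at h
  simp only [not_and_or, Classical.not_imp, not_not] at h
  rcases h with ⟨h3, h4⟩ | ⟨h3, h4⟩ | ⟨h3, h4⟩ | ⟨h3, h4⟩
  · rw [max_eq_right h3.le, ht_left d]
    exact Or.inl (lt_ht_of_not_isUp h3 h2 h4)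
  · rw [max_eq_left h3.le, ht_left c]
    exact Or.inl (ht_lt_of_isUp h3 h1 h4)
  · rw [min_eq_right h3.le, ht_right hd]
    exact Or.inr (lt_ht_of_not_isUp h1 h3 h4)
  · rw [min_eq_left h3.le, ht_right hc]
    exact Or.inr (ht_lt_of_isUp h2 h3 h4)

theorem disjoint_iff_compat {c d : Fin (n + 2) × Fin (n + 2)} (hc : c.1 < c.2)
    (hd : d.1 < d.2) (hne : c ≠ d) :
    Disjoint (openSegment ℝ (Q.v c.1) (Q.v c.2)) (openSegment ℝ (Q.v d.1) (Q.v d.2)) ↔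
      Compat Q.IsUp c d := by
  constructor
  · intro hdis h1 h2
    by_contra hcon
    rw [not_or] at hcon
    have hlr : Q.a (max c.1 d.1) < Q.a (min c.2 d.2) :=
      Q.a_strictMono (max_lt (lt_min hc h1) (lt_min h2 hd))
    have hA := exists_ht_lt_of_not_leChord hc hd h1 h2 hcon.1
    have hB := exists_ht_lt_of_not_leChord hd hc h2 h1 hcon.2
    rw [max_comm, min_comm] at hB
    have hcont : ContinuousOn (fun t => Q.ht d t - Q.ht c t)
        (Set.Icc (Q.a (max c.1 d.1)) (Q.a (min c.2 d.2))) :=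
      ((continuous_ht d).sub (continuous_ht c)).continuousOn
    -- the difference of the heights has opposite signs at the ends of the common strip
    have : ∃ t ∈ Set.Ioo (Q.a (max c.1 d.1)) (Q.a (min c.2 d.2)), Q.ht d t - Q.ht c t = 0 := by
      rcases hA with hA | hA <;> rcases hB with hB | hB
      · exact absurd hA hB.not_gt
      · exact intermediate_value_Ioo hlr.le hcont ⟨by linarith, by linarith⟩
      · exact intermediate_value_Ioo' hlr.le hcont ⟨by linarith, by linarith⟩
      · exact absurd hA hB.not_gt
    obtain ⟨t, ⟨ht1, ht2⟩, ht3⟩ := this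
    have hm := Q.a_strictMono.monotone
    have hmc : (t, Q.ht c t) ∈ openSegment ℝ (Q.v c.1) (Q.v c.2) :=
      (mem_openSegment_v hc).2 ⟨(hm (le_max_left _ _)).trans_lt ht1,
        ht2.trans_le (hm (min_le_left _ _)), rfl⟩
    have hmd : (t, Q.ht c t) ∈ openSegment ℝ (Q.v d.1) (Q.v d.2) :=
      (mem_openSegment_v hd).2 ⟨(hm (le_max_right _ _)).trans_lt ht1,
        ht2.trans_le (hm (min_le_right _ _)), by simp only; linarith⟩
    exact Set.disjoint_left.1 hdis hmc hmd
  · intro h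
    rw [Set.disjoint_left]
    intro q hqc hqd
    obtain ⟨c1, c2, c3⟩ := (mem_openSegment_v hc).1 hqc
    obtain ⟨d1, d2, d3⟩ := (mem_openSegment_v hd).1 hqd
    rcases h (Q.a_strictMono.lt_iff_lt.1 (c1.trans d2)) (Q.a_strictMono.lt_iff_lt.1 (d1.trans c2))
      with h | h
    · exact absurd (c3.symm.trans d3) (ht_lt_ht hc hd h hne c1 c2 d1 d2).ne
    · exact absurd (c3.symm.trans d3) (ht_lt_ht hd hc h hne.symm d1 d2 c1 c2).ne'

theorem Compat.refl {up : Fin n → Prop} (c : Fin n × Fin n) : Compat up c c :=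
  fun _ _ => Or.inl (LeChord.refl c)

theorem nonCrossing_iff {S : Set (Fin (n + 2) × Fin (n + 2))} : Q.NonCrossing S ↔
    (∀ c ∈ S, c.1 < c.2) ∧ ∀ c ∈ S, ∀ d ∈ S, Compat Q.IsUp c d := by
  refine and_congr_right fun hlt => ⟨fun h c hc d hd => ?_, fun h c hc d hd hne => ?_⟩
  · rcases eq_or_ne c d with rfl | hne
    · exact Compat.refl c
    · exact (disjoint_iff_compat (hlt c hc) (hlt d hd) hne).1 (h c hc d hd hne)
  · exact (disjoint_iff_compat (hlt c hc) (hlt d hd) hne).2 (h c hc d hd)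

theorem maximal_nonCrossing_iff {T : Set (Fin (n + 2) × Fin (n + 2))} :
    Maximal Q.NonCrossing T ↔ IsTriang Q.IsUp T := by
  constructor
  · rintro ⟨hT, hmax⟩
    rw [nonCrossing_iff] at hT
    refine ⟨hT.1, hT.2, fun c hlt hc => ?_⟩
    refine hmax (nonCrossing_iff.2 ⟨?_, ?_⟩) (Set.subset_insert c T) (Set.mem_insert c T)
    · rintro d (rfl | hd)
      exacts [hlt, hT.1 d hd]
    · rintro d (rfl | hd) e (rfl | he)
      exacts [Compat.refl _, hc e he, (hc d hd).symm, hT.2 d hd e he]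
  · intro hT
    refine ⟨nonCrossing_iff.2 ⟨hT.lt, hT.compat⟩, fun S hS hTS c hc => ?_⟩
    rw [nonCrossing_iff] at hS
    exact hT.mem c (hS.1 c hc) fun d hd => hS.2 c hc d (hTS hd)

theorem Triangulation.isTriang (T : Q.Triangulation) : IsTriang Q.IsUp T.1 :=
  maximal_nonCrossing_iff.1 T.2

variable (Q) in
/-- The triangulation of a permutation: the chords on all the paths of the permutation. -/
def permTriangulation (x : Equiv.Perm (Fin n)) : Q.Triangulation :=
  ⟨chords Q.Up x, maximal_nonCrossing_iff.2 (isTriang_chords Q.IsUp x)⟩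

end Height

end CambrianPolygon

/-! ### The triangles of a triangulation cover the polygon -/

namespace CambrianPolygon

section Cover

variable {n : ℕ} {Q : CambrianPolygon n}

theorem φ_fst (p : Fin (n + 2) → ℝ) : (Q.φ p).1 = ∑ m, p m * Q.a m := by
  simp [φ, Fintype.linearCombination_apply, v, Prod.fst_sum]

theorem φ_snd (p : Fin (n + 2) → ℝ) : (Q.φ p).2 = ∑ m, p m * Q.f m := by
  simp [φ, Fintype.linearCombination_apply, v, Prod.snd_sum]

theorem φ_e (i : Fin (n + 2)) : Q.φ (e i) = Q.v i := by
  simp [φ, e, Fintype.linearCombination_apply_single]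

theorem e_mem_simplex (i : Fin (n + 2)) : e i ∈ simplex n := single_mem_stdSimplex ℝ i

theorem convex_simplex : Convex ℝ (simplex n) := convex_stdSimplex ℝ _

theorem a_zero_le_φ_fst {p : Fin (n + 2) → ℝ} (hp : p ∈ simplex n) : Q.a 0 ≤ (Q.φ p).1 := by
  rw [φ_fst, ← one_mul (Q.a 0), ← hp.2, Finset.sum_mul]
  exact Finset.sum_le_sum fun m _ =>
    mul_le_mul_of_nonneg_left (Q.a_strictMono.monotone (Fin.zero_le m)) (hp.1 m)

theorem φ_fst_le_a_last {p : Fin (n + 2) → ℝ} (hp : p ∈ simplex n) :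
    (Q.φ p).1 ≤ Q.a (Fin.last (n + 1)) := by
  rw [φ_fst, ← one_mul (Q.a (Fin.last (n + 1))), ← hp.2, Finset.sum_mul]
  exact Finset.sum_le_sum fun m _ =>
    mul_le_mul_of_nonneg_left (Q.a_strictMono.monotone (Fin.le_last m)) (hp.1 m)

theorem φ_snd_sub_ht {p : Fin (n + 2) → ℝ} (hp : ∑ m, p m = 1) (c : Fin (n + 2) × Fin (n + 2)) :
    (Q.φ p).2 - Q.ht c (Q.φ p).1 = ∑ m, p m * (Q.f m - Q.ht c (Q.a m)) := by
  have h : ∀ m, p m * (Q.f m - Q.ht c (Q.a m)) =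
      p m * Q.f m - (Q.f c.1 - Q.slope c * Q.a c.1) * p m - Q.slope c * (p m * Q.a m) := by
    intro m
    simp only [ht]
    ring
  simp_rw [h, Finset.sum_sub_distrib, ← Finset.mul_sum, hp, ← φ_fst, ← φ_snd, ht]
  ring

/-- The point over `t` of an edge of the simplex. -/
noncomputable def edgePt (Q : CambrianPolygon n) (c : Fin (n + 2) × Fin (n + 2)) (t : ℝ) :
    Fin (n + 2) → ℝ :=
  (1 - Q.wt c t) • e c.1 + Q.wt c t • e c.2

theorem φ_edgePt {c : Fin (n + 2) × Fin (n + 2)} (h : c.1 < c.2) (t : ℝ) :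
    Q.φ (Q.edgePt c t) = (t, Q.ht c t) := by
  rw [edgePt, map_add, map_smul, map_smul, φ_e, φ_e]
  ext
  · simpa [v] using wt_combination_a h t
  · simpa [v] using wt_combination_f c t

theorem edgePt_mem_segment {c : Fin (n + 2) × Fin (n + 2)} (h : c.1 < c.2) {t : ℝ}
    (h1 : Q.a c.1 ≤ t) (h2 : t ≤ Q.a c.2) : Q.edgePt c t ∈ segment ℝ (e c.1) (e c.2) :=
  ⟨1 - Q.wt c t, Q.wt c t, by linarith [wt_le_one h h2], wt_nonneg h h1, by ring, rfl⟩

/-- The lower side over the strip to the right of `m` of the triangle `i < j < k`. -/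
noncomputable def lowSide (Q : CambrianPolygon n) (i j k m : Fin (n + 2)) :
    Fin (n + 2) × Fin (n + 2) :=
  open Classical in if Q.IsUp j then (i, k) else shortSide i j k m

/-- The upper side over the strip to the right of `m` of the triangle `i < j < k`. -/
noncomputable def highSide (Q : CambrianPolygon n) (i j k m : Fin (n + 2)) :
    Fin (n + 2) × Fin (n + 2) :=
  open Classical in if Q.IsUp j then shortSide i j k m else (i, k)

theorem support_of_mem_convexHull {i j k : Fin (n + 2)} {p : Fin (n + 2) → ℝ}
    (hp : p ∈ convexHull ℝ {e i, e j, e k}) :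
    p ∈ simplex n ∧ ∀ m, m ≠ i → m ≠ j → m ≠ k → p m = 0 := by
  have hsub : convexHull ℝ {e i, e j, e k} ⊆
      simplex n ∩ ⋂ m ∈ {m | m ≠ i ∧ m ≠ j ∧ m ≠ k}, {p : Fin (n + 2) → ℝ | p m = 0} := by
    refine convexHull_min ?_ (convex_simplex.inter (convex_iInter₂ fun m _ => ?_))
    · rintro q (rfl | rfl | rfl) <;>
        refine ⟨e_mem_simplex _, Set.mem_iInter₂.2 fun m hm => Pi.single_eq_of_ne ?_ _⟩
      exacts [hm.1, hm.2.1, hm.2.2]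
    · exact convex_hyperplane (f := fun p : Fin (n + 2) → ℝ => p m)
        ⟨fun _ _ => rfl, fun _ _ => rfl⟩ 0
  have h := hsub hp
  refine ⟨h.1, fun m h1 h2 h3 => ?_⟩
  exact Set.mem_iInter₂.1 h.2 m ⟨h1, h2, h3⟩

theorem f_sub_ht_middle {i j k : Fin (n + 2)} (hij : i < j) (hjk : j < k) :
    (Q.f j - Q.ht (i, k) (Q.a j)) * (Q.a k - Q.a i) =
      (Q.f j - Q.f i) * (Q.a k - Q.a i) - (Q.f k - Q.f i) * (Q.a j - Q.a i) := by
  have h1 := Q.a_strictMono hij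
  have h2 := Q.a_strictMono hjk
  have h3 : Q.a k - Q.a i ≠ 0 := by linarith
  simp only [ht, slope]
  field_simp
  ring

theorem f_sub_ht_right {i j k : Fin (n + 2)} (hij : i < j) :
    (Q.ht (i, j) (Q.a k) - Q.f k) * (Q.a j - Q.a i) =
      (Q.f j - Q.f i) * (Q.a k - Q.a i) - (Q.f k - Q.f i) * (Q.a j - Q.a i) := by
  have h1 := Q.a_strictMono hij
  have h3 : Q.a j - Q.a i ≠ 0 := by linarith
  simp only [ht, slope]
  field_simp
  ring

theorem f_sub_ht_left {i j k : Fin (n + 2)} (hjk : j < k) :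
    (Q.ht (j, k) (Q.a i) - Q.f i) * (Q.a k - Q.a j) =
      (Q.f j - Q.f i) * (Q.a k - Q.a i) - (Q.f k - Q.f i) * (Q.a j - Q.a i) := by
  have h2 := Q.a_strictMono hjk
  have h3 : Q.a k - Q.a j ≠ 0 := by linarith
  simp only [ht, slope]
  field_simp
  ring

/-- A vertex `k` to the right of a chord `(i, j)` lies below the line of the chord if `j` is an
upper vertex, and above the line otherwise. -/
theorem f_lt_ht_right {i j k : Fin (n + 2)} (hij : i < j) (hjk : j < k) :
    (Q.IsUp j → Q.f k < Q.ht (i, j) (Q.a k)) ∧ (¬ Q.IsUp j → Q.ht (i, j) (Q.a k) < Q.f k) := by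
  have h1 := sub_pos.2 (Q.a_strictMono hij)
  have h2 := sub_pos.2 (Q.a_strictMono (hij.trans hjk))
  have e1 := f_sub_ht_middle (Q := Q) hij hjk
  have e2 := f_sub_ht_right (Q := Q) (k := k) hij
  rw [← e1] at e2
  constructor
  · intro h
    have h3 := mul_pos (sub_pos.2 (ht_lt_of_isUp hij hjk h)) h2
    rw [← e2] at h3
    exact sub_pos.1 (pos_of_mul_pos_left h3 h1.le)
  · intro h
    have h3 := mul_neg_of_neg_of_pos (sub_neg.2 (lt_ht_of_not_isUp hij hjk h)) h2
    rw [← e2] at h3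
    exact sub_neg.1 (neg_of_mul_neg_left h3 h1.le)

theorem f_lt_ht_left {i j k : Fin (n + 2)} (hij : i < j) (hjk : j < k) :
    (Q.IsUp j → Q.f i < Q.ht (j, k) (Q.a i)) ∧ (¬ Q.IsUp j → Q.ht (j, k) (Q.a i) < Q.f i) := by
  have h1 := sub_pos.2 (Q.a_strictMono hjk)
  have h2 := sub_pos.2 (Q.a_strictMono (hij.trans hjk))
  have e1 := f_sub_ht_middle (Q := Q) hij hjk
  have e2 := f_sub_ht_left (Q := Q) (i := i) hjk
  rw [← e1] at e2
  constructor
  · intro h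
    have h3 := mul_pos (sub_pos.2 (ht_lt_of_isUp hij hjk h)) h2
    rw [← e2] at h3
    exact sub_pos.1 (pos_of_mul_pos_left h3 h1.le)
  · intro h
    have h3 := mul_neg_of_neg_of_pos (sub_neg.2 (lt_ht_of_not_isUp hij hjk h)) h2
    rw [← e2] at h3
    exact sub_neg.1 (neg_of_mul_neg_left h3 h1.le)

/-- A point of the plane that lies on no line through two vertices. -/
structure Generic (Q : CambrianPolygon n) (q : ℝ × ℝ) : Prop where
  fst_ne : ∀ m, q.1 ≠ Q.a m
  snd_ne : ∀ c : Fin (n + 2) × Fin (n + 2), c.1 < c.2 → q.2 ≠ Q.ht c q.1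

/-- The points of a face `i < j < k` of the simplex lie between the two sides of the triangle. -/
theorem between_sides {i j k m : Fin (n + 2)} (hij : i < j) (hjk : j < k)
    {p : Fin (n + 2) → ℝ} (hp : p ∈ convexHull ℝ {e i, e j, e k}) (hg : Q.Generic (Q.φ p)) :
    Q.ht (Q.lowSide i j k m) (Q.φ p).1 < (Q.φ p).2 ∧
      (Q.φ p).2 < Q.ht (Q.highSide i j k m) (Q.φ p).1 := by
  obtain ⟨hp, hs⟩ := support_of_mem_convexHull hp
  have hik := hij.trans hjk
  -- comparison with the line of a chord reduces to the three vertices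
  have lower : ∀ c : Fin (n + 2) × Fin (n + 2), c.1 < c.2 → Q.ht c (Q.a i) ≤ Q.f i →
      Q.ht c (Q.a j) ≤ Q.f j → Q.ht c (Q.a k) ≤ Q.f k → Q.ht c (Q.φ p).1 < (Q.φ p).2 := by
    intro c hc h1 h2 h3
    refine lt_of_le_of_ne (sub_nonneg.1 ?_) (hg.snd_ne c hc).symm
    rw [φ_snd_sub_ht hp.2]
    refine Finset.sum_nonneg fun m _ => ?_
    by_cases h : m = i ∨ m = j ∨ m = k
    · exact mul_nonneg (hp.1 m) (by rcases h with rfl | rfl | rfl <;> linarith)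
    · push Not at h
      rw [hs m h.1 h.2.1 h.2.2, zero_mul]
  have upper : ∀ c : Fin (n + 2) × Fin (n + 2), c.1 < c.2 → Q.f i ≤ Q.ht c (Q.a i) →
      Q.f j ≤ Q.ht c (Q.a j) → Q.f k ≤ Q.ht c (Q.a k) → (Q.φ p).2 < Q.ht c (Q.φ p).1 := by
    intro c hc h1 h2 h3
    refine lt_of_le_of_ne (sub_nonpos.1 ?_) (hg.snd_ne c hc)
    rw [φ_snd_sub_ht hp.2]
    refine Finset.sum_nonpos fun m _ => ?_
    by_cases h : m = i ∨ m = j ∨ m = k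
    · exact mul_nonpos_of_nonneg_of_nonpos (hp.1 m) (by rcases h with rfl | rfl | rfl <;> linarith)
    · push Not at h
      rw [hs m h.1 h.2.1 h.2.2, zero_mul]
  have l1 : ∀ c : Fin (n + 2) × Fin (n + 2), Q.ht (c.1, c.2) (Q.a c.1) = Q.f c.1 := ht_left
  have l2 : ∀ c : Fin (n + 2) × Fin (n + 2), c.1 < c.2 → Q.ht (c.1, c.2) (Q.a c.2) = Q.f c.2 :=
    fun c hc => ht_right hc
  have ik1 := (l1 (i, k)).le
  have ik1' := (l1 (i, k)).ge
  have ik2 := (l2 (i, k) hik).le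
  have ik2' := (l2 (i, k) hik).ge
  have ij1 := (l1 (i, j))
  have ij2 := (l2 (i, j) hij)
  have jk1 := (l1 (j, k))
  have jk2 := (l2 (j, k) hjk)
  unfold lowSide highSide shortSide
  by_cases hj : Q.IsUp j
  · rw [if_pos hj, if_pos hj]
    refine ⟨lower _ hik ik1 (ht_lt_of_isUp hij hjk hj).le ik2, ?_⟩
    split_ifs
    · exact upper _ hij ij1.ge ij2.ge ((f_lt_ht_right hij hjk).1 hj).le
    · exact upper _ hjk ((f_lt_ht_left hij hjk).1 hj).le jk1.ge jk2.ge
  · rw [if_neg hj, if_neg hj]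
    refine ⟨?_, upper _ hik ik1' (lt_ht_of_not_isUp hij hjk hj).le ik2'⟩
    split_ifs
    · exact lower _ hij ij1.le ij2.le ((f_lt_ht_right hij hjk).2 hj).le
    · exact lower _ hjk ((f_lt_ht_left hij hjk).2 hj).le jk1.le jk2.le

theorem exists_strip {t : ℝ} (h0 : Q.a 0 ≤ t) (h1 : t ≤ Q.a (Fin.last (n + 1))) :
    ∃ m : Fin (n + 1), Q.a m.castSucc ≤ t ∧ t ≤ Q.a m.succ := by
  by_contra! h
  have key : ∀ m : Fin (n + 2), Q.a m ≤ t := by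
    intro m
    induction m using Fin.induction with
    | zero => exact h0
    | succ m ih => exact (h m ih).le
  have := h (Fin.last n) (key _)
  rw [Fin.succ_last] at this
  linarith

/-- The sides of the triangles over a point: they are chords of the triangulation over its strip,
and no chord of the triangulation is between them. -/
theorem sides_spec {T : Set (Fin (n + 2) × Fin (n + 2))} (hT : IsTriang Q.IsUp T)
    {i j k m : Fin (n + 2)} (h1 : (i, j) ∈ T) (h2 : (j, k) ∈ T) (h3 : (i, k) ∈ T) (him : i ≤ m)
    (hmk : m < k) :
    (Q.lowSide i j k m ∈ T ∧ (Q.lowSide i j k m).1 ≤ m ∧ m < (Q.lowSide i j k m).2) ∧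
    (Q.highSide i j k m ∈ T ∧ (Q.highSide i j k m).1 ≤ m ∧ m < (Q.highSide i j k m).2) ∧
    (∀ g ∈ T, g.1 ≤ m → m < g.2 →
      LeChord Q.IsUp g (Q.lowSide i j k m) ∨ LeChord Q.IsUp (Q.highSide i j k m) g) ∧
    ∀ l, (l = i ∨ l = j ∨ l = k) ↔ (l = (Q.lowSide i j k m).1 ∨ l = (Q.lowSide i j k m).2 ∨
      l = (Q.highSide i j k m).1 ∨ l = (Q.highSide i j k m).2) := by
  have hij := hT.lt _ h1
  have hjk := hT.lt _ h2
  have hshort : shortSide i j k m ∈ T ∧ (shortSide i j k m).1 ≤ m ∧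
      m < (shortSide i j k m).2 := by
    unfold shortSide
    split_ifs with h
    · exact ⟨h1, him, h⟩
    · exact ⟨h2, not_lt.1 h, hmk⟩
  have hsup : ∀ l, (l = i ∨ l = j ∨ l = k) ↔ (l = i ∨ l = k ∨ l = (shortSide i j k m).1 ∨
      l = (shortSide i j k m).2) := by
    intro l
    unfold shortSide
    split_ifs <;> simp only <;> tauto
  unfold lowSide highSide
  by_cases hj : Q.IsUp j
  · simp only [if_pos hj]
    exact ⟨⟨h3, him, hmk⟩, hshort, fun g hg hgm hmg => leChord_triangle_of_up hij hjk him hmk hgm hmg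
      hj (hT.compat g hg _ h1) (hT.compat g hg _ h2) (hT.compat g hg _ h3), hsup⟩
  · simp only [if_neg hj]
    refine ⟨hshort, ⟨h3, him, hmk⟩, fun g hg hgm hmg => leChord_triangle_of_down hij hjk him hmk hgm
      hmg hj (hT.compat g hg _ h1) (hT.compat g hg _ h2) (hT.compat g hg _ h3), fun l => ?_⟩
    rw [hsup l]
    tauto

theorem ht_le_of_strip {c d : Fin (n + 2) × Fin (n + 2)} (hcd : LeChord Q.IsUp c d)
    {m : Fin (n + 1)} {t : ℝ} (h1 : Q.a m.castSucc ≤ t) (h2 : t ≤ Q.a m.succ)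
    (hc : c.1 ≤ m.castSucc) (hc' : m.castSucc < c.2) (hd : d.1 ≤ m.castSucc)
    (hd' : m.castSucc < d.2) : Q.ht c t ≤ Q.ht d t := by
  have hm := Q.a_strictMono.monotone
  exact ht_le_ht (hc.trans_lt hc') (hd.trans_lt hd') hcd (hc.trans_lt hd') (hd.trans_lt hc')
    ((hm hc).trans h1) (h2.trans (hm (Fin.castSucc_lt_iff_succ_le.1 hc')))
    ((hm hd).trans h1) (h2.trans (hm (Fin.castSucc_lt_iff_succ_le.1 hd')))

theorem eq_of_support {i j k : Fin (n + 2)} (hij : i < j) (hjk : j < k)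
    {p p' : Fin (n + 2) → ℝ} (hp : p ∈ simplex n) (hp' : p' ∈ simplex n)
    (hs : ∀ m, ¬ (m = i ∨ m = j ∨ m = k) → p m = 0)
    (hs' : ∀ m, ¬ (m = i ∨ m = j ∨ m = k) → p' m = 0) (h : Q.φ p = Q.φ p') : p = p' := by
  have hz : ∀ m, ¬ (m = i ∨ m = j ∨ m = k) → p m - p' m = 0 := fun m hm => by
    rw [hs m hm, hs' m hm, sub_zero]
  have hne : Q.f j - Q.ht (i, k) (Q.a j) ≠ 0 := by
    by_cases hj : Q.IsUp j
    · exact (sub_pos.2 (ht_lt_of_isUp hij hjk hj)).ne'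
    · exact (sub_neg.2 (lt_ht_of_not_isUp hij hjk hj)).ne
  have h1 : ∑ m, (p m - p' m) * (Q.f m - Q.ht (i, k) (Q.a m)) = 0 := by
    simp_rw [sub_mul, Finset.sum_sub_distrib]
    rw [← φ_snd_sub_ht hp.2 (i, k), ← φ_snd_sub_ht hp'.2 (i, k), h, sub_self]
  have h2 : ∑ m, (p m - p' m) * (Q.a m - Q.a i) = 0 := by
    simp_rw [sub_mul, mul_sub, Finset.sum_sub_distrib, ← Finset.sum_mul]
    rw [← φ_fst, ← φ_fst, h, hp.2, hp'.2, sub_self]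
  have h3 : ∑ m, (p m - p' m) = 0 := by
    rw [Finset.sum_sub_distrib, hp.2, hp'.2, sub_self]
  have ej : p j - p' j = 0 := by
    rw [Finset.sum_eq_single j] at h1
    · exact (mul_eq_zero.1 h1).resolve_right hne
    · intro m _ hm
      by_cases hmi : m = i
      · rw [hmi, show Q.ht (i, k) (Q.a i) = Q.f i from ht_left (i, k), sub_self, mul_zero]
      by_cases hmk : m = k
      · rw [hmk, show Q.ht (i, k) (Q.a k) = Q.f k from ht_right (c := (i, k)) (hij.trans hjk),
          sub_self, mul_zero]
      rw [hz m (by tauto), zero_mul]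
    · simp
  have ek : p k - p' k = 0 := by
    rw [Finset.sum_eq_single k] at h2
    · exact (mul_eq_zero.1 h2).resolve_right (sub_pos.2 (Q.a_strictMono (hij.trans hjk))).ne'
    · intro m _ hm
      by_cases hmi : m = i
      · rw [hmi, sub_self, mul_zero]
      by_cases hmj : m = j
      · rw [hmj, ej, zero_mul]
      rw [hz m (by tauto), zero_mul]
    · simp
  have ei : p i - p' i = 0 := by
    rw [Finset.sum_eq_single i] at h3
    · exact h3
    · intro m _ hm
      by_cases hmk : m = k
      · rw [hmk, ek]
      by_cases hmj : m = j
      · rw [hmj, ej]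
      exact hz m (by tauto)
    · simp
  funext m
  refine sub_eq_zero.1 ?_
  by_cases hm : m = i ∨ m = j ∨ m = k
  · rcases hm with rfl | rfl | rfl <;> assumption
  · exact hz m hm

/-- Over a generic point there is at most one point of the lifted triangulation. -/
theorem lift_unique {T : Q.Triangulation} {p p' : Fin (n + 2) → ℝ} (hp : p ∈ T.lift)
    (hp' : p' ∈ T.lift) (h : Q.φ p = Q.φ p') (hg : Q.Generic (Q.φ p)) : p = p' := by
  have hT := T.isTriang
  simp only [Triangulation.lift, Set.mem_iUnion] at hp hp'
  obtain ⟨i, j, k, ⟨h1, h2, h3⟩, hp⟩ := hp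
  obtain ⟨i', j', k', ⟨h1', h2', h3'⟩, hp'⟩ := hp'
  obtain ⟨ps, psupp⟩ := support_of_mem_convexHull hp
  obtain ⟨ps', psupp'⟩ := support_of_mem_convexHull hp'
  obtain ⟨m, hm1, hm2⟩ := exists_strip (a_zero_le_φ_fst (Q := Q) ps) (φ_fst_le_a_last ps)
  have hm1 := lt_of_le_of_ne hm1 (hg.fst_ne _).symm
  have hm2 := lt_of_le_of_ne hm2 (hg.fst_ne _)
  -- both triangles lie over the strip
  have strip : ∀ {i j k : Fin (n + 2)} {p : Fin (n + 2) → ℝ}, i < j → j < k → p ∈ simplex n →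
      (∀ m, m ≠ i → m ≠ j → m ≠ k → p m = 0) → Q.a m.castSucc < (Q.φ p).1 →
      (Q.φ p).1 < Q.a m.succ → i ≤ m.castSucc ∧ m.castSucc < k := by
    intro i j k p hij hjk hp hs hl hr
    constructor
    · by_contra! hcon
      rw [Fin.castSucc_lt_iff_succ_le] at hcon
      refine hr.not_ge ?_
      rw [φ_fst, ← one_mul (Q.a m.succ), ← hp.2, Finset.sum_mul]
      refine Finset.sum_le_sum fun l _ => ?_
      by_cases h : l = i ∨ l = j ∨ l = k
      · refine mul_le_mul_of_nonneg_left (Q.a_strictMono.monotone ?_) (hp.1 l)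
        rcases h with rfl | rfl | rfl
        exacts [hcon, hcon.trans hij.le, hcon.trans (hij.trans hjk).le]
      · push Not at h
        rw [hs l h.1 h.2.1 h.2.2, zero_mul, zero_mul]
    · by_contra! hcon
      refine hl.not_ge ?_
      rw [φ_fst, ← one_mul (Q.a m.castSucc), ← hp.2, Finset.sum_mul]
      refine Finset.sum_le_sum fun l _ => ?_
      by_cases h : l = i ∨ l = j ∨ l = k
      · refine mul_le_mul_of_nonneg_left (Q.a_strictMono.monotone ?_) (hp.1 l)
        rcases h with rfl | rfl | rfl
        exacts [(hij.trans hjk).le.trans hcon, hjk.le.trans hcon, hcon]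
      · push Not at h
        rw [hs l h.1 h.2.1 h.2.2, zero_mul, zero_mul]
  obtain ⟨s1, s2⟩ := strip (hT.lt _ h1) (hT.lt _ h2) ps psupp hm1 hm2
  obtain ⟨s1', s2'⟩ := strip (hT.lt _ h1') (hT.lt _ h2') ps' psupp' (h ▸ hm1) (h ▸ hm2)
  obtain ⟨⟨l1, l2, l3⟩, ⟨u1, u2, u3⟩, hno, hsides⟩ := sides_spec hT h1 h2 h3 s1 s2
  obtain ⟨⟨l1', l2', l3'⟩, ⟨u1', u2', u3'⟩, hno', hsides'⟩ := sides_spec hT h1' h2' h3' s1' s2'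
  obtain ⟨b1, b2⟩ := between_sides (m := m.castSucc) (hT.lt _ h1) (hT.lt _ h2) hp hg
  obtain ⟨b1', b2'⟩ := between_sides (m := m.castSucc) (hT.lt _ h1') (hT.lt _ h2') hp' (h ▸ hg)
  rw [← h] at b1' b2'
  have hlow : Q.lowSide i j k m.castSucc = Q.lowSide i' j' k' m.castSucc := by
    refine LeChord.antisymm (up := Q.IsUp) ?_ ?_
    · refine (hno' _ l1 l2 l3).resolve_right fun hc => ?_
      have := ht_le_of_strip hc hm1.le hm2.le u2' u3' l2 l3
      linarith
    · refine (hno _ l1' l2' l3').resolve_right fun hc => ?_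
      have := ht_le_of_strip hc hm1.le hm2.le u2 u3 l2' l3'
      linarith
  have hhigh : Q.highSide i j k m.castSucc = Q.highSide i' j' k' m.castSucc := by
    refine LeChord.antisymm (up := Q.IsUp) ?_ ?_
    · refine (hno _ u1' u2' u3').resolve_left fun hc => ?_
      have := ht_le_of_strip hc hm1.le hm2.le u2' u3' l2 l3
      linarith
    · refine (hno' _ u1 u2 u3).resolve_left fun hc => ?_
      have := ht_le_of_strip hc hm1.le hm2.le u2 u3 l2' l3'
      linarith
  refine eq_of_support (hT.lt _ h1) (hT.lt _ h2) ps ps' (fun m hm => ?_) (fun m hm => ?_) h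
  · push Not at hm
    exact psupp m hm.1 hm.2.1 hm.2.2
  · rw [hsides, hlow, hhigh, ← hsides'] at hm
    push Not at hm
    exact psupp' m hm.1 hm.2.1 hm.2.2

/-- The lowest path bounds the polygon from below. -/
theorem ht_le_of_steps_zero {x : Equiv.Perm (Fin n)} {d : Fin (n + 2) × Fin (n + 2)}
    (hd : d ∈ steps (toggled Q.Up x 0)) {p : Fin (n + 2) → ℝ} (hp : p ∈ simplex n) :
    Q.ht d (Q.φ p).1 ≤ (Q.φ p).2 := by
  obtain ⟨d1, d2, d3, d4⟩ := mem_steps.1 hd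
  rw [← sub_nonneg, φ_snd_sub_ht hp.2]
  refine Finset.sum_nonneg fun m _ => mul_nonneg (hp.1 m) (sub_nonneg.2 ?_)
  rcases lt_trichotomy m d.1 with h | h | h
  · exact ((f_lt_ht_left (j := d.1) (k := d.2) h d3).2
      ((mem_verts_toggled_zero (up := Q.IsUp) h d3).1 d1)).le
  · rw [h, ht_left]
  · rcases lt_trichotomy m d.2 with h' | h' | h'
    · refine (ht_lt_of_isUp h h' ?_).le
      by_contra hcon
      exact d4 _ ((mem_verts_toggled_zero (up := Q.IsUp) h h').2 hcon) ⟨h, h'⟩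
    · rw [h', ht_right d3]
    · exact ((f_lt_ht_right (i := d.1) (j := d.2) d3 h').2
        ((mem_verts_toggled_zero (up := Q.IsUp) d3 h').1 d2)).le

/-- The highest path bounds the polygon from above. -/
theorem le_ht_of_steps_last {x : Equiv.Perm (Fin n)} {d : Fin (n + 2) × Fin (n + 2)}
    (hd : d ∈ steps (toggled Q.Up x n)) {p : Fin (n + 2) → ℝ} (hp : p ∈ simplex n) :
    (Q.φ p).2 ≤ Q.ht d (Q.φ p).1 := by
  obtain ⟨d1, d2, d3, d4⟩ := mem_steps.1 hd
  rw [← sub_nonpos, φ_snd_sub_ht hp.2]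
  refine Finset.sum_nonpos fun m _ => mul_nonpos_of_nonneg_of_nonpos (hp.1 m) (sub_nonpos.2 ?_)
  rcases lt_trichotomy m d.1 with h | h | h
  · exact ((f_lt_ht_left (j := d.1) (k := d.2) h d3).1
      ((mem_verts_toggled_last (up := Q.IsUp) h d3).1 d1)).le
  · rw [h, ht_left]
  · rcases lt_trichotomy m d.2 with h' | h' | h'
    · refine (lt_ht_of_not_isUp h h' fun hcon => ?_).le
      exact d4 _ ((mem_verts_toggled_last (up := Q.IsUp) h h').2 hcon) ⟨h, h'⟩
    · rw [h', ht_right d3]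
    · exact ((f_lt_ht_right (i := d.1) (j := d.2) d3 h').1
        ((mem_verts_toggled_last (up := Q.IsUp) d3 h').1 d2)).le

theorem not_mem_steps_zero_and_last (hn : 1 ≤ n) {x : Equiv.Perm (Fin n)} {U : Fin n → Prop}
    {d : Fin (n + 2) × Fin (n + 2)} (h0 : d ∈ steps (toggled U x 0))
    (h1 : d ∈ steps (toggled U x n)) : False := by
  obtain ⟨c1, c2, c3, c4⟩ := mem_steps.1 h0
  obtain ⟨d1, d2, d3, d4⟩ := mem_steps.1 h1
  have key : ∀ b : Fin n, inner b ∈ verts (toggled U x 0) → inner b ∈ verts (toggled U x n) →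
      False := by
    intro b hb hb'
    rw [inner_mem_verts, mem_toggled] at hb hb'
    have := (x.symm b).2
    grind
  have key' : ∀ b : Fin n, inner b ∈ verts (toggled U x 0) ∨ inner b ∈ verts (toggled U x n) := by
    intro b
    rw [inner_mem_verts, inner_mem_verts, mem_toggled, mem_toggled]
    have := (x.symm b).2
    grind
  by_cases h2 : d.1 = 0
  · by_cases h3 : d.2 = Fin.last (n + 1)
    · have hb : d.1 < inner ⟨0, hn⟩ ∧ inner ⟨0, hn⟩ < d.2 := by
        rw [h2, h3]
        constructor <;> simp [Fin.lt_def, inner]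
        omega
      rcases key' ⟨0, hn⟩ with h | h
      · exact c4 _ h hb
      · exact d4 _ h hb
    · obtain ⟨b, hb⟩ := exists_inner (v := d.2) (fun h => by rw [h] at c3; exact absurd c3 (by simp)) h3
      exact key b (hb ▸ c2) (hb ▸ d2)
  · obtain ⟨b, hb⟩ := exists_inner h2 fun h => by
      rw [h] at c3
      exact absurd c3 (not_lt.2 (Fin.le_last _))
    exact key b (hb ▸ c1) (hb ▸ d1)

/-- The triangles of a triangulation cover the polygon. -/
theorem exists_mem_lift (hn : 1 ≤ n) (T : Q.Triangulation) {p : Fin (n + 2) → ℝ}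
    (hp : p ∈ simplex n) : ∃ p' ∈ T.lift, Q.φ p' = Q.φ p := by
  classical
  have hT := T.isTriang
  obtain ⟨m, hm1, hm2⟩ := exists_strip (a_zero_le_φ_fst (Q := Q) hp) (φ_fst_le_a_last hp)
  obtain ⟨B, hB, hBm, hmB⟩ := exists_step (toggled Q.Up 1 0) (Fin.castSucc_lt_succ (i := m))
  obtain ⟨D, hD, hDm, hmD⟩ := exists_step (toggled Q.Up 1 n) (Fin.castSucc_lt_succ (i := m))
  have hBD : B ≠ D := by
    rintro rfl
    exact not_mem_steps_zero_and_last hn hB hD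
  have hBT : B ∈ T.1 := hT.mem B (hBm.trans_lt hmB) fun d hd h1 h2 =>
    Or.inl (leChord_of_steps_zero (up := Q.IsUp) hB h2 h1)
  have hDT : D ∈ T.1 := hT.mem D (hDm.trans_lt hmD) fun d hd h1 h2 =>
    Or.inr (leChord_of_steps_last (up := Q.IsUp) hD h2 h1)
  -- the chords over the strip are ordered by their heights over an inner point of the strip
  obtain ⟨τ, hτ1, hτ2⟩ := exists_between (Q.a_strictMono (Fin.castSucc_lt_succ (i := m)))
  let S : Finset (Fin (n + 2) × Fin (n + 2)) :=
    Finset.univ.filter fun g => g ∈ T.1 ∧ g.1 ≤ m.castSucc ∧ m.castSucc < g.2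
  have hS : ∀ g, g ∈ S ↔ g ∈ T.1 ∧ g.1 ≤ m.castSucc ∧ m.castSucc < g.2 := fun g => by simp [S]
  have hkey : ∀ g ∈ S, ∀ g' ∈ S, LeChord Q.IsUp g g' → g ≠ g' → Q.ht g τ < Q.ht g' τ := by
    intro g hg g' hg' hle hne
    rw [hS] at hg hg'
    have hm := Q.a_strictMono.monotone
    exact ht_lt_ht (hT.lt _ hg.1) (hT.lt _ hg'.1) hle hne ((hm hg.2.1).trans_lt hτ1)
      (hτ2.trans_le (hm (Fin.castSucc_lt_iff_succ_le.1 hg.2.2))) ((hm hg'.2.1).trans_lt hτ1)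
      (hτ2.trans_le (hm (Fin.castSucc_lt_iff_succ_le.1 hg'.2.2)))
  have hcomp : ∀ g ∈ S, ∀ g' ∈ S, Q.ht g τ ≤ Q.ht g' τ → LeChord Q.IsUp g g' := by
    intro g hg g' hg' hle
    by_cases hne : g' = g
    · rw [hne]
      exact LeChord.refl g
    have hg1 := (hS g).1 hg
    have hg1' := (hS g').1 hg'
    refine (hT.compat g hg1.1 g' hg1'.1 (hg1.2.1.trans_lt hg1'.2.2)
      (hg1'.2.1.trans_lt hg1.2.2)).resolve_right fun h => ?_
    exact hle.not_gt (hkey g' hg' g hg h hne)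
  have hBS : B ∈ S := (hS B).2 ⟨hBT, hBm, hmB⟩
  have hDS : D ∈ S := (hS D).2 ⟨hDT, hDm, hmD⟩
  have hBlow : ∀ g ∈ S, g ≠ B → Q.ht B τ < Q.ht g τ := by
    intro g hg hne
    have hg1 := (hS g).1 hg
    exact hkey B hBS g hg (leChord_of_steps_zero (up := Q.IsUp) hB (hg1.2.1.trans_lt hmB)
      (hBm.trans_lt hg1.2.2)) hne.symm
  obtain ⟨c, hc, hcmin⟩ := Finset.exists_min_image
    (S.filter fun g => g ≠ B ∧ (Q.φ p).2 ≤ Q.ht g (Q.φ p).1) (fun g => Q.ht g τ)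
    ⟨D, by simp [hDS, hBD.symm, le_ht_of_steps_last hD hp]⟩
  simp only [Finset.mem_filter] at hc hcmin
  obtain ⟨hcS, hcB, hcp⟩ := hc
  obtain ⟨d, hd, hdmax⟩ := Finset.exists_max_image
    (S.filter fun g => Q.ht g τ < Q.ht c τ) (fun g => Q.ht g τ)
    ⟨B, by simp [hBS, hBlow c hcS hcB]⟩
  simp only [Finset.mem_filter] at hd hdmax
  obtain ⟨hdS, hdc⟩ := hd
  have hdp : Q.ht d (Q.φ p).1 ≤ (Q.φ p).2 := by
    by_cases h : d = B
    · exact h ▸ ht_le_of_steps_zero hB hp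
    · by_contra! hlt
      exact (hcmin d ⟨hdS, h, hlt.le⟩).not_gt hdc
  have hc1 := (hS c).1 hcS
  have hd1 := (hS d).1 hdS
  obtain ⟨i, j, k, h1, h2, h3, hci, hdi⟩ := hT.exists_triangle hc1.1 hd1.1 hc1.2.1 hc1.2.2 hd1.2.1
    hd1.2.2 (hcomp d hdS c hcS hdc.le) (by rintro rfl; exact lt_irrefl _ hdc) (by
      intro g hg hgm hmg hdg hgc
      by_contra! hcon
      have hgS := (hS g).2 ⟨hg, hgm, hmg⟩
      have l1 := hkey g hgS c hcS hgc hcon.1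
      have l2 := hkey d hdS g hgS hdg hcon.2.symm
      exact (hdmax g ⟨hgS, l1⟩).not_gt l2)
  have hedge : ∀ g ∈ S, g ∈ ({(i, j), (j, k), (i, k)} : Set (Fin (n + 2) × Fin (n + 2))) →
      Q.edgePt g (Q.φ p).1 ∈ convexHull ℝ {e i, e j, e k} := by
    intro g hg hgi
    have hg1 := (hS g).1 hg
    have hm := Q.a_strictMono.monotone
    have hcv := convex_convexHull ℝ {(e i : Fin (n + 2) → ℝ), e j, e k}
    refine hcv.segment_subset ?_ ?_ (edgePt_mem_segment (hT.lt _ hg1.1) ((hm hg1.2.1).trans hm1)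
      (hm2.trans (hm (Fin.castSucc_lt_iff_succ_le.1 hg1.2.2)))) <;>
    · refine subset_convexHull ℝ _ ?_
      rcases hgi with rfl | rfl | rfl <;> simp
  have hseg : Q.φ p ∈ segment ℝ (Q.φ (Q.edgePt d (Q.φ p).1)) (Q.φ (Q.edgePt c (Q.φ p).1)) := by
    rw [φ_edgePt (hT.lt _ hc1.1), φ_edgePt (hT.lt _ hd1.1), ← Prod.image_mk_segment_right]
    refine ⟨(Q.φ p).2, ?_, rfl⟩
    rw [segment_eq_Icc (hdp.trans hcp)]
    exact ⟨hdp, hcp⟩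
  obtain ⟨s, r, hs, hr, hsr, he⟩ := hseg
  rw [← map_smul, ← map_smul, ← map_add] at he
  refine ⟨_, ?_, he⟩
  simp only [Triangulation.lift, Set.mem_iUnion]
  exact ⟨i, j, k, ⟨h1, h2, h3⟩, (convex_convexHull ℝ _).segment_subset (hedge d hdS hdi)
    (hedge c hcS hci) ⟨s, r, hs, hr, hsr, rfl⟩⟩

theorem lift_subset_simplex (T : Q.Triangulation) : T.lift ⊆ simplex n := by
  intro p hp
  simp only [Triangulation.lift, Set.mem_iUnion] at hp
  obtain ⟨i, j, k, -, hp⟩ := hp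
  exact (support_of_mem_convexHull hp).1

theorem image_lift (hn : 1 ≤ n) (T : Q.Triangulation) : Q.φ '' T.lift = Q.φ '' simplex n := by
  refine (Set.image_mono (lift_subset_simplex T)).antisymm ?_
  rintro _ ⟨p, hp, rfl⟩
  obtain ⟨p', hp', h⟩ := exists_mem_lift hn T hp
  exact ⟨p', hp', h⟩

theorem isCompact_lift (T : Q.Triangulation) : IsCompact T.lift := by
  unfold Triangulation.lift
  refine isCompact_iUnion fun i => isCompact_iUnion fun j => isCompact_iUnion fun k =>
    isCompact_iUnion fun _ => ?_
  exact Set.Finite.isCompact_convexHull ℝ (((Set.finite_singleton _).insert _).insert _)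

end Cover

end CambrianPolygon

/-! ### Averages of sections -/

section Sections

variable {E F G : Type*} [NormedAddCommGroup E] [NormedSpace ℝ E]
  [NormedAddCommGroup G] [NormedAddCommGroup F] [NormedSpace ℝ F] [MeasurableSpace F] [BorelSpace F]

/-- Compact sets of positive finite volume in the dimension of their affine span. -/
structure IsBase (B : Set F) : Prop where
  isCompact : IsCompact B
  ne_zero : baseVolume B Set.univ ≠ 0
  ne_top : baseVolume B Set.univ ≠ ⊤

/-- The normalized volume on a base: averages are integrals with respect to it. -/
noncomputable def unitVolume (B : Set F) : Measure F :=
  (baseVolume B Set.univ)⁻¹ • baseVolume B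

namespace IsBase

variable {B : Set F}

theorem isProbabilityMeasure (hB : IsBase B) : IsProbabilityMeasure (unitVolume B) :=
  ⟨by
    rw [unitVolume, Measure.smul_apply, smul_eq_mul]
    exact ENNReal.inv_mul_cancel hB.ne_zero hB.ne_top⟩

theorem ae_iff (hB : IsBase B) {p : F → Prop} :
    (∀ᵐ q ∂(unitVolume B), p q) ↔ ∀ᵐ q ∂(baseVolume B), p q :=
  Measure.ae_ennreal_smul_measure_iff (ENNReal.inv_ne_zero.2 hB.ne_top)

theorem measurableSet (hB : IsBase B) : MeasurableSet B := hB.isCompact.isClosed.measurableSet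

theorem ae_mem (hB : IsBase B) : ∀ᵐ q ∂(unitVolume B), q ∈ B :=
  hB.ae_iff.2 (ae_restrict_mem hB.measurableSet)

theorem _root_.MeasureTheory.AEStronglyMeasurable.unitVolume {γ : F → G}
    (h : AEStronglyMeasurable γ (baseVolume B)) : AEStronglyMeasurable γ (_root_.unitVolume B) :=
  h.mono_ac Measure.smul_absolutelyContinuous

theorem integrable (hB : IsBase B) {γ : F → G} (h : AEStronglyMeasurable γ (baseVolume B))
    {P : Set G} (hP : Bornology.IsBounded P) (hγ : ∀ q ∈ B, γ q ∈ P) :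
    Integrable γ (unitVolume B) := by
  have := hB.isProbabilityMeasure
  obtain ⟨C, hC⟩ := hP.exists_norm_le
  refine Integrable.of_bound h.unitVolume C ?_
  filter_upwards [hB.ae_mem] with q hq using hC _ (hγ q hq)

theorem integrable_of_continuousOn [FiniteDimensional ℝ E] (hB : IsBase B) {γ : F → E} (h : ContinuousOn γ B) :
    Integrable γ (unitVolume B) :=
  hB.integrable (h.aestronglyMeasurable hB.measurableSet)
    (hB.isCompact.image_of_continuousOn h).isBounded fun q hq => ⟨q, hq, rfl⟩

end IsBase

theorem map_integral [FiniteDimensional ℝ E] [NormedSpace ℝ G] [CompleteSpace G] {X : Type*}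
    [MeasurableSpace X] (w : E →ₗ[ℝ] G) {μ : Measure X} {γ : X → E} (h : Integrable γ μ) :
    w (∫ q, γ q ∂μ) = ∫ q, w (γ q) ∂μ := by
  have : CompleteSpace E := FiniteDimensional.complete ℝ E
  exact ((LinearMap.toContinuousLinearMap w).integral_comp_comm h).symm

theorem integrable_map [FiniteDimensional ℝ E] [NormedSpace ℝ G] {X : Type*} [MeasurableSpace X]
    (w : E →ₗ[ℝ] G) {μ : Measure X} {γ : X → E} (h : Integrable γ μ) :
    Integrable (fun q => w (γ q)) μ :=
  (LinearMap.toContinuousLinearMap w).integrable_comp h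

/-- A measurable section of `ψ : P → ψ(P)`. -/
structure IsSection (ψ : E →ₗ[ℝ] F) (P : Set E) (γ : F → E) : Prop where
  aestronglyMeasurable : AEStronglyMeasurable γ (baseVolume (ψ '' P))
  mem : ∀ q ∈ ψ '' P, γ q ∈ P
  map_eq : ∀ q ∈ ψ '' P, ψ (γ q) = q

variable {ψ : E →ₗ[ℝ] F} {P : Set E} {γ γ' : F → E} {w : E →ₗ[ℝ] ℝ}

theorem mem_fiberPolytope {y : E} : y ∈ fiberPolytope ψ P ↔
    ∃ γ, IsSection ψ P γ ∧ y = ∫ q, γ q ∂(unitVolume (ψ '' P)) := by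
  constructor
  · rintro ⟨γ, h1, h2, h3⟩
    exact ⟨γ, ⟨h1, fun q hq => (h2 q hq).1, fun q hq => (h2 q hq).2⟩, h3⟩
  · rintro ⟨γ, h1, h2⟩
    exact ⟨γ, h1.1, fun q hq => ⟨h1.2 q hq, h1.3 q hq⟩, h2⟩

theorem IsSection.integrable (h : IsSection ψ P γ) (hB : IsBase (ψ '' P))
    (hP : Bornology.IsBounded P) : Integrable γ (unitVolume (ψ '' P)) :=
  hB.integrable h.aestronglyMeasurable hP h.mem

theorem convex_fiberPolytope (hB : IsBase (ψ '' P)) (hP : Bornology.IsBounded P)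
    (hc : Convex ℝ P) : Convex ℝ (fiberPolytope ψ P) := by
  intro y hy y' hy' s r hs hr hsr
  obtain ⟨γ, hγ, rfl⟩ := mem_fiberPolytope.1 hy
  obtain ⟨γ', hγ', rfl⟩ := mem_fiberPolytope.1 hy'
  refine mem_fiberPolytope.2 ⟨fun q => s • γ q + r • γ' q, ⟨?_, ?_, ?_⟩, ?_⟩
  · exact (hγ.1.const_smul s).add (hγ'.1.const_smul r)
  · exact fun q hq => hc (hγ.2 q hq) (hγ'.2 q hq) hs hr hsr
  · intro q hq
    rw [map_add, map_smul, map_smul, hγ.3 q hq, hγ'.3 q hq, ← add_smul, hsr, one_smul]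
  · rw [← integral_smul, ← integral_smul]
    exact (integral_add ((hγ.integrable hB hP).smul s) ((hγ'.integrable hB hP).smul r)).symm

theorem isBounded_fiberPolytope (hB : IsBase (ψ '' P)) (hP : Bornology.IsBounded P) :
    Bornology.IsBounded (fiberPolytope ψ P) := by
  have := hB.isProbabilityMeasure
  obtain ⟨C, hC⟩ := hP.exists_norm_le
  refine (Metric.isBounded_closedBall (x := (0 : E)) (r := C)).subset fun y hy => ?_
  obtain ⟨γ, hγ, rfl⟩ := mem_fiberPolytope.1 hy
  rw [mem_closedBall_zero_iff]
  refine (norm_integral_le_of_norm_le_const (C := C) ?_).trans (by simp)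
  filter_upwards [hB.ae_mem] with q hq using hC _ (hγ.2 q hq)

variable [FiniteDimensional ℝ E]

/-- A functional that attains its maximum over almost every fiber on a section belongs to the
normal cone at the average of the section. -/
theorem mem_normalCone_of_ae_le (hB : IsBase (ψ '' P)) (hP : Bornology.IsBounded P)
    (hγ : Integrable γ (unitVolume (ψ '' P)))
    (h : ∀ᵐ q ∂(unitVolume (ψ '' P)), ∀ p ∈ P, ψ p = q → w p ≤ w (γ q)) :
    w ∈ normalCone (fiberPolytope ψ P) (∫ q, γ q ∂(unitVolume (ψ '' P))) := by
  intro y hy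
  obtain ⟨γ', hγ', rfl⟩ := mem_fiberPolytope.1 hy
  have hγ'i := hγ'.integrable hB hP
  rw [map_integral w hγ'i, map_integral w hγ]
  refine integral_mono_ae (integrable_map w hγ'i) (integrable_map w hγ) ?_
  filter_upwards [h, hB.ae_mem] with q hq hqB using hq _ (hγ'.2 q hqB) (hγ'.3 q hqB)

theorem ae_eq_of_mem_normalCone (hB : IsBase (ψ '' P)) (hP : Bornology.IsBounded P)
    (hγ : Integrable γ (unitVolume (ψ '' P))) (hγ' : IsSection ψ P γ')
    (hw : w ∈ normalCone (fiberPolytope ψ P) (∫ q, γ q ∂(unitVolume (ψ '' P))))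
    (h : ∀ᵐ q ∂(unitVolume (ψ '' P)), w (γ q) ≤ w (γ' q)) :
    ∀ᵐ q ∂(unitVolume (ψ '' P)), w (γ q) = w (γ' q) := by
  have hγ'i := hγ'.integrable hB hP
  have h1 := hw _ (mem_fiberPolytope.2 ⟨γ', hγ', rfl⟩)
  rw [map_integral w hγ'i, map_integral w hγ] at h1
  exact (integral_eq_iff_of_ae_le (integrable_map w hγ) (integrable_map w hγ'i) h).1
    (le_antisymm (integral_mono_ae (integrable_map w hγ) (integrable_map w hγ'i) h) h1)

/-- A functional in the normal cone at the average of a continuous section attains its maximum over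
every fiber on the section: otherwise the section can be improved on a small homothetic copy of the
base. -/
theorem le_of_mem_normalCone (hB : IsBase (ψ '' P)) (hP : Bornology.IsBounded P)
    (hc : Convex ℝ P) (hcont : ContinuousOn γ (ψ '' P)) (hmem : ∀ q ∈ ψ '' P, γ q ∈ P)
    (hmap : ∀ q ∈ ψ '' P, ψ (γ q) = q)
    (hw : w ∈ normalCone (fiberPolytope ψ P) (∫ q, γ q ∂(unitVolume (ψ '' P)))) {p : E}
    (hp : p ∈ P) : w p ≤ w (γ (ψ p)) := by
  by_contra! hlt
  have hwc : Continuous w := w.continuous_of_finiteDimensional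
  have hBc : Convex ℝ (ψ '' P) := hc.linear_image ψ
  have hp0 : ψ p ∈ ψ '' P := ⟨p, hp, rfl⟩
  obtain ⟨C, hC⟩ := (hP.isCompact_closure.image hwc).isBounded.exists_norm_le
  have hC' : ∀ p' ∈ P, |w p'| ≤ C := fun p' hp' => hC _ ⟨p', subset_closure hp', rfl⟩
  obtain ⟨D, hD⟩ := hB.isCompact.isBounded.exists_norm_le
  obtain ⟨δ, hδ, hnear⟩ := Metric.continuousOn_iff.1 (hwc.comp_continuousOn hcont) (ψ p) hp0
    ((w p - w (γ (ψ p))) / 2) (by linarith)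
  have hCp := hC' p hp
  have hDp := hD _ hp0
  have hC0 : 0 ≤ C := (abs_nonneg _).trans hCp
  have hD0 : 0 ≤ D := (norm_nonneg _).trans hDp
  obtain ⟨τ, hτ, hτ1, hτD, hτC⟩ : ∃ τ : ℝ, 0 < τ ∧ τ < 1 ∧ τ * (2 * D) < δ ∧
      τ * (2 * C) < (w p - w (γ (ψ p))) / 2 := by
    have hε : 0 < (w p - w (γ (ψ p))) / 2 := by linarith
    refine ⟨min (1 / 2) (min (δ / (2 * D + 1)) ((w p - w (γ (ψ p))) / 2 / (2 * C + 1))) , ?_, ?_,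
      ?_, ?_⟩
    · positivity
    · exact (min_le_left _ _).trans_lt (by norm_num)
    · refine (mul_le_mul_of_nonneg_right ((min_le_right _ _).trans (min_le_left _ _))
        (by positivity)).trans_lt ?_
      rw [div_mul_eq_mul_div, div_lt_iff₀ (by positivity)]
      nlinarith
    · refine (mul_le_mul_of_nonneg_right ((min_le_right _ _).trans (min_le_right _ _))
        (by positivity)).trans_lt ?_
      rw [div_mul_eq_mul_div, div_lt_iff₀ (by positivity)]
      nlinarith
  let A : Set F := AffineMap.homothety (ψ p) τ '' (ψ '' P)
  let back : F → F := AffineMap.homothety (ψ p) τ⁻¹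
  have hback : ∀ q ∈ ψ '' P, back (AffineMap.homothety (ψ p) τ q) = q := by
    intro q _
    simp [back, AffineMap.homothety_apply, smul_smul, inv_mul_cancel₀ hτ.ne']
  have hhom : ∀ q, AffineMap.homothety (ψ p) τ q = (1 - τ) • ψ p + τ • q := by
    intro q
    simp only [AffineMap.homothety_apply, vsub_eq_sub, vadd_eq_add]
    module
  have hAB : A ⊆ ψ '' P := by
    rintro _ ⟨q, hq, rfl⟩
    rw [hhom]
    exact hBc hp0 hq (by linarith) hτ.le (by ring)
  have hcontA : ContinuousOn (AffineMap.homothety (ψ p) τ) (ψ '' P) := by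
    rw [show ⇑(AffineMap.homothety (ψ p) τ) = fun q => (1 - τ) • ψ p + τ • q from funext hhom]
    fun_prop
  have hAm : MeasurableSet A :=
    (hB.isCompact.image_of_continuousOn hcontA).isClosed.measurableSet
  have hbackc : Continuous back := by
    have : back = fun q => (1 - τ⁻¹) • ψ p + τ⁻¹ • q := by
      funext q
      simp only [back, AffineMap.homothety_apply, vsub_eq_sub, vadd_eq_add]
      module
    rw [this]
    fun_prop
  have hbackm : Set.MapsTo back A (ψ '' P) := by
    rintro _ ⟨q, hq, rfl⟩
    rw [hback q hq]
    exact hq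
  classical
  let σ : F → E := A.piecewise (fun q => (1 - τ) • p + τ • γ (back q)) γ
  have hσA : ∀ q ∈ A, σ q = (1 - τ) • p + τ • γ (back q) := fun q hq =>
    Set.piecewise_eq_of_mem _ _ _ hq
  have hσA' : ∀ q ∉ A, σ q = γ q := fun q hq => Set.piecewise_eq_of_notMem _ _ _ hq
  have hσ : IsSection ψ P σ := by
    refine ⟨?_, fun q hq => ?_, fun q hq => ?_⟩
    · refine AEStronglyMeasurable.piecewise hAm ?_ ?_
      · rw [baseVolume, Measure.restrict_restrict hAm, Set.inter_eq_left.2 hAB]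
        refine ContinuousOn.aestronglyMeasurable ?_ hAm
        exact continuousOn_const.add
          ((hcont.comp hbackc.continuousOn hbackm).const_smul τ)
      · exact (hcont.aestronglyMeasurable hB.measurableSet).restrict
    · by_cases h : q ∈ A
      · rw [hσA q h]
        exact hc hp (hmem _ (hbackm h)) (by linarith) hτ.le (by ring)
      · rw [hσA' q h]
        exact hmem q hq
    · by_cases h : q ∈ A
      · rw [hσA q h, map_add, map_smul, map_smul, hmap _ (hbackm h)]
        obtain ⟨q', hq', rfl⟩ := h
        rw [hback q' hq', hhom]
      · rw [hσA' q h]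
        exact hmap q hq
  have hltA : ∀ q ∈ A, w (γ q) < w (σ q) := by
    intro q hq
    rw [hσA q hq, map_add, map_smul, map_smul, smul_eq_mul, smul_eq_mul]
    have h1 : dist q (ψ p) < δ := by
      obtain ⟨q', hq', rfl⟩ := hq
      rw [hhom, dist_eq_norm, show (1 - τ) • ψ p + τ • q' - ψ p = τ • (q' - ψ p) by module,
        norm_smul, Real.norm_of_nonneg hτ.le]
      refine lt_of_le_of_lt (mul_le_mul_of_nonneg_left ?_ hτ.le) hτD
      calc ‖q' - ψ p‖ ≤ ‖q'‖ + ‖ψ p‖ := norm_sub_le _ _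
        _ ≤ 2 * D := by linarith [hD q' hq']
    have h2 := hnear q (hAB hq) h1
    rw [Real.dist_eq] at h2
    have h3 := (abs_lt.1 h2).2
    simp only [Function.comp_apply] at h3
    have h4 := (abs_le.1 (hC' _ (hmem _ (hbackm hq)))).1
    have h5 := (abs_le.1 hCp).2
    have h6 : τ * (-(2 * C)) ≤ τ * (w (γ (back q)) - w p) :=
      mul_le_mul_of_nonneg_left (by linarith) hτ.le
    linarith
  have hi : Integrable γ (unitVolume (ψ '' P)) := hB.integrable_of_continuousOn hcont
  have hae := ae_eq_of_mem_normalCone hB hP hi hσ hw (Filter.Eventually.of_forall fun q => by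
    by_cases h : q ∈ A
    · exact (hltA q h).le
    · rw [hσA' q h])
  have hnull : baseVolume (ψ '' P) A = 0 := by
    refine measure_mono_null ?_ (ae_iff.1 (hB.ae_iff.1 hae))
    exact fun q hq => (hltA q hq).ne
  have hsc : τ ≠ 0 := hτ.ne'
  rw [baseVolume, Measure.restrict_apply hAm, Set.inter_eq_left.2 hAB,
    hausdorffMeasure_homothety_image (by positivity) _ hsc] at hnull
  have h0 : (μH[(Module.finrank ℝ (vectorSpan ℝ (ψ '' P)) : ℝ)]) (ψ '' P) ≠ 0 := by
    have := hB.ne_zero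
    rwa [baseVolume, Measure.restrict_apply_univ] at this
  rw [ENNReal.smul_def, smul_eq_mul, mul_eq_zero] at hnull
  refine hnull.elim (fun h => ?_) h0
  simp [hτ.ne'] at h

/-- If a continuous map is injective on the part of a compact set over `S`, its inverse is
continuous on `S`. -/
theorem continuousOn_invFunOn {X Y : Type*} [TopologicalSpace X] [Nonempty X] [TopologicalSpace Y]
    [T2Space Y] {g : X → Y} (hg : Continuous g) {K : Set X} (hK : IsCompact K) {S : Set Y}
    (hS : S ⊆ g '' K) (huniq : ∀ q ∈ S, ∀ p ∈ K, ∀ p' ∈ K, g p = q → g p' = q → p = p') :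
    ContinuousOn (Function.invFunOn g K) S := by
  intro q hq
  have hinv : ∀ q ∈ S, Function.invFunOn g K q ∈ K ∧ g (Function.invFunOn g K q) = q :=
    fun q hq => ⟨Function.invFunOn_mem (hS hq), Function.invFunOn_eq (hS hq)⟩
  refine (Filter.tendsto_iff_ultrafilter _ _ _).2 fun U hU => ?_
  have hUS : ∀ᶠ q' in (U : Filter Y), q' ∈ S := hU self_mem_nhdsWithin
  have hUK : (U.map (Function.invFunOn g K) : Filter X) ≤ Filter.principal K := by
    rw [Filter.le_principal_iff]
    exact hUS.mono fun q' hq' => (hinv q' hq').1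
  obtain ⟨p, hp, hlim⟩ := hK.ultrafilter_le_nhds _ hUK
  have hgp : g p = q := by
    refine tendsto_nhds_unique (f := fun q' => g (Function.invFunOn g K q')) (l := (U : Filter Y))
      ((hg.tendsto p).comp hlim) ?_
    refine Filter.Tendsto.congr' (f₁ := fun q' => q') ?_ (hU.trans nhdsWithin_le_nhds)
    exact hUS.mono fun q' hq' => ((hinv q' hq').2).symm
  rw [huniq q hq _ (hinv q hq).1 p hp (hinv q hq).2 hgp]
  exact hlim

theorem isBase_segment {x y : F} (h : x ≠ y) : IsBase (segment ℝ x y) := by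
  have hd : Module.finrank ℝ (vectorSpan ℝ (segment ℝ x y)) = 1 := by
    rw [vectorSpan_segment]
    exact finrank_span_singleton (sub_ne_zero.2 h.symm)
  have hv : baseVolume (segment ℝ x y) Set.univ = edist x y := by
    rw [baseVolume, Measure.restrict_apply_univ, hd, Nat.cast_one, hausdorffMeasure_segment]
  refine ⟨?_, ?_, ?_⟩
  · rw [← convexHull_pair]
    exact Set.Finite.isCompact_convexHull ℝ (Set.toFinite _)
  · rw [hv]
    exact (edist_pos.2 h).ne'
  · rw [hv]
    exact edist_ne_top x y

end Sections

/-! ### Paths of edges of the simplex -/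

theorem lt_of_mem_segment {E : Type*} [AddCommGroup E] [Module ℝ E] {P R x : E} {g : E →ₗ[ℝ] ℝ}
    (hx : x ∈ segment ℝ P R) (h : g P < g R) :
    g P ≤ g x ∧ g x ≤ g R ∧ (g R - g P) • x = (g R - g x) • P + (g x - g P) • R := by
  obtain ⟨s, r, hs, hr, hsr, rfl⟩ := hx
  obtain rfl : s = 1 - r := by linarith
  simp only [map_add, map_smul, smul_eq_mul]
  refine ⟨by nlinarith, by nlinarith, ?_⟩
  module

/-- A linear functional is injective on a chain of segments along which it increases. -/
theorem injOn_iUnion_segment {E ι : Type*} [AddCommGroup E] [Module ℝ E] {S : Set ι} {P R : ι → E}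
    {g : E →ₗ[ℝ] ℝ} (hlt : ∀ c ∈ S, g (P c) < g (R c))
    (hord : ∀ c ∈ S, ∀ d ∈ S, c ≠ d →
      (g (R c) ≤ g (P d) ∧ (g (R c) = g (P d) → R c = P d)) ∨
      (g (R d) ≤ g (P c) ∧ (g (R d) = g (P c) → R d = P c))) :
    Set.InjOn g (⋃ c ∈ S, segment ℝ (P c) (R c)) := by
  have cancel : ∀ {r : ℝ} {x y : E}, 0 < r → r • x = r • y → x = y := fun hr h =>
    smul_right_injective E hr.ne' h
  have key : ∀ c ∈ S, ∀ d ∈ S, ∀ x ∈ segment ℝ (P c) (R c), ∀ y ∈ segment ℝ (P d) (R d),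
      g x = g y → g (R c) ≤ g (P d) → (g (R c) = g (P d) → R c = P d) → x = y := by
    intro c hc d hd x hx y hy hxy h1 h2
    obtain ⟨x1, x2, x3⟩ := lt_of_mem_segment hx (hlt c hc)
    obtain ⟨y1, y2, y3⟩ := lt_of_mem_segment hy (hlt d hd)
    have e1 : g x = g (R c) := by linarith
    have e2 : g y = g (P d) := by linarith
    rw [e1, sub_self, zero_smul, zero_add] at x3
    rw [e2, sub_self, zero_smul, add_zero] at y3
    rw [cancel (sub_pos.2 (hlt c hc)) x3, cancel (sub_pos.2 (hlt d hd)) y3,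
      h2 (by linarith)]
  intro x hx y hy hxy
  simp only [Set.mem_iUnion] at hx hy
  obtain ⟨c, hc, hx⟩ := hx
  obtain ⟨d, hd, hy⟩ := hy
  by_cases hcd : c = d
  · subst hcd
    obtain ⟨x1, x2, x3⟩ := lt_of_mem_segment hx (hlt c hc)
    obtain ⟨y1, y2, y3⟩ := lt_of_mem_segment hy (hlt c hc)
    rw [hxy, ← y3] at x3
    exact cancel (sub_pos.2 (hlt c hc)) x3
  · rcases hord c hc d hd hcd with ⟨h1, h2⟩ | ⟨h1, h2⟩
    · exact key c hc d hd x hx y hy hxy h1 h2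
    · exact (key d hd c hc y hy x hx hxy.symm h1 h2).symm

namespace CambrianPolygon

section Paths

variable {n : ℕ} {Q : CambrianPolygon n}

theorem ρφ_apply (p : Fin (n + 2) → ℝ) : (ρ ∘ₗ Q.φ) p = (Q.φ p).1 := rfl

variable (Q) in
/-- The interval at the bottom of the tower. -/
def interval : Set ℝ := segment ℝ (Q.a 0) (Q.a (Fin.last (n + 1)))

theorem a_zero_lt_a_last : Q.a 0 < Q.a (Fin.last (n + 1)) := Q.a_strictMono Fin.last_pos

theorem mem_interval {t : ℝ} : t ∈ Q.interval ↔ Q.a 0 ≤ t ∧ t ≤ Q.a (Fin.last (n + 1)) := by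
  rw [interval, segment_eq_Icc a_zero_lt_a_last.le]
  rfl

theorem a_mem_interval (m : Fin (n + 2)) : Q.a m ∈ Q.interval :=
  mem_interval.2 ⟨Q.a_strictMono.monotone (Fin.zero_le m),
    Q.a_strictMono.monotone (Fin.le_last m)⟩

/-- The lift to the simplex of the polygonal path through the vertices in `H`. -/
def edgePath (H : Set (Fin n)) : Set (Fin (n + 2) → ℝ) :=
  ⋃ c ∈ steps H, segment ℝ (e c.1) (e c.2)

theorem edgePath_subset (H : Set (Fin n)) : edgePath H ⊆ simplex n := by
  intro p hp
  simp only [edgePath, Set.mem_iUnion] at hp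
  obtain ⟨c, -, hp⟩ := hp
  exact convex_simplex.segment_subset (e_mem_simplex _) (e_mem_simplex _) hp

theorem isCompact_edgePath (H : Set (Fin n)) : IsCompact (edgePath H) := by
  refine (Set.toFinite _).isCompact_biUnion fun c _ => ?_
  rw [← convexHull_pair]
  exact Set.Finite.isCompact_convexHull ℝ (Set.toFinite _)

theorem steps_eq_of_overlap {H : Set (Fin n)} {c d : Fin (n + 2) × Fin (n + 2)}
    (hc : c ∈ steps H) (hd : d ∈ steps H) (h1 : c.1 < d.2) (h2 : d.1 < c.2) : c = d := by
  obtain ⟨c1, c2, c3, c4⟩ := mem_steps.1 hc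
  obtain ⟨d1, d2, d3, d4⟩ := mem_steps.1 hd
  refine Prod.ext (le_antisymm ?_ ?_) (le_antisymm ?_ ?_)
  · exact not_lt.1 fun h => d4 _ c1 ⟨h, h1⟩
  · exact not_lt.1 fun h => c4 _ d1 ⟨h, h2⟩
  · exact not_lt.1 fun h => c4 _ d2 ⟨h1, h⟩
  · exact not_lt.1 fun h => d4 _ c2 ⟨h2, h⟩

theorem ρφ_e (i : Fin (n + 2)) : (ρ ∘ₗ Q.φ) (e i) = Q.a i := by
  rw [ρφ_apply, φ_e]
  rfl

theorem injOn_edgePath (H : Set (Fin n)) : Set.InjOn (ρ ∘ₗ Q.φ) (edgePath H) := by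
  refine injOn_iUnion_segment (fun c hc => ?_) fun c hc d hd hne => ?_
  · rw [ρφ_e, ρφ_e]
    exact Q.a_strictMono (mem_steps.1 hc).2.2.1
  · simp only [ρφ_e]
    have : c.2 ≤ d.1 ∨ d.2 ≤ c.1 := by
      by_contra! h
      exact hne (steps_eq_of_overlap hc hd h.2 h.1)
    rcases this with h | h
    · exact Or.inl ⟨Q.a_strictMono.monotone h, fun h' => by rw [Q.a_strictMono.injective h']⟩
    · exact Or.inr ⟨Q.a_strictMono.monotone h, fun h' => by rw [Q.a_strictMono.injective h']⟩

/-- Every point of the interval lies under a step of the path. -/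
theorem exists_step_over (H : Set (Fin n)) {t : ℝ} (ht : t ∈ Q.interval) :
    ∃ c ∈ steps H, Q.a c.1 ≤ t ∧ t ≤ Q.a c.2 := by
  obtain ⟨m, h1, h2⟩ := exists_strip (mem_interval.1 ht).1 (mem_interval.1 ht).2
  obtain ⟨c, hc, hcm, hmc⟩ := exists_step H (Fin.castSucc_lt_succ (i := m))
  have hm := Q.a_strictMono.monotone
  exact ⟨c, hc, (hm hcm).trans h1, h2.trans (hm (Fin.castSucc_lt_iff_succ_le.1 hmc))⟩

theorem edgePt_mem_edgePath {H : Set (Fin n)} {c : Fin (n + 2) × Fin (n + 2)} (hc : c ∈ steps H)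
    {t : ℝ} (h1 : Q.a c.1 ≤ t) (h2 : t ≤ Q.a c.2) : Q.edgePt c t ∈ edgePath H :=
  Set.mem_iUnion₂.2 ⟨c, hc, edgePt_mem_segment (mem_steps.1 hc).2.2.1 h1 h2⟩

theorem image_simplex_interval : (ρ ∘ₗ Q.φ) '' simplex n = Q.interval := by
  ext t
  constructor
  · rintro ⟨p, hp, rfl⟩
    exact mem_interval.2 ⟨a_zero_le_φ_fst hp, φ_fst_le_a_last hp⟩
  · intro ht
    obtain ⟨c, hc, h1, h2⟩ := exists_step_over ∅ ht
    refine ⟨Q.edgePt c t, edgePath_subset _ (edgePt_mem_edgePath hc h1 h2), ?_⟩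
    rw [ρφ_apply, φ_edgePt (mem_steps.1 hc).2.2.1]

theorem image_edgePath (H : Set (Fin n)) : (ρ ∘ₗ Q.φ) '' edgePath H = Q.interval := by
  refine Set.Subset.antisymm ?_ fun t ht => ?_
  · rw [← image_simplex_interval]
    exact Set.image_mono (edgePath_subset H)
  · obtain ⟨c, hc, h1, h2⟩ := exists_step_over H ht
    refine ⟨Q.edgePt c t, edgePt_mem_edgePath hc h1 h2, ?_⟩
    rw [ρφ_apply, φ_edgePt (mem_steps.1 hc).2.2.1]

theorem isBase_interval : IsBase Q.interval := isBase_segment a_zero_lt_a_last.ne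

theorem isBase_image_simplex : IsBase ((ρ ∘ₗ Q.φ) '' simplex n) :=
  image_simplex_interval ▸ isBase_interval

theorem isBounded_simplex : Bornology.IsBounded (simplex n) := bounded_stdSimplex _

variable (Q) in
/-- The section of the projection to the interval with values in a path of edges. -/
noncomputable def pathPt (H : Set (Fin n)) : ℝ → Fin (n + 2) → ℝ :=
  Function.invFunOn (ρ ∘ₗ Q.φ) (edgePath H)

theorem pathPt_eq {H : Set (Fin n)} {c : Fin (n + 2) × Fin (n + 2)} (hc : c ∈ steps H)
    {t : ℝ} (h1 : Q.a c.1 ≤ t) (h2 : t ≤ Q.a c.2) : Q.pathPt H t = Q.edgePt c t := by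
  have hmem := edgePt_mem_edgePath hc h1 h2
  have hmap : (ρ ∘ₗ Q.φ) (Q.edgePt c t) = t := by
    rw [ρφ_apply, φ_edgePt (mem_steps.1 hc).2.2.1]
  have hex : ∃ p ∈ edgePath H, (ρ ∘ₗ Q.φ) p = t := ⟨_, hmem, hmap⟩
  exact injOn_edgePath H (Function.invFunOn_mem hex) hmem
    ((Function.invFunOn_eq hex).trans hmap.symm)

theorem pathPt_mem {H : Set (Fin n)} {t : ℝ} (ht : t ∈ Q.interval) :
    Q.pathPt H t ∈ simplex n := by
  obtain ⟨c, hc, h1, h2⟩ := exists_step_over H ht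
  rw [pathPt_eq hc h1 h2]
  exact edgePath_subset H (edgePt_mem_edgePath hc h1 h2)

variable (Q) in
/-- The height of the path through the vertices in `H`. -/
noncomputable def pathHt (H : Set (Fin n)) (t : ℝ) : ℝ := (Q.φ (Q.pathPt H t)).2

theorem φ_pathPt {H : Set (Fin n)} {t : ℝ} (ht : t ∈ Q.interval) :
    Q.φ (Q.pathPt H t) = (t, Q.pathHt H t) := by
  refine Prod.ext ?_ rfl
  obtain ⟨c, hc, h1, h2⟩ := exists_step_over H ht
  rw [pathPt_eq hc h1 h2, φ_edgePt (mem_steps.1 hc).2.2.1]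

theorem pathHt_eq {H : Set (Fin n)} {c : Fin (n + 2) × Fin (n + 2)} (hc : c ∈ steps H)
    {t : ℝ} (h1 : Q.a c.1 ≤ t) (h2 : t ≤ Q.a c.2) : Q.pathHt H t = Q.ht c t := by
  rw [pathHt, pathPt_eq hc h1 h2, φ_edgePt (mem_steps.1 hc).2.2.1]

theorem continuousOn_pathPt (H : Set (Fin n)) : ContinuousOn (Q.pathPt H) Q.interval := by
  refine continuousOn_invFunOn (LinearMap.continuous_of_finiteDimensional _) (isCompact_edgePath H)
    (image_edgePath H).ge fun t _ p hp p' hp' h h' => ?_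
  exact injOn_edgePath H hp hp' (h.trans h'.symm)

theorem integrable_pathPt (H : Set (Fin n)) :
    Integrable (Q.pathPt H) (unitVolume Q.interval) :=
  isBase_interval.integrable_of_continuousOn (continuousOn_pathPt H)

theorem cubeVertex_eq (H : Set (Fin n)) :
    Q.cubeVertex H = ∫ t, Q.pathPt H t ∂(unitVolume Q.interval) := by
  rw [cubeVertex, sectionAverage]
  change ⨍ t, Q.pathPt H t ∂(baseVolume ((ρ ∘ₗ Q.φ) '' edgePath H)) = _
  rw [image_edgePath]
  rfl

theorem isSection_pathPt (H : Set (Fin n)) :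
    IsSection (ρ ∘ₗ Q.φ) (simplex n) (Q.pathPt H) := by
  refine ⟨?_, fun t ht => ?_, fun t ht => ?_⟩
  · rw [image_simplex_interval]
    exact (continuousOn_pathPt H).aestronglyMeasurable isBase_interval.measurableSet
  · rw [image_simplex_interval] at ht
    exact pathPt_mem ht
  · rw [image_simplex_interval] at ht
    rw [ρφ_apply, φ_pathPt ht]

theorem mem_cube {y : Fin (n + 2) → ℝ} : y ∈ Q.cube ↔
    ∃ γ, IsSection (ρ ∘ₗ Q.φ) (simplex n) γ ∧ y = ∫ t, γ t ∂(unitVolume Q.interval) := by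
  rw [cube, mem_fiberPolytope, image_simplex_interval]

theorem cubeVertex_mem_cube (H : Set (Fin n)) : Q.cubeVertex H ∈ Q.cube :=
  mem_cube.2 ⟨_, isSection_pathPt H, cubeVertex_eq H⟩

theorem convex_cube : Convex ℝ Q.cube :=
  convex_fiberPolytope isBase_image_simplex isBounded_simplex convex_simplex

theorem isBounded_cube : Bornology.IsBounded Q.cube :=
  isBounded_fiberPolytope isBase_image_simplex isBounded_simplex

theorem pathHt_mono {x : Equiv.Perm (Fin n)} {k l : ℕ} (hkl : k ≤ l) {t : ℝ}
    (ht : t ∈ Q.interval) :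
    Q.pathHt (toggled Q.Up x k) t ≤ Q.pathHt (toggled Q.Up x l) t := by
  obtain ⟨m, h1, h2⟩ := exists_strip (mem_interval.1 ht).1 (mem_interval.1 ht).2
  obtain ⟨c, hc, hcm, hmc⟩ := exists_step (toggled Q.Up x k) (Fin.castSucc_lt_succ (i := m))
  obtain ⟨d, hd, hdm, hmd⟩ := exists_step (toggled Q.Up x l) (Fin.castSucc_lt_succ (i := m))
  have hm := Q.a_strictMono.monotone
  rw [pathHt_eq hc ((hm hcm).trans h1) (h2.trans (hm (Fin.castSucc_lt_iff_succ_le.1 hmc))),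
    pathHt_eq hd ((hm hdm).trans h1) (h2.trans (hm (Fin.castSucc_lt_iff_succ_le.1 hmd)))]
  exact ht_le_of_strip (leChord_of_steps (up := Q.IsUp) hkl hc hd (hcm.trans_lt hmd)
    (hdm.trans_lt hmc)) h1 h2 hcm hmc hdm hmd

theorem φ_fst_mem_interval {p : Fin (n + 2) → ℝ} (hp : p ∈ simplex n) :
    (Q.φ p).1 ∈ Q.interval :=
  mem_interval.2 ⟨a_zero_le_φ_fst hp, φ_fst_le_a_last hp⟩

theorem pathHt_zero_le (x : Equiv.Perm (Fin n)) {p : Fin (n + 2) → ℝ} (hp : p ∈ simplex n) :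
    Q.pathHt (toggled Q.Up x 0) (Q.φ p).1 ≤ (Q.φ p).2 := by
  obtain ⟨c, hc, h1, h2⟩ := exists_step_over (toggled Q.Up x 0) (φ_fst_mem_interval (Q := Q) hp)
  rw [pathHt_eq hc h1 h2]
  exact ht_le_of_steps_zero hc hp

theorem le_pathHt_last (x : Equiv.Perm (Fin n)) {p : Fin (n + 2) → ℝ} (hp : p ∈ simplex n) :
    (Q.φ p).2 ≤ Q.pathHt (toggled Q.Up x n) (Q.φ p).1 := by
  obtain ⟨c, hc, h1, h2⟩ := exists_step_over (toggled Q.Up x n) (φ_fst_mem_interval (Q := Q) hp)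
  rw [pathHt_eq hc h1 h2]
  exact le_ht_of_steps_last hc hp

/-- Over a triangle of a permutation, the two paths at its sides run through one face. -/
theorem pathPt_mem_face {x : Equiv.Perm (Fin n)} {b : Fin n} {i j : Fin (n + 2)}
    (hs : IsStep Q.Up x b i j) {t : ℝ} (h1 : Q.a i ≤ t) (h2 : t ≤ Q.a j) :
    Q.pathPt (toggled Q.Up x (x.symm b)) t ∈ convexHull ℝ {e i, e (inner b), e j} ∧
      Q.pathPt (toggled Q.Up x (x.symm b + 1)) t ∈ convexHull ℝ {e i, e (inner b), e j} := by
  have hcv := convex_convexHull ℝ {(e i : Fin (n + 2) → ℝ), e (inner b), e j}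
  have he : ∀ m, m = i ∨ m = inner b ∨ m = j →
      e m ∈ convexHull ℝ {(e i : Fin (n + 2) → ℝ), e (inner b), e j} := fun m hm =>
    subset_convexHull ℝ _ (by rcases hm with rfl | rfl | rfl <;> simp)
  have hib := hs.left_lt
  have hbj := hs.lt_right
  have long : ∀ H : Set (Fin n), (i, j) ∈ steps H →
      Q.pathPt H t ∈ convexHull ℝ {e i, e (inner b), e j} := by
    intro H hH
    rw [pathPt_eq hH h1 h2]
    exact hcv.segment_subset (he i (Or.inl rfl)) (he j (Or.inr (Or.inr rfl)))
      (edgePt_mem_segment (c := (i, j)) (hib.trans hbj) h1 h2)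
  have short : ∀ H : Set (Fin n), (i, inner b) ∈ steps H → (inner b, j) ∈ steps H →
      Q.pathPt H t ∈ convexHull ℝ {e i, e (inner b), e j} := by
    intro H hH hH'
    rcases le_total t (Q.a (inner b)) with h | h
    · rw [pathPt_eq hH h1 h]
      exact hcv.segment_subset (he i (Or.inl rfl)) (he _ (Or.inr (Or.inl rfl)))
        (edgePt_mem_segment (c := (i, inner b)) hib h1 h)
    · rw [pathPt_eq hH' h h2]
      exact hcv.segment_subset (he _ (Or.inr (Or.inl rfl))) (he j (Or.inr (Or.inr rfl)))
        (edgePt_mem_segment (c := (inner b, j)) hbj h h2)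
  by_cases hU : Q.Up b
  · exact ⟨long _ (hs.long_mem_of_up hU), short _ (hs.left_mem_of_up hU) (hs.right_mem_of_up hU)⟩
  · exact ⟨short _ (hs.left_mem_of_down hU) (hs.right_mem_of_down hU),
      long _ (hs.long_mem_of_down hU)⟩

/-- Over the interior of the left half of a triangle of a permutation, the two paths at its sides
are different. -/
theorem pathHt_lt {x : Equiv.Perm (Fin n)} {b : Fin n} {i j : Fin (n + 2)}
    (hs : IsStep Q.Up x b i j) {t : ℝ} (h1 : Q.a i < t) (h2 : t < Q.a (inner b)) :
    Q.pathHt (toggled Q.Up x (x.symm b)) t < Q.pathHt (toggled Q.Up x (x.symm b + 1)) t := by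
  have hib := hs.left_lt
  have hbj := hs.lt_right
  have h3 := h2.trans (Q.a_strictMono hbj)
  by_cases hU : Q.Up b
  · have hc := hs.long_mem_of_up hU
    have hd := hs.left_mem_of_up hU
    rw [pathHt_eq hc h1.le h3.le, pathHt_eq hd h1.le h2.le]
    exact ht_lt_ht (hib.trans hbj) hib
      (leChord_of_steps (up := Q.IsUp) (Nat.le_succ _) hc hd hib (hib.trans hbj))
      (fun h => hbj.ne' (congrArg Prod.snd h)) h1 h3 h1 h2
  · have hc := hs.left_mem_of_down hU
    have hd := hs.long_mem_of_down hU
    rw [pathHt_eq hc h1.le h2.le, pathHt_eq hd h1.le h3.le]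
    exact ht_lt_ht hib (hib.trans hbj)
      (leChord_of_steps (up := Q.IsUp) (Nat.le_succ _) hc hd (hib.trans hbj) hib)
      (fun h => hbj.ne (congrArg Prod.snd h)) h1 h2 h1 h3

/-- Where two consecutive paths differ, they are the sides of a triangle of the permutation. -/
theorem mem_strip_of_pathHt_lt {x : Equiv.Perm (Fin n)} {b : Fin n} {i j : Fin (n + 2)}
    (hs : IsStep Q.Up x b i j) {t : ℝ} (ht : t ∈ Q.interval)
    (h : Q.pathHt (toggled Q.Up x (x.symm b)) t < Q.pathHt (toggled Q.Up x (x.symm b + 1)) t) :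
    Q.a i ≤ t ∧ t ≤ Q.a j := by
  obtain ⟨d, hd, h1, h2⟩ := exists_step_over (toggled Q.Up x (x.symm b + 1)) ht
  have hm := Q.a_strictMono.monotone
  have hd' : d ∉ steps (toggled Q.Up x (x.symm b)) := by
    intro hd'
    rw [pathHt_eq hd h1 h2, pathHt_eq hd' h1 h2] at h
    exact lt_irrefl _ h
  rcases hs.mem_steps_succ hd hd' with ⟨-, rfl | rfl⟩ | ⟨-, rfl⟩
  · exact ⟨h1, h2.trans (hm hs.lt_right.le)⟩
  · exact ⟨(hm hs.left_lt.le).trans h1, h2⟩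
  · exact ⟨h1, h2⟩

end Paths

end CambrianPolygon

/-! ### The monotone path of a permutation -/

theorem exists_le_le_succ {y : ℕ → ℝ} {s : ℝ} (h0 : y 0 ≤ s) : ∀ {n : ℕ}, 1 ≤ n → s ≤ y n →
    ∃ k < n, y k ≤ s ∧ s ≤ y (k + 1)
  | n + 1, _, hs => by
    rcases le_total (y n) s with h | h
    · exact ⟨n, Nat.lt_succ_self n, h, hs⟩
    · rcases Nat.eq_zero_or_pos n with rfl | hn
      · exact ⟨0, Nat.lt_succ_self 0, h0, hs⟩
      · obtain ⟨k, hk, h'⟩ := exists_le_le_succ h0 hn h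
        exact ⟨k, hk.trans (Nat.lt_succ_self n), h'⟩

theorem unitVolume_segment_ne_zero {F : Type*} [NormedAddCommGroup F] [NormedSpace ℝ F]
    [MeasurableSpace F] [BorelSpace F] {x y u v : F} (h : x ≠ y) (huv : u ≠ v)
    (hsub : segment ℝ u v ⊆ segment ℝ x y) : unitVolume (segment ℝ x y) (segment ℝ u v) ≠ 0 := by
  have hd : Module.finrank ℝ (vectorSpan ℝ (segment ℝ x y)) = 1 := by
    rw [vectorSpan_segment]
    exact finrank_span_singleton (sub_ne_zero.2 h.symm)
  rw [unitVolume, Measure.smul_apply, smul_eq_mul, mul_ne_zero_iff]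
  refine ⟨ENNReal.inv_ne_zero.2 (isBase_segment h).ne_top, ?_⟩
  rw [baseVolume, Measure.restrict_apply (isBase_segment huv).measurableSet,
    Set.inter_eq_left.2 hsub, hd, Nat.cast_one, hausdorffMeasure_segment]
  exact (edist_pos.2 huv).ne'

namespace CambrianPolygon

section MonotonePath

variable {n : ℕ} {Q : CambrianPolygon n}

variable (Q) in
/-- The height of a point of the simplex, as a linear functional. -/
def heightMap : (Fin (n + 2) → ℝ) →ₗ[ℝ] ℝ := LinearMap.snd ℝ ℝ ℝ ∘ₗ Q.φ

theorem heightMap_apply (p : Fin (n + 2) → ℝ) : Q.heightMap p = (Q.φ p).2 := rfl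

variable (Q) in
/-- The center of the interval, over which the cube lies. -/
noncomputable def mid : ℝ := ∫ t, t ∂(unitVolume Q.interval)

variable (Q) in
/-- The vertices of the cube on the monotone path of a permutation. -/
noncomputable def pathVertex (x : Equiv.Perm (Fin n)) (k : ℕ) : Fin (n + 2) → ℝ :=
  Q.cubeVertex (toggled Q.Up x k)

theorem pathVertex_mem_cube (x : Equiv.Perm (Fin n)) (k : ℕ) : Q.pathVertex x k ∈ Q.cube :=
  cubeVertex_mem_cube _

theorem φ_fst_of_mem_cube {y : Fin (n + 2) → ℝ} (hy : y ∈ Q.cube) : (Q.φ y).1 = Q.mid := by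
  obtain ⟨γ, hγ, rfl⟩ := mem_cube.1 hy
  have hi := hγ.integrable isBase_image_simplex isBounded_simplex
  rw [image_simplex_interval] at hi
  rw [← ρφ_apply, map_integral _ hi, mid]
  refine integral_congr_ae ?_
  filter_upwards [isBase_interval.ae_mem] with t ht
  exact hγ.map_eq t (image_simplex_interval.symm ▸ ht)

theorem integrable_section {γ : ℝ → Fin (n + 2) → ℝ} (hγ : IsSection (ρ ∘ₗ Q.φ) (simplex n) γ) :
    Integrable γ (unitVolume Q.interval) := by
  have hi := hγ.integrable isBase_image_simplex isBounded_simplex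
  rwa [image_simplex_interval] at hi

theorem IsSection.mem_simplex {γ : ℝ → Fin (n + 2) → ℝ}
    (hγ : IsSection (ρ ∘ₗ Q.φ) (simplex n) γ) {t : ℝ} (ht : t ∈ Q.interval) :
    γ t ∈ simplex n := hγ.mem t (image_simplex_interval.symm ▸ ht)

theorem IsSection.φ_fst {γ : ℝ → Fin (n + 2) → ℝ}
    (hγ : IsSection (ρ ∘ₗ Q.φ) (simplex n) γ) {t : ℝ} (ht : t ∈ Q.interval) :
    (Q.φ (γ t)).1 = t := hγ.map_eq t (image_simplex_interval.symm ▸ ht)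

theorem heightMap_pathVertex (x : Equiv.Perm (Fin n)) (k : ℕ) : Q.heightMap (Q.pathVertex x k) =
    ∫ t, Q.pathHt (toggled Q.Up x k) t ∂(unitVolume Q.interval) := by
  rw [pathVertex, cubeVertex_eq, map_integral _ (integrable_pathPt _)]
  rfl

theorem integrable_pathHt (H : Set (Fin n)) :
    Integrable (Q.pathHt H) (unitVolume Q.interval) :=
  integrable_map Q.heightMap (integrable_pathPt H)

theorem heightMap_mem_of_mem_cube (x : Equiv.Perm (Fin n)) {y : Fin (n + 2) → ℝ}
    (hy : y ∈ Q.cube) : Q.heightMap (Q.pathVertex x 0) ≤ Q.heightMap y ∧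
      Q.heightMap y ≤ Q.heightMap (Q.pathVertex x n) := by
  obtain ⟨γ, hγ, rfl⟩ := mem_cube.1 hy
  have hi := integrable_section hγ
  rw [heightMap_pathVertex, heightMap_pathVertex, map_integral _ hi]
  constructor
  · refine integral_mono_ae (integrable_pathHt _) (integrable_map _ hi) ?_
    filter_upwards [isBase_interval.ae_mem] with t ht
    have := pathHt_zero_le (Q := Q) x (IsSection.mem_simplex hγ ht)
    rwa [IsSection.φ_fst hγ ht] at this
  · refine integral_mono_ae (integrable_map _ hi) (integrable_pathHt _) ?_
    filter_upwards [isBase_interval.ae_mem] with t ht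
    have := le_pathHt_last (Q := Q) x (IsSection.mem_simplex hγ ht)
    rwa [IsSection.φ_fst hγ ht] at this

/-- The path of a permutation is strictly monotone. -/
theorem heightMap_pathVertex_lt (x : Equiv.Perm (Fin n)) {k : ℕ} (hk : k < n) :
    Q.heightMap (Q.pathVertex x k) < Q.heightMap (Q.pathVertex x (k + 1)) := by
  obtain ⟨b, rfl⟩ : ∃ b, (x.symm b : ℕ) = k := ⟨x ⟨k, hk⟩, by simp⟩
  obtain ⟨i, j, hs⟩ := exists_isStep Q.Up x b
  have hle : ∀ᵐ t ∂(unitVolume Q.interval), Q.pathHt (toggled Q.Up x (x.symm b)) t ≤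
      Q.pathHt (toggled Q.Up x (x.symm b + 1)) t := by
    filter_upwards [isBase_interval.ae_mem] with t ht using pathHt_mono (Nat.le_succ _) ht
  rw [heightMap_pathVertex, heightMap_pathVertex]
  refine lt_of_le_of_ne (integral_mono_ae (integrable_pathHt _) (integrable_pathHt _) hle)
    fun heq => ?_
  have hae := (integral_eq_iff_of_ae_le (integrable_pathHt _) (integrable_pathHt _) hle).1 heq
  obtain ⟨u, hu, hu'⟩ := exists_between (Q.a_strictMono hs.left_lt)
  obtain ⟨v, hv, hv'⟩ := exists_between hu'
  have hsub : segment ℝ u v ⊆ segment ℝ (Q.a 0) (Q.a (Fin.last (n + 1))) := by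
    have h0 := Q.a_strictMono.monotone (Fin.zero_le i)
    have h1 := Q.a_strictMono.monotone (Fin.le_last (inner b))
    rw [segment_eq_Icc hv.le, segment_eq_Icc a_zero_lt_a_last.le]
    exact Set.Icc_subset_Icc (by linarith) (by linarith)
  refine unitVolume_segment_ne_zero a_zero_lt_a_last.ne hv.ne hsub
    (measure_mono_null (fun t ht => ?_) (ae_iff.1 hae))
  rw [segment_eq_Icc hv.le] at ht
  exact (pathHt_lt hs (hu.trans_le ht.1) (ht.2.trans_lt hv')).ne

theorem heightMap_pathVertex_le (x : Equiv.Perm (Fin n)) {k l : ℕ} (hkl : k ≤ l) (hl : l ≤ n) :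
    Q.heightMap (Q.pathVertex x k) ≤ Q.heightMap (Q.pathVertex x l) := by
  induction l, hkl using Nat.le_induction with
  | base => exact le_rfl
  | succ l hkl ih => exact (ih (by omega)).trans (heightMap_pathVertex_lt x (by omega)).le

theorem monotonePath_eq (x : Equiv.Perm (Fin n)) : Q.monotonePath x =
    ⋃ k ∈ (Set.univ : Set (Fin n)), segment ℝ (Q.pathVertex x k) (Q.pathVertex x (k + 1)) := by
  simp only [monotonePath, pathVertex, pathSet_eq, Set.mem_univ, Set.iUnion_true]

theorem injOn_monotonePath (x : Equiv.Perm (Fin n)) :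
    Set.InjOn Q.heightMap (Q.monotonePath x) := by
  rw [monotonePath_eq]
  refine injOn_iUnion_segment (fun k _ => heightMap_pathVertex_lt x k.2) ?_
  have key : ∀ k l : Fin n, k < l →
      Q.heightMap (Q.pathVertex x (k + 1)) ≤ Q.heightMap (Q.pathVertex x l) ∧
      (Q.heightMap (Q.pathVertex x (k + 1)) = Q.heightMap (Q.pathVertex x l) →
        Q.pathVertex x (k + 1) = Q.pathVertex x l) := by
    intro k l hkl
    have hkl' : (k : ℕ) + 1 ≤ l := hkl
    refine ⟨heightMap_pathVertex_le x hkl' l.2.le, fun h => ?_⟩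
    rcases hkl'.eq_or_lt with h' | h'
    · rw [h']
    · have h1 := heightMap_pathVertex_lt (Q := Q) x (h'.trans l.2)
      have h2 := heightMap_pathVertex_le (Q := Q) x (Nat.succ_le_of_lt h') l.2.le
      exact absurd h (h1.trans_le h2).ne
  intro k _ l _ hne
  rcases lt_or_gt_of_ne hne with h | h
  · exact Or.inl (key k l h)
  · exact Or.inr (key l k h)

variable (Q) in
/-- The image of the cube in the polygon, a vertical segment. -/
def fiberSegment (x : Equiv.Perm (Fin n)) : Set (ℝ × ℝ) :=
  segment ℝ (Q.mid, Q.heightMap (Q.pathVertex x 0)) (Q.mid, Q.heightMap (Q.pathVertex x n))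

theorem heightMap_zero_lt_last (hn : 1 ≤ n) (x : Equiv.Perm (Fin n)) :
    Q.heightMap (Q.pathVertex x 0) < Q.heightMap (Q.pathVertex x n) :=
  (heightMap_pathVertex_lt x hn).trans_le (heightMap_pathVertex_le x hn le_rfl)

theorem mem_fiberSegment (hn : 1 ≤ n) {x : Equiv.Perm (Fin n)} {q : ℝ × ℝ} :
    q ∈ Q.fiberSegment x ↔ q.1 = Q.mid ∧ Q.heightMap (Q.pathVertex x 0) ≤ q.2 ∧
      q.2 ≤ Q.heightMap (Q.pathVertex x n) := by
  rw [fiberSegment, ← Prod.image_mk_segment_right,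
    segment_eq_Icc (heightMap_zero_lt_last hn x).le]
  constructor
  · rintro ⟨s, hs, rfl⟩
    exact ⟨rfl, hs.1, hs.2⟩
  · rintro ⟨h1, h2⟩
    exact ⟨q.2, h2, Prod.ext h1.symm rfl⟩

theorem isBase_fiberSegment (hn : 1 ≤ n) (x : Equiv.Perm (Fin n)) : IsBase (Q.fiberSegment x) :=
  isBase_segment fun h => (heightMap_zero_lt_last hn x).ne (Prod.ext_iff.1 h).2

theorem monotonePath_subset_cube (x : Equiv.Perm (Fin n)) : Q.monotonePath x ⊆ Q.cube := by
  rw [monotonePath_eq]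
  refine Set.iUnion₂_subset fun k _ => ?_
  exact convex_cube.segment_subset (pathVertex_mem_cube _ _) (pathVertex_mem_cube _ _)

theorem φ_eq_of_mem_cube {p : Fin (n + 2) → ℝ} (hp : p ∈ Q.cube) :
    Q.φ p = (Q.mid, Q.heightMap p) := Prod.ext (φ_fst_of_mem_cube hp) rfl

theorem exists_mem_segment_pathVertex (x : Equiv.Perm (Fin n)) {k : ℕ} (hk : k < n) {s : ℝ}
    (h1 : Q.heightMap (Q.pathVertex x k) ≤ s) (h2 : s ≤ Q.heightMap (Q.pathVertex x (k + 1))) :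
    ∃ p ∈ segment ℝ (Q.pathVertex x k) (Q.pathVertex x (k + 1)), p ∈ Q.monotonePath x ∧
      Q.heightMap p = s := by
  have hs : s ∈ segment ℝ (Q.heightMap (Q.pathVertex x k))
      (Q.heightMap (Q.pathVertex x (k + 1))) := by
    rw [segment_eq_Icc (h1.trans h2)]
    exact ⟨h1, h2⟩
  obtain ⟨r, r', hr, hr', hrr, he⟩ := hs
  rw [← map_smul, ← map_smul, ← map_add] at he
  refine ⟨_, ⟨r, r', hr, hr', hrr, rfl⟩, ?_, he⟩
  rw [monotonePath_eq]
  exact Set.mem_iUnion₂.2 ⟨⟨k, hk⟩, Set.mem_univ _, r, r', hr, hr', hrr, rfl⟩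

theorem image_monotonePath (hn : 1 ≤ n) (x : Equiv.Perm (Fin n)) :
    Q.φ '' Q.monotonePath x = Q.fiberSegment x := by
  ext q
  rw [mem_fiberSegment hn]
  constructor
  · rintro ⟨p, hp, rfl⟩
    have hp' := monotonePath_subset_cube x hp
    exact ⟨φ_fst_of_mem_cube hp', heightMap_mem_of_mem_cube x hp'⟩
  · rintro ⟨h1, h2, h3⟩
    obtain ⟨k, hk, h4, h5⟩ :=
      exists_le_le_succ (y := fun k => Q.heightMap (Q.pathVertex x k)) h2 hn h3
    obtain ⟨p, -, hp, h6⟩ := exists_mem_segment_pathVertex x hk h4 h5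
    refine ⟨p, hp, Prod.ext ?_ h6⟩
    rw [h1, φ_fst_of_mem_cube (monotonePath_subset_cube x hp)]

theorem image_cube (hn : 1 ≤ n) (x : Equiv.Perm (Fin n)) : Q.φ '' Q.cube = Q.fiberSegment x := by
  refine Set.Subset.antisymm ?_ ?_
  · rintro _ ⟨p, hp, rfl⟩
    exact (mem_fiberSegment hn).2 ⟨φ_fst_of_mem_cube hp, heightMap_mem_of_mem_cube x hp⟩
  · rw [← image_monotonePath hn]
    exact Set.image_mono (monotonePath_subset_cube x)

theorem isCompact_monotonePath (x : Equiv.Perm (Fin n)) : IsCompact (Q.monotonePath x) := by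
  rw [monotonePath_eq]
  refine (Set.toFinite _).isCompact_biUnion fun c _ => ?_
  rw [← convexHull_pair]
  exact Set.Finite.isCompact_convexHull ℝ (Set.toFinite _)

variable (Q) in
/-- The section of the projection of the cube with values in the monotone path. -/
noncomputable def monotoneSection (x : Equiv.Perm (Fin n)) : ℝ × ℝ → Fin (n + 2) → ℝ :=
  Function.invFunOn Q.φ (Q.monotonePath x)

theorem injOn_φ_monotonePath (x : Equiv.Perm (Fin n)) : Set.InjOn Q.φ (Q.monotonePath x) :=
  fun _ hp _ hp' h => injOn_monotonePath x hp hp' (congrArg Prod.snd h)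

theorem monotoneSection_φ {x : Equiv.Perm (Fin n)} {p : Fin (n + 2) → ℝ}
    (hp : p ∈ Q.monotonePath x) : Q.monotoneSection x (Q.φ p) = p := by
  have hex : ∃ p' ∈ Q.monotonePath x, Q.φ p' = Q.φ p := ⟨p, hp, rfl⟩
  exact injOn_φ_monotonePath x (Function.invFunOn_mem hex) hp (Function.invFunOn_eq hex)

theorem monotoneSection_mem (hn : 1 ≤ n) {x : Equiv.Perm (Fin n)} {q : ℝ × ℝ}
    (hq : q ∈ Q.fiberSegment x) : Q.monotoneSection x q ∈ Q.monotonePath x ∧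
      Q.φ (Q.monotoneSection x q) = q := by
  have hex : ∃ p' ∈ Q.monotonePath x, Q.φ p' = q := (image_monotonePath hn x).ge hq
  exact ⟨Function.invFunOn_mem hex, Function.invFunOn_eq hex⟩

theorem continuousOn_monotoneSection (hn : 1 ≤ n) (x : Equiv.Perm (Fin n)) :
    ContinuousOn (Q.monotoneSection x) (Q.fiberSegment x) := by
  refine continuousOn_invFunOn (LinearMap.continuous_of_finiteDimensional _)
    (isCompact_monotonePath x) (image_monotonePath hn x).ge fun q _ p hp p' hp' h h' => ?_
  exact injOn_φ_monotonePath x hp hp' (h.trans h'.symm)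

theorem permVertex_eq (hn : 1 ≤ n) (x : Equiv.Perm (Fin n)) : Q.permVertex x =
    ∫ q, Q.monotoneSection x q ∂(unitVolume (Q.fiberSegment x)) := by
  rw [permVertex, sectionAverage, image_monotonePath hn]
  rfl

/-- A functional in the normal cone of a permutation attains its maximum over the fibers of the
cube on the monotone path of the permutation. -/
theorem le_monotoneSection (hn : 1 ≤ n) {x : Equiv.Perm (Fin n)} {w : (Fin (n + 2) → ℝ) →ₗ[ℝ] ℝ}
    (hw : w ∈ normalCone Q.permutohedron (Q.permVertex x)) {p : Fin (n + 2) → ℝ}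
    (hp : p ∈ Q.cube) : w p ≤ w (Q.monotoneSection x (Q.φ p)) := by
  rw [permVertex_eq hn, permutohedron, ← image_cube hn x] at hw
  refine le_of_mem_normalCone (image_cube hn x ▸ isBase_fiberSegment hn x) isBounded_cube
    convex_cube ?_ ?_ ?_ hw hp
  · rw [image_cube hn x]
    exact continuousOn_monotoneSection hn x
  · intro q hq
    rw [image_cube hn x] at hq
    exact monotonePath_subset_cube x (monotoneSection_mem hn hq).1
  · intro q hq
    rw [image_cube hn x] at hq
    exact (monotoneSection_mem hn hq).2

/-- Up to a multiple of the height, a functional in the normal cone of a permutation attains its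
maximum over the cube on each edge of the monotone path: as a function of the height, the maximum
over the fibers of the cube is concave, and it is linear on the edge. -/
theorem exists_slope (hn : 1 ≤ n) {x : Equiv.Perm (Fin n)} {w : (Fin (n + 2) → ℝ) →ₗ[ℝ] ℝ}
    (hw : w ∈ normalCone Q.permutohedron (Q.permVertex x)) {k : ℕ} (hk : k < n) :
    ∃ β : ℝ, w - β • Q.heightMap ∈ normalCone Q.cube (Q.pathVertex x k) ∧
      w - β • Q.heightMap ∈ normalCone Q.cube (Q.pathVertex x (k + 1)) := by
  have hlt := heightMap_pathVertex_lt (Q := Q) x hk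
  set y := Q.heightMap (Q.pathVertex x k) with hy
  set y' := Q.heightMap (Q.pathVertex x (k + 1)) with hy'
  let β := (w (Q.pathVertex x (k + 1)) - w (Q.pathVertex x k)) / (y' - y)
  let u := w - β • Q.heightMap
  have hu : ∀ p, u p = w p - β * Q.heightMap p := fun p => rfl
  have hend : u (Q.pathVertex x (k + 1)) = u (Q.pathVertex x k) := by
    have : β * (y' - y) = w (Q.pathVertex x (k + 1)) - w (Q.pathVertex x k) :=
      div_mul_cancel₀ _ (by linarith)
    rw [hu, hu, ← hy, ← hy']
    linarith
  have key : ∀ p ∈ Q.cube, u p ≤ u (Q.pathVertex x k) := by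
    intro p hp
    by_contra! hcon
    -- move from the middle of the edge a little towards a better point
    let m := (1 / 2 : ℝ) • Q.pathVertex x k + (1 / 2 : ℝ) • Q.pathVertex x (k + 1)
    have hm : m ∈ Q.cube := convex_cube (pathVertex_mem_cube x k) (pathVertex_mem_cube x (k + 1))
      (by norm_num) (by norm_num) (by norm_num)
    have hmu : u m = u (Q.pathVertex x k) := by
      simp only [m, map_add, map_smul, hend, smul_eq_mul]
      ring
    have hmy : Q.heightMap m = (y + y') / 2 := by
      simp only [m, map_add, map_smul, smul_eq_mul, ← hy, ← hy']
      ring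
    set s := Q.heightMap p - (y + y') / 2 with hs
    set d := (y' - y) / 2 with hd
    have hd0 : 0 < d := by rw [hd]; linarith
    obtain ⟨τ, hτ, hτ1, hτs⟩ : ∃ τ : ℝ, 0 < τ ∧ τ ≤ 1 ∧ |τ * s| ≤ d := by
      refine ⟨d / (d + |s|), by positivity, (div_le_one (by positivity)).2
        (by linarith [abs_nonneg s]), ?_⟩
      rw [abs_mul, abs_of_pos (by positivity), div_mul_eq_mul_div, div_le_iff₀ (by positivity)]
      nlinarith [abs_nonneg s]
    have hpτ : (1 - τ) • m + τ • p ∈ Q.cube :=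
      convex_cube hm hp (by linarith) hτ.le (by ring)
    have hyτ : Q.heightMap ((1 - τ) • m + τ • p) = (y + y') / 2 + τ * s := by
      rw [map_add, map_smul, map_smul, hmy, smul_eq_mul, smul_eq_mul, hs]
      ring
    have habs := abs_le.1 hτs
    obtain ⟨p', hp', hp'm, hp'h⟩ := exists_mem_segment_pathVertex x hk
      (s := (y + y') / 2 + τ * s) (by rw [← hy]; linarith) (by rw [← hy']; linarith)
    have hφ : Q.φ ((1 - τ) • m + τ • p) = Q.φ p' := by
      rw [φ_eq_of_mem_cube hpτ, φ_eq_of_mem_cube (monotonePath_subset_cube x hp'm), hp'h, hyτ]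
    have h1 := le_monotoneSection hn hw hpτ
    rw [hφ, monotoneSection_φ hp'm] at h1
    have h2 : u p' = u (Q.pathVertex x k) := by
      obtain ⟨r, r', hr, hr', hrr, rfl⟩ := hp'
      rw [map_add, map_smul, map_smul, hend, ← add_smul, hrr, one_smul]
    have h3 : u ((1 - τ) • m + τ • p) ≤ u p' := by
      rw [hu, hu, hyτ, hp'h]
      linarith
    rw [map_add, map_smul, map_smul, hmu, h2, smul_eq_mul, smul_eq_mul] at h3
    have h4 := mul_pos hτ (sub_pos.2 hcon)
    linarith
  exact ⟨β, key, fun p hp => (key p hp).trans hend.ge⟩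

/-- A functional in the normal cone of a permutation attains its maximum over the fibers of the
simplex on the segments between consecutive paths of the permutation. -/
theorem le_of_mem_segment_pathPt (hn : 1 ≤ n) {x : Equiv.Perm (Fin n)}
    {w : (Fin (n + 2) → ℝ) →ₗ[ℝ] ℝ} (hw : w ∈ normalCone Q.permutohedron (Q.permVertex x))
    {k : ℕ} (hk : k < n) {p p' : Fin (n + 2) → ℝ} (hp : p ∈ simplex n)
    (hp' : p' ∈ segment ℝ (Q.pathPt (toggled Q.Up x k) (Q.φ p).1)
      (Q.pathPt (toggled Q.Up x (k + 1)) (Q.φ p).1)) (h : Q.φ p' = Q.φ p) : w p ≤ w p' := by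
  obtain ⟨β, h1, h2⟩ := exists_slope hn hw hk
  have key : ∀ H : Set (Fin n), w - β • Q.heightMap ∈ normalCone Q.cube (Q.cubeVertex H) →
      (w - β • Q.heightMap) p ≤ (w - β • Q.heightMap) (Q.pathPt H (Q.φ p).1) := by
    intro H hH
    rw [cubeVertex_eq, cube, ← image_simplex_interval] at hH
    have hs := isSection_pathPt (Q := Q) H
    refine le_of_mem_normalCone isBase_image_simplex isBounded_simplex convex_simplex ?_ hs.mem
      hs.map_eq hH hp
    rw [image_simplex_interval]
    exact continuousOn_pathPt H
  have hh : Q.heightMap p' = Q.heightMap p := congrArg Prod.snd h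
  have h3 := key _ h1
  have h4 := key _ h2
  have h5 : (w - β • Q.heightMap) p ≤ (w - β • Q.heightMap) p' := by
    obtain ⟨r, r', hr, hr', hrr, rfl⟩ := hp'
    rw [map_add, map_smul, map_smul, smul_eq_mul, smul_eq_mul]
    calc (w - β • Q.heightMap) p
        = r * (w - β • Q.heightMap) p + r' * (w - β • Q.heightMap) p := by
          rw [← add_mul, hrr, one_mul]
      _ ≤ _ := add_le_add (mul_le_mul_of_nonneg_left h3 hr) (mul_le_mul_of_nonneg_left h4 hr')
  simp only [LinearMap.sub_apply, LinearMap.smul_apply, hh] at h5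
  linarith

end MonotonePath

end CambrianPolygon

/-! ### The normal cone of a permutation lies in the normal cone of its triangulation -/

namespace CambrianPolygon

section Sufficiency

variable {n : ℕ} {Q : CambrianPolygon n}

theorem exists_mem_segment_pathPt {H H' : Set (Fin n)} {q : ℝ × ℝ} (hq : q.1 ∈ Q.interval)
    (h1 : Q.pathHt H q.1 ≤ q.2) (h2 : q.2 ≤ Q.pathHt H' q.1) :
    ∃ p ∈ segment ℝ (Q.pathPt H q.1) (Q.pathPt H' q.1), Q.φ p = q := by
  have hseg : q ∈ segment ℝ (Q.φ (Q.pathPt H q.1)) (Q.φ (Q.pathPt H' q.1)) := by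
    rw [φ_pathPt hq, φ_pathPt hq, ← Prod.image_mk_segment_right]
    refine ⟨q.2, ?_, rfl⟩
    rw [segment_eq_Icc (h1.trans h2)]
    exact ⟨h1, h2⟩
  obtain ⟨s, r, hs, hr, hsr, he⟩ := hseg
  rw [← map_smul, ← map_smul, ← map_add] at he
  exact ⟨_, ⟨s, r, hs, hr, hsr, rfl⟩, he⟩

/-- The left half of the open triangle of a permutation. -/
theorem exists_isOpen_triangle {x : Equiv.Perm (Fin n)} {b : Fin n} {i j : Fin (n + 2)}
    (hs : IsStep Q.Up x b i j) : ∃ O : Set (ℝ × ℝ), IsOpen O ∧ O.Nonempty ∧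
      O ⊆ Q.φ '' simplex n ∧ ∀ q ∈ O, Q.a i < q.1 ∧ q.1 < Q.a (inner b) ∧
        Q.pathHt (toggled Q.Up x (x.symm b)) q.1 < q.2 ∧
        q.2 < Q.pathHt (toggled Q.Up x (x.symm b + 1)) q.1 := by
  have hib := hs.left_lt
  have hbj := hs.lt_right
  have hm := Q.a_strictMono.monotone
  obtain ⟨c, d, hcd⟩ : ∃ c d, ∀ t, Q.a i ≤ t → t ≤ Q.a (inner b) →
      Q.pathHt (toggled Q.Up x (x.symm b)) t = Q.ht c t ∧
      Q.pathHt (toggled Q.Up x (x.symm b + 1)) t = Q.ht d t := by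
    by_cases hU : Q.Up b
    · exact ⟨(i, j), (i, inner b), fun t h1 h2 =>
        ⟨pathHt_eq (hs.long_mem_of_up hU) h1 (h2.trans (hm hbj.le)),
          pathHt_eq (hs.left_mem_of_up hU) h1 h2⟩⟩
    · exact ⟨(i, inner b), (i, j), fun t h1 h2 =>
        ⟨pathHt_eq (hs.left_mem_of_down hU) h1 h2,
          pathHt_eq (hs.long_mem_of_down hU) h1 (h2.trans (hm hbj.le))⟩⟩
  refine ⟨{q | Q.a i < q.1 ∧ q.1 < Q.a (inner b) ∧ Q.ht c q.1 < q.2 ∧ q.2 < Q.ht d q.1},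
    ?_, ?_, ?_, ?_⟩
  · have hc := continuous_ht (Q := Q) c
    have hd := continuous_ht (Q := Q) d
    exact (isOpen_lt continuous_const continuous_fst).inter
      ((isOpen_lt continuous_fst continuous_const).inter
        ((isOpen_lt (hc.comp continuous_fst) continuous_snd).inter
          (isOpen_lt continuous_snd (hd.comp continuous_fst))))
  · obtain ⟨t, h1, h2⟩ := exists_between (Q.a_strictMono hib)
    have h3 := pathHt_lt hs h1 h2
    rw [(hcd t h1.le h2.le).1, (hcd t h1.le h2.le).2] at h3
    obtain ⟨s, h4, h5⟩ := exists_between h3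
    exact ⟨(t, s), h1, h2, h4, h5⟩
  · rintro q ⟨h1, h2, h3, h4⟩
    have hq : q.1 ∈ Q.interval := mem_interval.2
      ⟨(hm (Fin.zero_le i)).trans h1.le, h2.le.trans (hm (Fin.le_last _))⟩
    rw [← (hcd _ h1.le h2.le).1] at h3
    rw [← (hcd _ h1.le h2.le).2] at h4
    obtain ⟨p, hp, he⟩ := exists_mem_segment_pathPt hq h3.le h4.le
    exact ⟨p, convex_simplex.segment_subset (pathPt_mem hq) (pathPt_mem hq) hp, he⟩
  · rintro q ⟨h1, h2, h3, h4⟩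
    rw [(hcd _ h1.le h2.le).1, (hcd _ h1.le h2.le).2]
    exact ⟨h1, h2, h3, h4⟩

variable (Q) in
/-- The polygon. -/
def polygon : Set (ℝ × ℝ) := Q.φ '' simplex n

theorem isCompact_polygon : IsCompact Q.polygon :=
  (isCompact_stdSimplex ℝ _).image (LinearMap.continuous_of_finiteDimensional _)

theorem exists_isOpen_subset (hn : 1 ≤ n) : ∃ O : Set (ℝ × ℝ), IsOpen O ∧ O.Nonempty ∧
    O ⊆ Q.polygon := by
  obtain ⟨i, j, hs⟩ := exists_isStep Q.Up 1 ⟨0, hn⟩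
  obtain ⟨O, h1, h2, h3, -⟩ := exists_isOpen_triangle hs
  exact ⟨O, h1, h2, h3⟩

theorem baseVolume_polygon (hn : 1 ≤ n) :
    baseVolume Q.polygon = (volume : Measure (ℝ × ℝ)).restrict Q.polygon := by
  obtain ⟨O, h1, h2, h3⟩ := exists_isOpen_subset (Q := Q) hn
  have hspan : vectorSpan ℝ Q.polygon = ⊤ := by
    have := (affineSpan_mono ℝ h3)
    rw [h1.affineSpan_eq_top h2, top_le_iff] at this
    rw [← direction_affineSpan, this, AffineSubspace.direction_top]
  have h2 : Module.finrank ℝ (ℝ × ℝ) = 2 := by simp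
  rw [baseVolume, hspan, finrank_top, h2, ← hausdorffMeasure_prod_real]
  norm_num

theorem isBase_polygon (hn : 1 ≤ n) : IsBase Q.polygon := by
  obtain ⟨O, h1, h2, h3⟩ := exists_isOpen_subset (Q := Q) hn
  refine ⟨isCompact_polygon, ?_, ?_⟩ <;>
    rw [baseVolume_polygon hn, Measure.restrict_apply_univ]
  · exact ((h1.measure_pos volume h2).trans_le (measure_mono h3)).ne'
  · exact isCompact_polygon.measure_lt_top.ne

theorem isOpen_generic : IsOpen {q | Q.Generic q} := by
  have : {q | Q.Generic q} = (⋂ m, {q : ℝ × ℝ | q.1 ≠ Q.a m}) ∩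
      ⋂ c : Fin (n + 2) × Fin (n + 2), ⋂ _ : c.1 < c.2, {q : ℝ × ℝ | q.2 ≠ Q.ht c q.1} := by
    ext q
    simp only [Set.mem_inter_iff, Set.mem_iInter, Set.mem_ofPred_eq]
    exact ⟨fun h => ⟨h.1, h.2⟩, fun h => ⟨h.1, h.2⟩⟩
  rw [this]
  refine (isOpen_iInter_of_finite fun m => isOpen_ne_fun continuous_fst continuous_const).inter
    (isOpen_iInter_of_finite fun c => isOpen_iInter_of_finite fun _ =>
      isOpen_ne_fun continuous_snd ((continuous_ht c).comp continuous_fst))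

theorem ae_generic : ∀ᵐ q ∂(volume : Measure (ℝ × ℝ)), Q.Generic q := by
  have h1 : ∀ m, ∀ᵐ q ∂(volume : Measure (ℝ × ℝ)), q.1 ≠ Q.a m := by
    intro m
    rw [ae_iff]
    have : {q : ℝ × ℝ | ¬ q.1 ≠ Q.a m} = {Q.a m} ×ˢ Set.univ := by
      ext q
      simp
    rw [this, Measure.volume_eq_prod, Measure.prod_prod, Real.volume_singleton, zero_mul]
  have h2 : ∀ c : Fin (n + 2) × Fin (n + 2), ∀ᵐ q ∂(volume : Measure (ℝ × ℝ)),
      c.1 < c.2 → q.2 ≠ Q.ht c q.1 := by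
    intro c
    have hm : MeasurableSet {q : ℝ × ℝ | ¬ q.2 ≠ Q.ht c q.1} := by
      simp only [ne_eq, not_not]
      exact (isClosed_eq continuous_snd ((continuous_ht c).comp continuous_fst)).measurableSet
    have : ∀ᵐ q ∂(volume : Measure (ℝ × ℝ)), q.2 ≠ Q.ht c q.1 := by
      rw [ae_iff, Measure.volume_eq_prod, Measure.measure_prod_null hm]
      refine Filter.Eventually.of_forall fun t => ?_
      have : Prod.mk t ⁻¹' {q : ℝ × ℝ | ¬ q.2 ≠ Q.ht c q.1} = {Q.ht c t} := by
        ext s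
        simp
      exact (congrArg volume this).trans Real.volume_singleton
    filter_upwards [this] with q hq _ using hq
  filter_upwards [ae_all_iff.2 h1, ae_all_iff.2 h2] with q hq1 hq2 using ⟨hq1, hq2⟩

theorem ae_generic_polygon (hn : 1 ≤ n) :
    ∀ᵐ q ∂(unitVolume Q.polygon), q ∈ Q.polygon ∧ Q.Generic q := by
  have h : ∀ᵐ q ∂(unitVolume Q.polygon), Q.Generic q := by
    rw [(isBase_polygon hn).ae_iff, baseVolume_polygon hn]
    exact ae_restrict_of_ae ae_generic
  filter_upwards [h, (isBase_polygon hn).ae_mem] with q h1 h2 using ⟨h2, h1⟩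

variable {T : Q.Triangulation}

/-- The section with values in the lift of a triangulation. -/
noncomputable def Triangulation.liftSection (T : Q.Triangulation) : ℝ × ℝ → Fin (n + 2) → ℝ :=
  Function.invFunOn Q.φ T.lift

theorem liftSection_mem (hn : 1 ≤ n) {q : ℝ × ℝ} (hq : q ∈ Q.polygon) :
    T.liftSection q ∈ T.lift ∧ Q.φ (T.liftSection q) = q := by
  have hex : ∃ p ∈ T.lift, Q.φ p = q := (image_lift hn T).ge hq
  exact ⟨Function.invFunOn_mem hex, Function.invFunOn_eq hex⟩

theorem isSection_liftSection (hn : 1 ≤ n) (T : Q.Triangulation) :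
    IsSection Q.φ (simplex n) T.liftSection := by
  refine ⟨?_, fun q hq => lift_subset_simplex T (liftSection_mem hn hq).1,
    fun q hq => (liftSection_mem hn hq).2⟩
  have hG : MeasurableSet (Q.polygon ∩ {q | Q.Generic q}) :=
    (isBase_polygon hn).measurableSet.inter isOpen_generic.measurableSet
  have hae : ∀ᵐ q ∂(baseVolume Q.polygon), q ∈ Q.polygon ∩ {q | Q.Generic q} :=
    (isBase_polygon hn).ae_iff.1 (ae_generic_polygon hn)
  change AEStronglyMeasurable _ (baseVolume Q.polygon)
  rw [← Measure.restrict_eq_self_of_ae_mem hae]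
  refine ContinuousOn.aestronglyMeasurable ?_ hG
  refine continuousOn_invFunOn (LinearMap.continuous_of_finiteDimensional _) (isCompact_lift T)
    (fun q hq => (image_lift hn T).ge hq.1) fun q hq p hp p' hp' h h' => ?_
  exact lift_unique hp hp' (h.trans h'.symm) (h.symm ▸ hq.2)

theorem integrable_liftSection (hn : 1 ≤ n) (T : Q.Triangulation) :
    Integrable T.liftSection (unitVolume Q.polygon) :=
  (isSection_liftSection hn T).integrable (isBase_polygon hn) isBounded_simplex

theorem triangulation_vertex_eq (hn : 1 ≤ n) (T : Q.Triangulation) :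
    T.vertex = ∫ q, T.liftSection q ∂(unitVolume Q.polygon) := by
  rw [Triangulation.vertex, sectionAverage, image_lift hn]
  rfl

/-- A generic point of the polygon is strictly between two consecutive paths of a permutation. -/
theorem exists_pathHt_lt_lt (hn : 1 ≤ n) (x : Equiv.Perm (Fin n)) {q : ℝ × ℝ}
    (hq : q ∈ Q.polygon) (hg : Q.Generic q) : ∃ k < n,
      Q.pathHt (toggled Q.Up x k) q.1 < q.2 ∧ q.2 < Q.pathHt (toggled Q.Up x (k + 1)) q.1 := by
  obtain ⟨p, hp, rfl⟩ := hq
  have hne : ∀ H : Set (Fin n), (Q.φ p).2 ≠ Q.pathHt H (Q.φ p).1 := by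
    intro H
    obtain ⟨c, hc, h1, h2⟩ := exists_step_over H (φ_fst_mem_interval (Q := Q) hp)
    rw [pathHt_eq hc h1 h2]
    exact hg.snd_ne c (mem_steps.1 hc).2.2.1
  obtain ⟨k, hk, h1, h2⟩ := exists_le_le_succ
    (y := fun k => Q.pathHt (toggled Q.Up x k) (Q.φ p).1) (pathHt_zero_le x hp) hn
    (le_pathHt_last x hp)
  exact ⟨k, hk, lt_of_le_of_ne h1 (hne _).symm, lt_of_le_of_ne h2 (hne _)⟩

theorem φ_fst_of_mem_polygon {q : ℝ × ℝ} (hq : q ∈ Q.polygon) : q.1 ∈ Q.interval := by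
  obtain ⟨p, hp, rfl⟩ := hq
  exact φ_fst_mem_interval hp

/-- Between two consecutive paths, the section of the triangulation of a permutation interpolates
between the paths of edges. -/
theorem liftSection_mem_segment (hn : 1 ≤ n) (x : Equiv.Perm (Fin n)) {q : ℝ × ℝ}
    (hq : q ∈ Q.polygon) (hg : Q.Generic q) {k : ℕ} (hk : k < n)
    (h1 : Q.pathHt (toggled Q.Up x k) q.1 < q.2)
    (h2 : q.2 < Q.pathHt (toggled Q.Up x (k + 1)) q.1) :
    (Q.permTriangulation x).liftSection q ∈ segment ℝ (Q.pathPt (toggled Q.Up x k) q.1)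
      (Q.pathPt (toggled Q.Up x (k + 1)) q.1) := by
  have hqi := φ_fst_of_mem_polygon hq
  obtain ⟨p, hp, he⟩ := exists_mem_segment_pathPt hqi h1.le h2.le
  obtain ⟨b, rfl⟩ : ∃ b, (x.symm b : ℕ) = k := ⟨x ⟨k, hk⟩, by simp⟩
  obtain ⟨i, j, hs⟩ := exists_isStep Q.Up x b
  obtain ⟨h3, h4⟩ := mem_strip_of_pathHt_lt hs hqi (h1.trans h2)
  obtain ⟨f1, f2⟩ := pathPt_mem_face hs h3 h4
  have hlift : p ∈ (Q.permTriangulation x).lift := by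
    simp only [Triangulation.lift, Set.mem_iUnion]
    exact ⟨i, inner b, j, hs.chords_mem, (convex_convexHull ℝ _).segment_subset f1 f2 hp⟩
  obtain ⟨l1, l2⟩ := liftSection_mem (T := Q.permTriangulation x) hn hq
  rw [lift_unique l1 hlift (l2.trans he.symm) (l2.symm ▸ hg)]
  exact hp

theorem le_liftSection (hn : 1 ≤ n) {x : Equiv.Perm (Fin n)} {w : (Fin (n + 2) → ℝ) →ₗ[ℝ] ℝ}
    (hw : w ∈ normalCone Q.permutohedron (Q.permVertex x)) {p : Fin (n + 2) → ℝ}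
    (hp : p ∈ simplex n) (hg : Q.Generic (Q.φ p)) :
    w p ≤ w ((Q.permTriangulation x).liftSection (Q.φ p)) := by
  have hq : Q.φ p ∈ Q.polygon := ⟨p, hp, rfl⟩
  obtain ⟨k, hk, h1, h2⟩ := exists_pathHt_lt_lt hn x hq hg
  exact le_of_mem_segment_pathPt hn hw hk hp (liftSection_mem_segment hn x hq hg hk h1 h2)
    (liftSection_mem hn hq).2

theorem normalCone_subset (hn : 1 ≤ n) (x : Equiv.Perm (Fin n)) :
    normalCone Q.permutohedron (Q.permVertex x) ⊆
      normalCone Q.associahedron (Q.permTriangulation x).vertex := by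
  intro w hw
  rw [triangulation_vertex_eq hn]
  refine mem_normalCone_of_ae_le (isBase_polygon hn) isBounded_simplex
    (integrable_liftSection hn _) ?_
  filter_upwards [ae_generic_polygon hn] with q hq p hp h
  subst h
  exact le_liftSection hn hw hp hq.2

/-- If the normal cone of a permutation is contained in the normal cone of a triangulation, then
the functionals in the normal cone do not distinguish the triangulation from the one of the
permutation. -/
theorem ae_eq_liftSection (hn : 1 ≤ n) {x : Equiv.Perm (Fin n)} {w : (Fin (n + 2) → ℝ) →ₗ[ℝ] ℝ}
    (hw : w ∈ normalCone Q.permutohedron (Q.permVertex x))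
    (hT : w ∈ normalCone Q.associahedron T.vertex) :
    ∀ᵐ q ∂(unitVolume Q.polygon),
      w (T.liftSection q) = w ((Q.permTriangulation x).liftSection q) := by
  rw [triangulation_vertex_eq hn] at hT
  refine ae_eq_of_mem_normalCone (isBase_polygon hn) isBounded_simplex
    (integrable_liftSection hn _) (isSection_liftSection hn _) hT ?_
  filter_upwards [ae_generic_polygon hn] with q hq
  obtain ⟨h1, h2⟩ := liftSection_mem (T := T) hn hq.1
  have h3 := le_liftSection hn hw (lift_subset_simplex T h1) (h2.symm ▸ hq.2)
  rwa [h2] at h3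

end Sufficiency

end CambrianPolygon

/-! ### Functionals in the normal cone of a permutation -/

namespace CambrianPolygon

section Hinge

variable {n : ℕ} {Q : CambrianPolygon n}

/-- The convex function that is `0` up to `c` and has slope `1` from there on. -/
def hinge (c t : ℝ) : ℝ := max 0 (t - c)

theorem hinge_of_le {c t : ℝ} (h : t ≤ c) : hinge c t = 0 := max_eq_left (by linarith)

theorem hinge_of_ge {c t : ℝ} (h : c ≤ t) : hinge c t = t - c := max_eq_right (by linarith)

theorem hinge_nonneg (c t : ℝ) : 0 ≤ hinge c t := le_max_left _ _

theorem sub_le_hinge (c t : ℝ) : t - c ≤ hinge c t := le_max_right _ _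

theorem continuous_hinge (c : ℝ) : Continuous (hinge c) := by
  unfold hinge
  fun_prop

variable (Q) in
/-- The defect in Jensen's inequality for the hinge at the vertex `b`. -/
noncomputable def gap (b : Fin n) (p : Fin (n + 2) → ℝ) : ℝ :=
  ∑ m, p m * hinge (Q.a (inner b)) (Q.a m) - hinge (Q.a (inner b)) (Q.φ p).1

theorem sum_mul_sub {p : Fin (n + 2) → ℝ} (hp : ∑ m, p m = 1) (c : ℝ) :
    ∑ m, p m * (Q.a m - c) = (Q.φ p).1 - c := by
  simp_rw [mul_sub, Finset.sum_sub_distrib, ← Finset.sum_mul, hp, φ_fst, one_mul]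

theorem gap_nonneg {p : Fin (n + 2) → ℝ} (hp : p ∈ simplex n) (b : Fin n) : 0 ≤ Q.gap b p := by
  refine sub_nonneg.2 (max_le ?_ ?_)
  · exact Finset.sum_nonneg fun m _ => mul_nonneg (hp.1 m) (hinge_nonneg _ _)
  · rw [← sum_mul_sub hp.2]
    exact Finset.sum_le_sum fun m _ => mul_le_mul_of_nonneg_left (sub_le_hinge _ _) (hp.1 m)

theorem gap_eq_zero_of_le {p : Fin (n + 2) → ℝ} (hp : p ∈ simplex n) {b : Fin n}
    (h : ∀ m, p m ≠ 0 → m ≤ inner b) : Q.gap b p = 0 := by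
  have h1 : ∑ m, p m * hinge (Q.a (inner b)) (Q.a m) = 0 := by
    refine Finset.sum_eq_zero fun m _ => ?_
    by_cases hm : p m = 0
    · rw [hm, zero_mul]
    · rw [hinge_of_le (Q.a_strictMono.monotone (h m hm)), mul_zero]
  refine le_antisymm ?_ (gap_nonneg hp b)
  rw [gap, h1, zero_sub]
  exact neg_nonpos.2 (hinge_nonneg _ _)

theorem gap_eq_zero_of_ge {p : Fin (n + 2) → ℝ} (hp : p ∈ simplex n) {b : Fin n}
    (h : ∀ m, p m ≠ 0 → inner b ≤ m) : Q.gap b p = 0 := by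
  have h1 : ∑ m, p m * hinge (Q.a (inner b)) (Q.a m) = (Q.φ p).1 - Q.a (inner b) := by
    rw [← sum_mul_sub hp.2]
    refine Finset.sum_congr rfl fun m _ => ?_
    by_cases hm : p m = 0
    · rw [hm, zero_mul, zero_mul]
    · rw [hinge_of_ge (Q.a_strictMono.monotone (h m hm))]
  refine le_antisymm ?_ (gap_nonneg hp b)
  rw [gap, h1]
  exact sub_nonpos.2 (sub_le_hinge _ _)

theorem le_of_gap_eq_zero {p : Fin (n + 2) → ℝ} (hp : p ∈ simplex n) {b : Fin n}
    (h : Q.gap b p = 0) (hb : (Q.φ p).1 < Q.a (inner b)) {m : Fin (n + 2)} (hm : p m ≠ 0) :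
    m ≤ inner b := by
  rw [gap, hinge_of_le hb.le, sub_zero, Finset.sum_eq_zero_iff_of_nonneg
    fun m _ => mul_nonneg (hp.1 m) (hinge_nonneg _ _)] at h
  have h1 := (mul_eq_zero.1 (h m (Finset.mem_univ m))).resolve_left hm
  have h2 := sub_le_hinge (Q.a (inner b)) (Q.a m)
  exact Q.a_strictMono.le_iff_le.1 (by linarith)

theorem ge_of_gap_eq_zero {p : Fin (n + 2) → ℝ} (hp : p ∈ simplex n) {b : Fin n}
    (h : Q.gap b p = 0) (hb : Q.a (inner b) < (Q.φ p).1) {m : Fin (n + 2)} (hm : p m ≠ 0) :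
    inner b ≤ m := by
  rw [gap, hinge_of_ge hb.le, ← sum_mul_sub hp.2, ← Finset.sum_sub_distrib] at h
  simp_rw [← mul_sub] at h
  rw [Finset.sum_eq_zero_iff_of_nonneg
    fun m _ => mul_nonneg (hp.1 m) (sub_nonneg.2 (sub_le_hinge _ _))] at h
  have h1 := (mul_eq_zero.1 (h m (Finset.mem_univ m))).resolve_left hm
  have h2 := hinge_nonneg (Q.a (inner b)) (Q.a m)
  exact Q.a_strictMono.le_iff_le.1 (by linarith)

/-- The step of a path over the strip between `m` and `m + 1`. -/
noncomputable def stepAt (H : Set (Fin n)) (m : Fin (n + 1)) : Fin (n + 2) × Fin (n + 2) :=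
  (exists_step H (Fin.castSucc_lt_succ (i := m))).choose

theorem stepAt_spec (H : Set (Fin n)) (m : Fin (n + 1)) : stepAt H m ∈ steps H ∧
    (stepAt H m).1 ≤ m.castSucc ∧ m.succ ≤ (stepAt H m).2 := by
  have h := (exists_step H (Fin.castSucc_lt_succ (i := m))).choose_spec
  exact ⟨h.1, h.2.1, Fin.castSucc_lt_iff_succ_le.1 h.2.2⟩

theorem pathHt_eq_stepAt (H : Set (Fin n)) {m : Fin (n + 1)} {t : ℝ} (h1 : Q.a m.castSucc ≤ t)
    (h2 : t ≤ Q.a m.succ) : Q.pathHt H t = Q.ht (stepAt H m) t := by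
  obtain ⟨s1, s2, s3⟩ := stepAt_spec H m
  have hm := Q.a_strictMono.monotone
  exact pathHt_eq s1 ((hm s2).trans h1) (h2.trans (hm s3))

variable (Q) in
/-- The change of slope at the vertex `b` of a path. -/
noncomputable def kink (H : Set (Fin n)) (b : Fin n) : ℝ :=
  Q.slope (stepAt H b.succ) - Q.slope (stepAt H b.castSucc)

theorem ht_sub_ht (c d : Fin (n + 2) × Fin (n + 2)) (t t' : ℝ) : Q.ht d t - Q.ht c t =
    Q.ht d t' - Q.ht c t' + (Q.slope d - Q.slope c) * (t - t') := by
  simp only [ht]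
  ring

theorem ht_stepAt_sub (H : Set (Fin n)) (b : Fin n) (t : ℝ) :
    Q.ht (stepAt H b.succ) t - Q.ht (stepAt H b.castSucc) t =
      Q.kink H b * (t - Q.a (inner b)) := by
  have hm := Q.a_strictMono.monotone
  have h1 := pathHt_eq_stepAt (Q := Q) H (m := b.succ) (t := Q.a (inner b)) le_rfl
    (hm (Fin.castSucc_lt_succ).le)
  have h2 := pathHt_eq_stepAt (Q := Q) H (m := b.castSucc) (t := Q.a (inner b))
    (hm (by simp [inner, Fin.le_def])) le_rfl
  rw [ht_sub_ht _ _ t (Q.a (inner b)), ← h1, ← h2, sub_self, zero_add, kink]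

theorem kink_of_not_mem {H : Set (Fin n)} {b : Fin n} (hb : b ∉ H) : Q.kink H b = 0 := by
  obtain ⟨c1, c2, c3⟩ := stepAt_spec H b.castSucc
  obtain ⟨d1, d2, d3⟩ := stepAt_spec H b.succ
  have hb' : inner b ∉ verts H := fun h => hb (inner_mem_verts.1 h)
  have h1 : inner b < (stepAt H b.castSucc).2 :=
    lt_of_le_of_ne c3 fun h => hb' (h ▸ (mem_steps.1 c1).2.1)
  have h2 : (stepAt H b.succ).1 < inner b :=
    lt_of_le_of_ne d2 fun h => hb' (h ▸ (mem_steps.1 d1).1)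
  have h3 : stepAt H b.castSucc = stepAt H b.succ := by
    refine steps_eq_of_overlap c1 d1 (c2.trans_lt (lt_of_lt_of_le ?_ d3)) (h2.trans h1)
    simp [Fin.lt_def]
  rw [kink, h3, sub_self]

theorem kink_of_mem {H : Set (Fin n)} {b : Fin n} (hb : b ∈ H) :
    (Q.Up b → Q.kink H b < 0) ∧ (¬ Q.Up b → 0 < Q.kink H b) := by
  obtain ⟨c1, c2, c3⟩ := stepAt_spec H b.castSucc
  obtain ⟨d1, d2, d3⟩ := stepAt_spec H b.succ
  have hb' : inner b ∈ verts H := inner_mem_verts.2 hb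
  have hcb : (stepAt H b.castSucc).1 < inner b := c2.trans_lt (by simp [Fin.lt_def, inner])
  have hbd : inner b < (stepAt H b.succ).2 := lt_of_lt_of_le Fin.castSucc_lt_succ d3
  have h1 : (stepAt H b.castSucc).2 = inner b := by
    refine le_antisymm (not_lt.1 fun h => ?_) c3
    exact (mem_steps.1 c1).2.2.2 _ hb' ⟨hcb, h⟩
  have h2 : (stepAt H b.succ).1 = inner b := by
    refine le_antisymm d2 (not_lt.1 fun h => ?_)
    exact (mem_steps.1 d1).2.2.2 _ hb' ⟨h, hbd⟩
  obtain ⟨h3, h4⟩ := f_lt_ht_right (Q := Q) hcb hbd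
  have h5 := ht_stepAt_sub (Q := Q) H b (Q.a (stepAt H b.succ).2)
  rw [ht_right (mem_steps.1 d1).2.2.1] at h5
  have h6 : ((stepAt H b.castSucc).1, inner b) = stepAt H b.castSucc := Prod.ext rfl h1.symm
  rw [h6] at h3 h4
  have h7 := sub_pos.2 (Q.a_strictMono hbd)
  constructor
  · intro hU
    have := h3 hU
    exact neg_of_mul_neg_left (by linarith) h7.le
  · intro hU
    have := h4 hU
    exact pos_of_mul_pos_left (by linarith) h7.le

theorem ht_stepAt_eq_sum (H : Set (Fin n)) (t : ℝ) (m : Fin (n + 1)) :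
    Q.ht (stepAt H m) t = Q.ht (stepAt H 0) t +
      ∑ b : Fin n, if b.castSucc < m then Q.kink H b * (t - Q.a (inner b)) else 0 := by
  induction m using Fin.induction with
  | zero => simp
  | succ m ih =>
    have h : ∀ b : Fin n, (if b.castSucc < m.succ then Q.kink H b * (t - Q.a (inner b)) else 0) =
        (if b.castSucc < m.castSucc then Q.kink H b * (t - Q.a (inner b)) else 0) +
          if b = m then Q.kink H b * (t - Q.a (inner b)) else 0 := by
      intro b
      rcases lt_trichotomy b m with h | rfl | h
      · rw [if_pos (Fin.castSucc_lt_succ_iff.2 h.le), if_pos (Fin.castSucc_lt_castSucc_iff.2 h),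
          if_neg h.ne, add_zero]
      · rw [if_pos Fin.castSucc_lt_succ, if_neg (lt_irrefl _), if_pos rfl, zero_add]
      · rw [if_neg (fun h' => (Fin.castSucc_lt_succ_iff.1 h').not_gt h),
          if_neg (fun h' => (Fin.castSucc_lt_castSucc_iff.1 h').not_gt h), if_neg h.ne', add_zero]
    simp_rw [h, Finset.sum_add_distrib]
    rw [← add_assoc, ← ih, Finset.sum_ite_eq' Finset.univ m, if_pos (Finset.mem_univ m),
      ← ht_stepAt_sub]
    ring

/-- A path is the sum of a linear function and of its kinks. -/
theorem pathHt_eq_sum (H : Set (Fin n)) {t : ℝ} (ht : t ∈ Q.interval) :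
    Q.pathHt H t = Q.ht (stepAt H 0) t + ∑ b, Q.kink H b * hinge (Q.a (inner b)) t := by
  obtain ⟨m, h1, h2⟩ := exists_strip (mem_interval.1 ht).1 (mem_interval.1 ht).2
  rw [pathHt_eq_stepAt H h1 h2, ht_stepAt_eq_sum]
  congr 1
  refine Finset.sum_congr rfl fun b _ => ?_
  have hm := Q.a_strictMono.monotone
  split_ifs with h
  · have : inner b ≤ m.castSucc := by
      simp only [Fin.lt_def, Fin.le_def, inner, Fin.val_castSucc, Fin.val_succ] at h ⊢
      omega
    rw [hinge_of_ge ((hm this).trans h1)]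
  · have : m.succ ≤ inner b := by
      simp only [Fin.lt_def, Fin.le_def, inner, Fin.val_castSucc, Fin.val_succ] at h ⊢
      omega
    rw [hinge_of_le (h2.trans (hm this)), mul_zero]

open Classical in
variable (Q) in
/-- The concave part of a path: its kinks at upper vertices. -/
noncomputable def capPart (H : Set (Fin n)) (t : ℝ) : ℝ :=
  ∑ b, (if Q.Up b then Q.kink H b else 0) * hinge (Q.a (inner b)) t

open Classical in
variable (Q) in
/-- The convex part of a path: its kinks at lower vertices and a linear function. -/
noncomputable def cupPart (H : Set (Fin n)) (t : ℝ) : ℝ :=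
  Q.ht (stepAt H 0) t + ∑ b, (if Q.Up b then 0 else Q.kink H b) * hinge (Q.a (inner b)) t

theorem capPart_add_cupPart (H : Set (Fin n)) {t : ℝ} (ht : t ∈ Q.interval) :
    Q.capPart H t + Q.cupPart H t = Q.pathHt H t := by
  rw [pathHt_eq_sum H ht, capPart, cupPart, add_left_comm, ← Finset.sum_add_distrib]
  congr 1
  refine Finset.sum_congr rfl fun b _ => ?_
  split_ifs <;> ring

theorem continuous_capPart (H : Set (Fin n)) : Continuous (Q.capPart H) := by
  unfold capPart
  exact continuous_finsetSum _ fun b _ => continuous_const.mul (continuous_hinge _)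

theorem continuous_cupPart (H : Set (Fin n)) : Continuous (Q.cupPart H) := by
  unfold cupPart
  exact (continuous_ht _).add
    (continuous_finsetSum _ fun b _ => continuous_const.mul (continuous_hinge _))

theorem sum_mul_sum_hinge (p : Fin (n + 2) → ℝ) (g : Fin n → ℝ) :
    ∑ m, p m * ∑ b, g b * hinge (Q.a (inner b)) (Q.a m) =
      ∑ b, g b * hinge (Q.a (inner b)) (Q.φ p).1 + ∑ b, g b * Q.gap b p := by
  simp_rw [Finset.mul_sum, gap]
  rw [Finset.sum_comm, ← Finset.sum_add_distrib]
  refine Finset.sum_congr rfl fun b _ => ?_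
  rw [← mul_add, add_sub_cancel, Finset.mul_sum]
  exact Finset.sum_congr rfl fun m _ => by ring

open Classical in
theorem sum_mul_capPart (H : Set (Fin n)) (p : Fin (n + 2) → ℝ) :
    ∑ m, p m * Q.capPart H (Q.a m) = Q.capPart H (Q.φ p).1 +
      ∑ b, (if Q.Up b then Q.kink H b else 0) * Q.gap b p :=
  sum_mul_sum_hinge p _

open Classical in
theorem sum_mul_cupPart (H : Set (Fin n)) {p : Fin (n + 2) → ℝ} (hp : p ∈ simplex n) :
    ∑ m, p m * Q.cupPart H (Q.a m) = Q.cupPart H (Q.φ p).1 +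
      ∑ b, (if Q.Up b then 0 else Q.kink H b) * Q.gap b p := by
  have h := φ_snd_sub_ht (Q := Q) hp.2 (stepAt H 0)
  simp_rw [mul_sub, Finset.sum_sub_distrib, ← φ_snd] at h
  simp_rw [cupPart, mul_add, Finset.sum_add_distrib]
  rw [sum_mul_sum_hinge]
  linarith

variable (Q) in
/-- The functional that lifts the vertices of the polygon to the concave function of `(t, s)` which
is the minimum of the concave part of a path at `t` and of the difference of `s` and the convex part
of the path at `t`; on the path, both expressions agree. -/
noncomputable def liftMap (H : Set (Fin n)) : (Fin (n + 2) → ℝ) →ₗ[ℝ] ℝ :=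
  Fintype.linearCombination ℝ fun m =>
    min (Q.capPart H (Q.a m)) (Q.f m - Q.cupPart H (Q.a m))

theorem liftMap_apply (H : Set (Fin n)) (p : Fin (n + 2) → ℝ) : Q.liftMap H p =
    ∑ m, p m * min (Q.capPart H (Q.a m)) (Q.f m - Q.cupPart H (Q.a m)) := rfl

open Classical in
theorem cap_sub_liftMap (H : Set (Fin n)) (p : Fin (n + 2) → ℝ) :
    Q.capPart H (Q.φ p).1 - Q.liftMap H p =
      ∑ m, p m * (Q.capPart H (Q.a m) -
        min (Q.capPart H (Q.a m)) (Q.f m - Q.cupPart H (Q.a m))) +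
      ∑ b, (-if Q.Up b then Q.kink H b else 0) * Q.gap b p := by
  simp_rw [mul_sub, Finset.sum_sub_distrib, neg_mul, Finset.sum_neg_distrib]
  rw [sum_mul_capPart, liftMap_apply]
  ring

open Classical in
theorem sub_cup_sub_liftMap (H : Set (Fin n)) {p : Fin (n + 2) → ℝ} (hp : p ∈ simplex n) :
    (Q.φ p).2 - Q.cupPart H (Q.φ p).1 - Q.liftMap H p =
      ∑ m, p m * (Q.f m - Q.cupPart H (Q.a m) -
        min (Q.capPart H (Q.a m)) (Q.f m - Q.cupPart H (Q.a m))) +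
      ∑ b, (if Q.Up b then 0 else Q.kink H b) * Q.gap b p := by
  simp_rw [mul_sub, Finset.sum_sub_distrib]
  rw [sum_mul_cupPart H hp, liftMap_apply, φ_snd]
  ring

theorem kink_nonpos {H : Set (Fin n)} {b : Fin n} (hb : Q.Up b) : Q.kink H b ≤ 0 := by
  by_cases h : b ∈ H
  · exact ((kink_of_mem h).1 hb).le
  · exact (kink_of_not_mem h).le

theorem kink_nonneg {H : Set (Fin n)} {b : Fin n} (hb : ¬ Q.Up b) : 0 ≤ Q.kink H b := by
  by_cases h : b ∈ H
  · exact ((kink_of_mem h).2 hb).le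
  · exact (kink_of_not_mem h).ge

theorem cap_term_nonneg (H : Set (Fin n)) {p : Fin (n + 2) → ℝ} (hp : p ∈ simplex n)
    (m : Fin (n + 2)) : 0 ≤ p m * (Q.capPart H (Q.a m) -
      min (Q.capPart H (Q.a m)) (Q.f m - Q.cupPart H (Q.a m))) :=
  mul_nonneg (hp.1 m) (sub_nonneg.2 (min_le_left _ _))

theorem cup_term_nonneg (H : Set (Fin n)) {p : Fin (n + 2) → ℝ} (hp : p ∈ simplex n)
    (m : Fin (n + 2)) : 0 ≤ p m * (Q.f m - Q.cupPart H (Q.a m) -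
      min (Q.capPart H (Q.a m)) (Q.f m - Q.cupPart H (Q.a m))) :=
  mul_nonneg (hp.1 m) (sub_nonneg.2 (min_le_right _ _))

open Classical in
theorem cap_gap_nonneg (H : Set (Fin n)) {p : Fin (n + 2) → ℝ} (hp : p ∈ simplex n)
    (b : Fin n) : 0 ≤ (-if Q.Up b then Q.kink H b else 0) * Q.gap b p := by
  refine mul_nonneg ?_ (gap_nonneg hp b)
  split_ifs with h
  · exact neg_nonneg.2 (kink_nonpos h)
  · simp

open Classical in
theorem cup_gap_nonneg (H : Set (Fin n)) {p : Fin (n + 2) → ℝ} (hp : p ∈ simplex n)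
    (b : Fin n) : 0 ≤ (if Q.Up b then 0 else Q.kink H b) * Q.gap b p := by
  refine mul_nonneg ?_ (gap_nonneg hp b)
  split_ifs with h
  · exact le_rfl
  · exact kink_nonneg h

theorem liftMap_le_cap (H : Set (Fin n)) {p : Fin (n + 2) → ℝ} (hp : p ∈ simplex n) :
    Q.liftMap H p ≤ Q.capPart H (Q.φ p).1 := by
  rw [← sub_nonneg, cap_sub_liftMap]
  exact add_nonneg (Finset.sum_nonneg fun m _ => cap_term_nonneg H hp m)
    (Finset.sum_nonneg fun b _ => cap_gap_nonneg H hp b)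

theorem liftMap_le_sub_cup (H : Set (Fin n)) {p : Fin (n + 2) → ℝ} (hp : p ∈ simplex n) :
    Q.liftMap H p ≤ (Q.φ p).2 - Q.cupPart H (Q.φ p).1 := by
  rw [← sub_nonneg, sub_cup_sub_liftMap H hp]
  exact add_nonneg (Finset.sum_nonneg fun m _ => cup_term_nonneg H hp m)
    (Finset.sum_nonneg fun b _ => cup_gap_nonneg H hp b)

theorem liftMap_eq_cap_iff (H : Set (Fin n)) {p : Fin (n + 2) → ℝ} (hp : p ∈ simplex n) :
    Q.liftMap H p = Q.capPart H (Q.φ p).1 ↔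
      (∀ m, p m ≠ 0 → Q.pathHt H (Q.a m) ≤ Q.f m) ∧ ∀ b, Q.Up b → b ∈ H → Q.gap b p = 0 := by
  rw [eq_comm, ← sub_eq_zero, cap_sub_liftMap, add_eq_zero_iff_of_nonneg
    (Finset.sum_nonneg fun m _ => cap_term_nonneg H hp m)
    (Finset.sum_nonneg fun b _ => cap_gap_nonneg H hp b),
    Finset.sum_eq_zero_iff_of_nonneg fun m _ => cap_term_nonneg H hp m,
    Finset.sum_eq_zero_iff_of_nonneg fun b _ => cap_gap_nonneg H hp b]
  refine and_congr (forall_congr' fun m => ?_) (forall_congr' fun b => ?_)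
  · simp only [Finset.mem_univ, true_implies, mul_eq_zero, or_iff_not_imp_left, sub_eq_zero]
    refine imp_congr_right fun _ => ?_
    rw [eq_comm, min_eq_left_iff, le_sub_iff_add_le, capPart_add_cupPart H (a_mem_interval m)]
  · simp only [Finset.mem_univ, true_implies, mul_eq_zero, neg_eq_zero]
    constructor
    · intro h hU hb
      rw [if_pos hU] at h
      exact h.resolve_left ((kink_of_mem hb).1 hU).ne
    · intro h
      split_ifs with hU
      · by_cases hb : b ∈ H
        · exact Or.inr (h hU hb)
        · exact Or.inl (kink_of_not_mem hb)
      · exact Or.inl rfl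

theorem liftMap_eq_sub_cup_iff (H : Set (Fin n)) {p : Fin (n + 2) → ℝ} (hp : p ∈ simplex n) :
    Q.liftMap H p = (Q.φ p).2 - Q.cupPart H (Q.φ p).1 ↔
      (∀ m, p m ≠ 0 → Q.f m ≤ Q.pathHt H (Q.a m)) ∧ ∀ b, ¬ Q.Up b → b ∈ H → Q.gap b p = 0 := by
  rw [eq_comm, ← sub_eq_zero, sub_cup_sub_liftMap H hp, add_eq_zero_iff_of_nonneg
    (Finset.sum_nonneg fun m _ => cup_term_nonneg H hp m)
    (Finset.sum_nonneg fun b _ => cup_gap_nonneg H hp b),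
    Finset.sum_eq_zero_iff_of_nonneg fun m _ => cup_term_nonneg H hp m,
    Finset.sum_eq_zero_iff_of_nonneg fun b _ => cup_gap_nonneg H hp b]
  refine and_congr (forall_congr' fun m => ?_) (forall_congr' fun b => ?_)
  · simp only [Finset.mem_univ, true_implies, mul_eq_zero, or_iff_not_imp_left, sub_eq_zero]
    refine imp_congr_right fun _ => ?_
    rw [eq_comm, min_eq_right_iff, sub_le_iff_le_add, capPart_add_cupPart H (a_mem_interval m)]
  · simp only [Finset.mem_univ, true_implies, mul_eq_zero]
    constructor
    · intro h hU hb
      rw [if_neg hU] at h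
      exact h.resolve_left ((kink_of_mem hb).2 hU).ne'
    · intro h
      split_ifs with hU
      · exact Or.inl rfl
      · by_cases hb : b ∈ H
        · exact Or.inr (h hU hb)
        · exact Or.inl (kink_of_not_mem hb)

end Hinge

end CambrianPolygon

/-! ### The triangulation is determined by the normal cone -/

namespace CambrianPolygon

section Uniqueness

variable {n : ℕ} {Q : CambrianPolygon n}

theorem pathPt_support {H : Set (Fin n)} {t : ℝ} (ht : t ∈ Q.interval) :
    ∃ c ∈ steps H, ∀ m, Q.pathPt H t m ≠ 0 → m = c.1 ∨ m = c.2 := by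
  obtain ⟨c, hc, h1, h2⟩ := exists_step_over H ht
  refine ⟨c, hc, fun m hm => ?_⟩
  rw [pathPt_eq hc h1 h2] at hm
  by_contra! hcon
  refine hm ?_
  simp [edgePt, e, Pi.single_eq_of_ne hcon.1, Pi.single_eq_of_ne hcon.2]

theorem pathHt_of_mem_verts {H : Set (Fin n)} {m : Fin (n + 2)} (hm : m ∈ verts H) :
    Q.pathHt H (Q.a m) = Q.f m := by
  obtain ⟨c, hc, h1, h2⟩ := exists_step_over H (a_mem_interval (Q := Q) m)
  rw [pathHt_eq hc h1 h2]
  obtain ⟨c1, c2, c3, c4⟩ := mem_steps.1 hc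
  rcases (Q.a_strictMono.le_iff_le.1 h1).eq_or_lt with h | h
  · rw [← h, ht_left]
  · rcases (Q.a_strictMono.le_iff_le.1 h2).eq_or_lt with h' | h'
    · rw [h', ht_right c3]
    · exact absurd ⟨h, h'⟩ (c4 _ hm)

theorem pathHt_of_not_mem {H : Set (Fin n)} {b : Fin n} (hb : b ∉ H) :
    (Q.Up b → Q.pathHt H (Q.a (inner b)) < Q.f (inner b)) ∧
      (¬ Q.Up b → Q.f (inner b) < Q.pathHt H (Q.a (inner b))) := by
  obtain ⟨c, hc, h1, h2⟩ := exists_step_over H (a_mem_interval (Q := Q) (inner b))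
  rw [pathHt_eq hc h1 h2]
  have hb' : inner b ∉ verts H := fun h => hb (inner_mem_verts.1 h)
  obtain ⟨c1, c2, c3, c4⟩ := mem_steps.1 hc
  have h3 : c.1 < inner b := lt_of_le_of_ne (Q.a_strictMono.le_iff_le.1 h1) fun h => hb' (h ▸ c1)
  have h4 : inner b < c.2 := lt_of_le_of_ne (Q.a_strictMono.le_iff_le.1 h2) fun h => hb' (h ▸ c2)
  exact ⟨fun hU => ht_lt_of_isUp h3 h4 hU, fun hU => lt_ht_of_not_isUp h3 h4 hU⟩

theorem gap_pathPt {H : Set (Fin n)} {b : Fin n} (hb : b ∈ H) {t : ℝ} (ht : t ∈ Q.interval) :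
    Q.gap b (Q.pathPt H t) = 0 := by
  obtain ⟨c, hc, hsupp⟩ := pathPt_support (H := H) ht
  obtain ⟨c1, c2, c3, c4⟩ := mem_steps.1 hc
  have hb' : inner b ∈ verts H := inner_mem_verts.2 hb
  rcases le_or_gt c.2 (inner b) with h | h
  · refine gap_eq_zero_of_le (pathPt_mem ht) fun m hm => ?_
    rcases hsupp m hm with rfl | rfl
    exacts [c3.le.trans h, h]
  · have h' : inner b ≤ c.1 := not_lt.1 fun h' => c4 _ hb' ⟨h', h⟩
    refine gap_eq_zero_of_ge (pathPt_mem ht) fun m hm => ?_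
    rcases hsupp m hm with rfl | rfl
    exacts [h', h'.trans c3.le]

theorem support_pathPt_mem_verts {H : Set (Fin n)} {t : ℝ} (ht : t ∈ Q.interval)
    {m : Fin (n + 2)} (hm : Q.pathPt H t m ≠ 0) : m ∈ verts H := by
  obtain ⟨c, hc, hsupp⟩ := pathPt_support (H := H) ht
  rcases hsupp m hm with rfl | rfl
  exacts [(mem_steps.1 hc).1, (mem_steps.1 hc).2.1]

/-- On the paths above a given path, the lifting functional of the given path is the concave part. -/
theorem liftMap_pathPt_of_le {x : Equiv.Perm (Fin n)} {k l : ℕ} (hkl : k ≤ l) {t : ℝ}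
    (ht : t ∈ Q.interval) :
    Q.liftMap (toggled Q.Up x k) (Q.pathPt (toggled Q.Up x l) t) =
      Q.capPart (toggled Q.Up x k) t := by
  have h := (liftMap_eq_cap_iff (Q := Q) (toggled Q.Up x k)
    (pathPt_mem (Q := Q) (H := toggled Q.Up x l) ht)).2 ⟨fun m hm => ?_, fun b hU hb => ?_⟩
  · rwa [φ_pathPt ht] at h
  · rw [← pathHt_of_mem_verts (support_pathPt_mem_verts ht hm)]
    exact pathHt_mono hkl (a_mem_interval m)
  · refine gap_pathPt ?_ ht
    rw [mem_toggled] at hb ⊢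
    exact ⟨fun _ => (hb.1 hU).trans_le hkl, fun _ => hU⟩

theorem liftMap_pathPt_of_ge {x : Equiv.Perm (Fin n)} {k l : ℕ} (hkl : l ≤ k) {t : ℝ}
    (ht : t ∈ Q.interval) :
    Q.liftMap (toggled Q.Up x k) (Q.pathPt (toggled Q.Up x l) t) =
      Q.pathHt (toggled Q.Up x l) t - Q.cupPart (toggled Q.Up x k) t := by
  have h := (liftMap_eq_sub_cup_iff (Q := Q) (toggled Q.Up x k)
    (pathPt_mem (Q := Q) (H := toggled Q.Up x l) ht)).2 ⟨fun m hm => ?_, fun b hU hb => ?_⟩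
  · rwa [φ_pathPt ht] at h
  · rw [← pathHt_of_mem_verts (support_pathPt_mem_verts ht hm)]
    exact pathHt_mono hkl (a_mem_interval m)
  · refine gap_pathPt ?_ ht
    rw [mem_toggled] at hb ⊢
    exact ⟨fun h => absurd h hU, fun h => absurd (hb.2 (h.trans_le hkl)) hU⟩

theorem integrable_of_continuous {g : ℝ → ℝ} (hg : Continuous g) :
    Integrable g (unitVolume Q.interval) :=
  isBase_interval.integrable_of_continuousOn hg.continuousOn

/-- The lifting functionals of the paths of a permutation belong to its normal cone. -/
theorem liftMap_mem_normalCone (hn : 1 ≤ n) (x : Equiv.Perm (Fin n)) (k : ℕ) :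
    Q.liftMap (toggled Q.Up x k) ∈ normalCone Q.permutohedron (Q.permVertex x) := by
  set H := toggled Q.Up x k with hH
  set W := Q.liftMap H with hW
  have hcap := integrable_of_continuous (Q := Q) (continuous_capPart (Q := Q) H)
  have hcup := integrable_of_continuous (Q := Q) (continuous_cupPart (Q := Q) H)
  -- bounds on the cube
  have hle : ∀ p ∈ Q.cube, W p ≤ ∫ t, Q.capPart H t ∂(unitVolume Q.interval) ∧
      W p ≤ Q.heightMap p - ∫ t, Q.cupPart H t ∂(unitVolume Q.interval) := by
    intro p hp
    obtain ⟨γ, hγ, rfl⟩ := mem_cube.1 hp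
    have hi := integrable_section hγ
    rw [map_integral W hi, map_integral Q.heightMap hi,
      ← integral_sub (integrable_map Q.heightMap hi) hcup]
    constructor
    · refine integral_mono_ae (integrable_map W hi) hcap ?_
      filter_upwards [isBase_interval.ae_mem] with t ht
      have := liftMap_le_cap (Q := Q) H (IsSection.mem_simplex hγ ht)
      rwa [IsSection.φ_fst hγ ht] at this
    · refine integral_mono_ae (integrable_map W hi)
        ((integrable_map Q.heightMap hi).sub hcup) ?_
      filter_upwards [isBase_interval.ae_mem] with t ht
      have := liftMap_le_sub_cup (Q := Q) H (IsSection.mem_simplex hγ ht)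
      rwa [IsSection.φ_fst hγ ht] at this
  -- the bounds are attained on the path
  have hup : ∀ l, k ≤ l →
      W (Q.pathVertex x l) = ∫ t, Q.capPart H t ∂(unitVolume Q.interval) := by
    intro l hl
    rw [pathVertex, cubeVertex_eq, map_integral W (integrable_pathPt _)]
    refine integral_congr_ae ?_
    filter_upwards [isBase_interval.ae_mem] with t ht using liftMap_pathPt_of_le hl ht
  have hdown : ∀ l, l ≤ k → W (Q.pathVertex x l) =
      Q.heightMap (Q.pathVertex x l) - ∫ t, Q.cupPart H t ∂(unitVolume Q.interval) := by
    intro l hl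
    rw [heightMap_pathVertex, ← integral_sub (integrable_pathHt _) hcup, pathVertex,
      cubeVertex_eq, map_integral W (integrable_pathPt _)]
    refine integral_congr_ae ?_
    filter_upwards [isBase_interval.ae_mem] with t ht using liftMap_pathPt_of_ge hl ht
  have hattain : ∀ p ∈ Q.monotonePath x, W p = ∫ t, Q.capPart H t ∂(unitVolume Q.interval) ∨
      W p = Q.heightMap p - ∫ t, Q.cupPart H t ∂(unitVolume Q.interval) := by
    intro p hp
    rw [monotonePath_eq] at hp
    obtain ⟨l, -, r, r', hr, hr', hrr, rfl⟩ := Set.mem_iUnion₂.1 hp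
    simp only [map_add, map_smul, smul_eq_mul]
    rcases le_or_gt k l with hl | hl
    · rw [hup l hl, hup (l + 1) (by omega), ← add_mul, hrr, one_mul]
      exact Or.inl rfl
    · rw [hdown l hl.le, hdown (l + 1) hl]
      refine Or.inr ?_
      linear_combination (-∫ t, Q.cupPart H t ∂(unitVolume Q.interval)) * hrr
  rw [permVertex_eq hn, permutohedron, ← image_cube hn x]
  have hB : IsBase (Q.φ '' Q.cube) := image_cube hn x ▸ isBase_fiberSegment hn x
  refine mem_normalCone_of_ae_le hB isBounded_cube
    (hB.integrable_of_continuousOn ?_) ?_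
  · rw [image_cube hn x]
    exact continuousOn_monotoneSection hn x
  · filter_upwards [hB.ae_mem] with q hq p hp h
    rw [image_cube hn x] at hq
    obtain ⟨h1, h2⟩ := monotoneSection_mem hn hq
    have h3 : Q.heightMap p = Q.heightMap (Q.monotoneSection x q) := by
      rw [heightMap_apply, heightMap_apply, h2, h]
    rcases hattain _ h1 with h4 | h4
    · rw [h4]
      exact (hle p hp).1
    · rw [h4, ← h3]
      exact (hle p hp).2

/-- A point over the triangle of `b` on which the lifting functionals of the two paths at the
triangle are maximal lies in the face of the triangle. -/
theorem support_subset_of_liftMap {x : Equiv.Perm (Fin n)} {b : Fin n} {i j : Fin (n + 2)}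
    (hs : IsStep Q.Up x b i j) {p : Fin (n + 2) → ℝ} (hp : p ∈ simplex n)
    (hi : Q.a i < (Q.φ p).1) (hj : (Q.φ p).1 < Q.a j)
    (h1 : Q.liftMap (toggled Q.Up x (x.symm b)) p =
      Q.capPart (toggled Q.Up x (x.symm b)) (Q.φ p).1)
    (h2 : Q.liftMap (toggled Q.Up x (x.symm b + 1)) p =
      (Q.φ p).2 - Q.cupPart (toggled Q.Up x (x.symm b + 1)) (Q.φ p).1)
    {m : Fin (n + 2)} (hm : p m ≠ 0) : m = i ∨ m = inner b ∨ m = j := by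
  obtain ⟨a1, g1⟩ := (liftMap_eq_cap_iff _ hp).1 h1
  obtain ⟨a2, g2⟩ := (liftMap_eq_sub_cup_iff _ hp).1 h2
  have hgap : ∀ b', b' ∈ toggled Q.Up x (x.symm b) → b' ∈ toggled Q.Up x (x.symm b + 1) →
      Q.gap b' p = 0 := by
    intro b' hb hb'
    by_cases hU : Q.Up b'
    · exact g1 b' hU hb
    · exact g2 b' hU hb'
  have him : i ≤ m := by
    by_cases h0 : i = 0
    · rw [h0]
      exact Fin.zero_le m
    · obtain ⟨b', rfl⟩ := exists_inner h0 fun h => by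
        have := hs.left_lt
        rw [h] at this
        exact absurd this (not_lt.2 (Fin.le_last _))
      exact ge_of_gap_eq_zero hp (hgap b' (inner_mem_verts.1 hs.left_mem)
        (inner_mem_verts.1 hs.left_mem')) hi hm
  have hmj : m ≤ j := by
    by_cases h0 : j = Fin.last (n + 1)
    · rw [h0]
      exact Fin.le_last m
    · obtain ⟨b', rfl⟩ := exists_inner (v := j) (fun h => by
        have := hs.lt_right
        rw [h] at this
        exact absurd this (not_lt.2 (Fin.zero_le _))) h0
      exact le_of_gap_eq_zero hp (hgap b' (inner_mem_verts.1 hs.right_mem)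
        (inner_mem_verts.1 hs.right_mem')) hj hm
  rcases him.eq_or_lt with h | him
  · exact Or.inl h.symm
  rcases hmj.eq_or_lt with h | hmj
  · exact Or.inr (Or.inr h)
  refine Or.inr (Or.inl ?_)
  obtain ⟨b', rfl⟩ := exists_inner_of_lt him hmj
  by_contra hne
  have hbb : b' ≠ b := fun h => hne (by rw [h])
  -- the vertex is between the two paths, hence on one of them
  have hiff : b' ∈ toggled Q.Up x (x.symm b + 1) ↔ b' ∈ toggled Q.Up x (x.symm b) :=
    toggled_succ hbb
  have hmem : b' ∈ toggled Q.Up x (x.symm b) := by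
    by_contra hcon
    have hcon' := fun h => hcon (hiff.1 h)
    by_cases hU : Q.Up b'
    · exact absurd ((pathHt_of_not_mem hcon').1 hU) (a2 _ hm).not_gt
    · exact absurd ((pathHt_of_not_mem hcon).2 hU) (a1 _ hm).not_gt
  exact hne (hs.eq_of_mem _ (inner_mem_verts.2 hmem) him hmj)

theorem exists_mem_of_ae (hn : 1 ≤ n) {O : Set (ℝ × ℝ)} (hO : IsOpen O) (hne : O.Nonempty)
    (hsub : O ⊆ Q.polygon) {P : ℝ × ℝ → Prop} (hP : ∀ᵐ q ∂(unitVolume Q.polygon), P q) :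
    ∃ q ∈ O, P q := by
  by_contra! hcon
  rw [(isBase_polygon hn).ae_iff, baseVolume_polygon hn] at hP
  have h0 := measure_mono_null (fun q hq => hcon q hq) (ae_iff.1 hP)
  rw [Measure.restrict_apply hO.measurableSet, Set.inter_eq_left.2 hsub] at h0
  exact (hO.measure_pos volume hne).ne' h0

/-- A generic point of a face of the simplex has no vanishing coordinate on the face. -/
theorem ne_zero_of_generic {i j k : Fin (n + 2)} (hij : i < j) (hjk : j < k)
    {p : Fin (n + 2) → ℝ} (hp : p ∈ convexHull ℝ {e i, e j, e k}) (hg : Q.Generic (Q.φ p)) :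
    p i ≠ 0 ∧ p j ≠ 0 ∧ p k ≠ 0 := by
  obtain ⟨hps, hsupp⟩ := support_of_mem_convexHull hp
  have key : ∀ c : Fin (n + 2) × Fin (n + 2), c.1 < c.2 →
      (∀ m, m ≠ c.1 → m ≠ c.2 → p m = 0) → False := by
    intro c hc h
    refine hg.snd_ne c hc (sub_eq_zero.1 ?_)
    rw [φ_snd_sub_ht hps.2]
    refine Finset.sum_eq_zero fun m _ => ?_
    by_cases h1 : m = c.1
    · rw [h1, ht_left, sub_self, mul_zero]
    by_cases h2 : m = c.2
    · rw [h2, ht_right hc, sub_self, mul_zero]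
    rw [h m h1 h2, zero_mul]
  refine ⟨fun h => key (j, k) hjk fun m h1 h2 => ?_, fun h => key (i, k) (hij.trans hjk)
    fun m h1 h2 => ?_, fun h => key (i, j) hij fun m h1 h2 => ?_⟩
  · by_cases hm : m = i
    · rw [hm, h]
    · exact hsupp m hm h1 h2
  · by_cases hm : m = j
    · rw [hm, h]
    · exact hsupp m h1 hm h2
  · by_cases hm : m = k
    · rw [hm, h]
    · exact hsupp m h1 h2 hm

theorem triple_eq {N : ℕ} {i j k i' j' k' : Fin N} (hij : i < j) (hjk : j < k) (hij' : i' < j')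
    (hjk' : j' < k') (h1 : i' = i ∨ i' = j ∨ i' = k) (h2 : j' = i ∨ j' = j ∨ j' = k)
    (h3 : k' = i ∨ k' = j ∨ k' = k) : i' = i ∧ j' = j ∧ k' = k := by
  omega

variable {T : Q.Triangulation} {x : Equiv.Perm (Fin n)}

/-- The triangles of a permutation belong to each triangulation whose normal cone contains the
normal cone of the permutation. -/
theorem triangle_mem (hn : 1 ≤ n) (hT : normalCone Q.permutohedron (Q.permVertex x) ⊆
      normalCone Q.associahedron T.vertex) {b : Fin n} {i j : Fin (n + 2)}
    (hs : IsStep Q.Up x b i j) : (i, inner b) ∈ T.1 ∧ (inner b, j) ∈ T.1 ∧ (i, j) ∈ T.1 := by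
  obtain ⟨O, hO, hne, hsub, hprop⟩ := exists_isOpen_triangle hs
  have hw1 := liftMap_mem_normalCone (Q := Q) hn x (x.symm b)
  have hw2 := liftMap_mem_normalCone (Q := Q) hn x (x.symm b + 1)
  obtain ⟨q, hqO, hq1, hq2, hq, hg⟩ := exists_mem_of_ae hn hO hne hsub
    ((ae_eq_liftSection hn hw1 (hT hw1)).and
      ((ae_eq_liftSection hn hw2 (hT hw2)).and (ae_generic_polygon hn)))
  obtain ⟨hi, hb, hlow, hhigh⟩ := hprop q hqO
  have hqi := φ_fst_of_mem_polygon hq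
  have hseg := liftSection_mem_segment hn x hq hg (x.symm b).2 hlow hhigh
  obtain ⟨hpx, hφx⟩ := liftSection_mem (T := Q.permTriangulation x) hn hq
  obtain ⟨hpT, hφT⟩ := liftSection_mem (T := T) hn hq
  set p := T.liftSection q with hp
  have hps := lift_subset_simplex T hpT
  -- the values of the lifting functionals, by interpolation between the two paths
  have e1 : Q.liftMap (toggled Q.Up x (x.symm b)) p =
      Q.capPart (toggled Q.Up x (x.symm b)) (Q.φ p).1 := by
    rw [hq1, hφT]
    obtain ⟨r, r', hr, hr', hrr, he⟩ := hseg
    rw [← he, map_add, map_smul, map_smul, liftMap_pathPt_of_le le_rfl hqi,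
      liftMap_pathPt_of_le (Nat.le_succ _) hqi, ← add_smul, hrr, one_smul]
  have e2 : Q.liftMap (toggled Q.Up x (x.symm b + 1)) p =
      (Q.φ p).2 - Q.cupPart (toggled Q.Up x (x.symm b + 1)) (Q.φ p).1 := by
    rw [hq2, hφT]
    obtain ⟨r, r', hr, hr', hrr, he⟩ := hseg
    have h2 : r * Q.pathHt (toggled Q.Up x (x.symm b)) q.1 +
        r' * Q.pathHt (toggled Q.Up x (x.symm b + 1)) q.1 = q.2 := by
      rw [← he, map_add, map_smul, map_smul, φ_pathPt hqi, φ_pathPt hqi] at hφx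
      exact congrArg Prod.snd hφx
    rw [← he, map_add, map_smul, map_smul, liftMap_pathPt_of_ge (Nat.le_succ _) hqi,
      liftMap_pathPt_of_ge le_rfl hqi, smul_eq_mul, smul_eq_mul]
    linear_combination h2 - Q.cupPart (toggled Q.Up x (x.symm b + 1)) q.1 * hrr
  have hsupp : ∀ m, p m ≠ 0 → m = i ∨ m = inner b ∨ m = j := fun m hm =>
    support_subset_of_liftMap hs hps (hφT.symm ▸ hi)
      (hφT.symm ▸ hb.trans (Q.a_strictMono hs.lt_right)) e1 e2 hm
  have hpT' := hpT
  simp only [Triangulation.lift, Set.mem_iUnion] at hpT'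
  obtain ⟨i', j', k', hijk, hmem⟩ := hpT'
  have hij' := T.isTriang.lt _ hijk.1
  have hjk' := T.isTriang.lt _ hijk.2.1
  obtain ⟨n1, n2, n3⟩ := ne_zero_of_generic hij' hjk' hmem (hφT.symm ▸ hg)
  obtain ⟨rfl, rfl, rfl⟩ := triple_eq hs.left_lt hs.lt_right hij' hjk' (hsupp _ n1) (hsupp _ n2)
    (hsupp _ n3)
  exact hijk

theorem permTriangulation_eq (hn : 1 ≤ n) (hT : normalCone Q.permutohedron (Q.permVertex x) ⊆
      normalCone Q.associahedron T.vertex) : Q.permTriangulation x = T := by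
  have key : ∀ k ≤ n, ∀ c ∈ steps (toggled Q.Up x k), c ∈ T.1 := by
    intro k
    induction k with
    | zero =>
      intro _ c hc
      exact T.isTriang.mem c (mem_steps.1 hc).2.2.1 fun d hd h1 h2 =>
        Or.inl (leChord_of_steps_zero (up := Q.IsUp) hc h2 h1)
    | succ k ih =>
      intro hk c hc
      by_cases hc' : c ∈ steps (toggled Q.Up x k)
      · exact ih (by omega) c hc'
      · obtain ⟨b, rfl⟩ : ∃ b, (x.symm b : ℕ) = k := ⟨x ⟨k, hk⟩, by simp⟩
        obtain ⟨i, j, hs⟩ := exists_isStep Q.Up x b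
        obtain ⟨t1, t2, t3⟩ := triangle_mem hn hT hs
        rcases hs.mem_steps_succ hc hc' with ⟨-, rfl | rfl⟩ | ⟨-, rfl⟩
        exacts [t1, t2, t3]
  refine Subtype.ext (Set.Subset.antisymm ?_ ?_)
  · intro c hc
    obtain ⟨k, hk, hc⟩ := mem_chords.1 hc
    exact key k hk c hc
  · refine (Q.permTriangulation x).2.2 T.2.1 ?_
    intro c hc
    obtain ⟨k, hk, hc⟩ := mem_chords.1 hc
    exact key k hk c hc

end Uniqueness

end CambrianPolygon

theorem theorem6p2 (n : ℕ) (hn : 1 ≤ n) (Q : CambrianPolygon n) :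
    ∃ η : Equiv.Perm (Fin n) → Q.Triangulation,
      (∀ (x : Equiv.Perm (Fin n)) (T : Q.Triangulation),
        η x = T ↔
          normalCone Q.permutohedron (Q.permVertex x) ⊆ normalCone Q.associahedron T.vertex) ∧
      (∀ x : Equiv.Perm (Fin n),
        (η x).1 = ⋃ k ∈ Set.Iic n, CambrianPolygon.steps (Q.pathSet x k)) ∧
      ∃ Θ : LatticeCon (Equiv.Perm (Fin n)),
        (∀ x y : Equiv.Perm (Fin n), Θ.r x y ↔ η x = η y) ∧
        Θ = cambrianCon Q.orientation ∧
        ∃ E : Θ.Quot ≃o CambrianLattice Q.orientation,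
          ∀ x : Equiv.Perm (Fin n),
            E (LatticeCon.Quot.mk Θ x) = LatticeCon.Quot.mk (cambrianCon Q.orientation) x := by
  refine ⟨Q.permTriangulation, fun x T => ⟨?_, fun hT => CambrianPolygon.permTriangulation_eq hn hT⟩,
    fun x => ?_, cambrianCon Q.orientation, fun x y => ?_, rfl, OrderIso.refl _, fun x => rfl⟩
  · rintro rfl
    exact CambrianPolygon.normalCone_subset hn x
  · simp only [Q.pathSet_eq]
    rfl
  · rw [Q.cambrianCon_iff]
    exact ⟨fun h => Subtype.ext h, fun h => congrArg Subtype.val h⟩
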